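/- Let $\mathbb{H}$ be the Heisenberg group, i.e. $\mathbb{R}^3$ with $x\cdot y=(x_1+y_1,\,x_2+y_2,\,x_3+y_3+\tfrac12(x_1y_2-x_2y_1))$, let $X_1=\partial_{x_1}-\tfrac12x_2\partial_{x_3}$, $X_2=\partial_{x_2}+\tfrac12x_1\partial_{x_3}$, let $\nabla=(X_1,X_2)$ be the sub-gradient with $|\nabla f|=((X_1f)^2+(X_2f)^2)^{1/2}$, and let $d(x)$ be the Carnot–Carathéodory distance from $x$ to the identity $0$: the infimum of $\int_0^1(a_1^2+a_2^2)^{1/2}\,ds$ over Lipschitz curves $\gamma:[0,1]\to\mathbb{H}$ joining $x$ to $0$ with $\gamma'=a_1X_1(\gamma)+a_2X_2(\gamma)$ almost everywhere, $a_1,a_2$ measurable. Let $N\ge1$ and $\Omega=\mathbb{H}^{\mathbb{Z}^N}$; write $i\sim j$ if $\sum_l|i_l-j_l|=1$. For $x\in\mathbb{H}$, $i\in\mathbb{Z}^N$, $\omega\in\Omega$ let $x\bullet_i\omega$ be the configuration with $i$-th coordinate $x$ and all other coordinates those of $\omega$. A function $f:\Omega\to\mathbb{R}$ is called $C^n$ (smooth)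 if $x\mapsto f(x\bullet_i\omega)$ is $C^n$ ($C^\infty$) on $\mathbb{H}$ for all $i,\omega$; put $\nabla_if(\omega)=\nabla\big(f(\cdot\bullet_i\omega)\big)(\omega_i)$. Let $(\phi_{\{i,j\}})_{i\sim j}$ be $C^2$ functions on $\Omega$, $\phi_{\{i,j\}}$ depending only on the coordinates $i,j$, with $\|\phi_{\{i,j\}}\|_\infty\le M$ and $\|\nabla_i\nabla_j\phi_{\{i,j\}}\|_\infty\le M$ for all $i\sim j$ and some $M\in(0,\infty)$. Let $p\ge2$, $\frac1p+\frac1q=1$, $\alpha>0$, $\varepsilon,\rho,\theta\in\mathbb{R}$ with $\varepsilon\rho>0$, and $\varepsilon>-\frac{\alpha}{2N}$ if $p=2$. For $i\in\mathbb{Z}^N$ and $\omega\in\Omega$ let $$U_i^\omega(x)=\alpha\, d(x)^p+\varepsilon\sum_{j\sim i}\big(d(x)+\rho\, d(\omega_j)\big)^2+\theta\sum_{j\sim i}\phi_{\{i,j\}}(x\bullet_i\omega),\qquad \mathbb{E}_i^\omega(dx)=\frac{e^{-U_i^\omega(x)}}{\int_{\mathbb{H}}e^{-U_i^\omega(y)}dy}\,dx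 ,$$ and for $g:\Omega\to\mathbb{R}$ write $\mathbb{E}_i^\omega(g)=\int g(x\bullet_i\omega)\,\mathbb{E}_i^\omega(dx)$. Then every $\mathbb{E}_i^\omega$ is a well-defined probability measure, and there is a constant $c\in(0,\infty)$, independent of $i$ and of the boundary condition $\omega$, such that for all $i$, all $\omega$ and all smooth $f:\Omega\to\mathbb{R}$ $$\mathbb{E}_i^\omega\Big(|f|^q\log\frac{|f|^q}{\mathbb{E}_i^\omega|f|^q}\Big)\le c\,\mathbb{E}_i^\omega\big(|\nabla_if|^q\big).$$ Here, whenever the right-hand side is finite, $|f|^q$ and $|f|^q\log\big(|f|^q/\mathbb{E}_i^\omega|f|^q\big)$ are $\mathbb{E}_i^\omega$-integrable; when it is infinite, nothing is claimed. -/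

import Mathlib

open MeasureTheory

noncomputable section

/-- The underlying manifold `ℝ³` of the Heisenberg group, with coordinates
`x.1`, `x.2.1`, `x.2.2`. The group law is
`x · y = (x₁ + y₁, x₂ + y₂, x₃ + y₃ + (x₁ y₂ - x₂ y₁) / 2)`, the identity is `0`, and the Haar
measure is Lebesgue measure `volume`. -/
abbrev Heis : Type := ℝ × ℝ × ℝ

namespace Heis

/-- The left invariant vector field `X₁ = ∂₁ - (x₂ / 2) ∂₃`. -/
def X₁ (x : Heis) : Heis := (1, 0, -(x.2.1 / 2))

/-- The left invariant vector field `X₂ = ∂₂ + (x₁ / 2) ∂₃`. -/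
def X₂ (x : Heis) : Heis := (0, 1, x.1 / 2)

/-- The horizontal frame `(X₁, X₂)`. -/
def X (k : Fin 2) : Heis → Heis := ![X₁, X₂] k

/-- The derivative `X_k f` of a function along the vector field `X_k`. -/
def lieDeriv (k : Fin 2) (f : Heis → ℝ) (x : Heis) : ℝ := fderiv ℝ f x (X k x)

/-- `γ : [0,1] → ℍ` is an admissible curve from `x` to `y` with coefficients `a₁, a₂`:
it is Lipschitz and `γ' = a₁ X₁(γ) + a₂ X₂(γ)` almost everywhere, `a₁, a₂` measurable. -/
structure IsAdmissible (x y : Heis) (γ : ℝ → Heis) (a₁ a₂ : ℝ → ℝ) : Prop where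
  lipschitz : ∃ K, LipschitzOnWith K γ (Set.Icc 0 1)
  measurable₁ : Measurable a₁
  measurable₂ : Measurable a₂
  deriv : ∀ᵐ s ∂(volume.restrict (Set.Icc (0 : ℝ) 1)),
    HasDerivAt γ (a₁ s • X₁ (γ s) + a₂ s • X₂ (γ s)) s
  source : γ 0 = x
  target : γ 1 = y

/-- The Carnot–Carathéodory distance: infimum of the lengths of admissible curves. -/
def ccDist (x y : Heis) : ℝ :=
  sInf {l : ℝ | ∃ γ a₁ a₂, IsAdmissible x y γ a₁ a₂ ∧
    l = ∫ s in (0 : ℝ)..1, Real.sqrt (a₁ s ^ 2 + a₂ s ^ 2)}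

/-- `d(x) = d(x, e)`, the distance to the identity. -/
def d (x : Heis) : ℝ := ccDist x 0

end Heis

/-- The sites of the lattice `ℤ^N`. -/
abbrev Site (N : ℕ) : Type := Fin N → ℤ

namespace Site

variable {N : ℕ}

/-- The `ℓ¹` lattice metric. -/
def dist1 (i j : Site N) : ℤ := ∑ l, |i l - j l|

/-- The finite set of nearest neighbours of `i`, i.e. of all `j` with `dist1 i j = 1`
(see `mem_neighbors`). -/
def neighbors (i : Site N) : Finset (Site N) :=
  {j ∈ Finset.Icc (i - 1) (i + 1) | dist1 i j = 1}

theorem mem_neighbors {i j : Site N} : j ∈ neighbors i ↔ dist1 i j = 1 := by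
  simp only [neighbors, Finset.mem_filter, Finset.mem_Icc, and_iff_right_iff_imp]
  intro h
  have key : ∀ l, |i l - j l| ≤ 1 := fun l => by
    rw [← h]
    exact Finset.single_le_sum (f := fun l => |i l - j l|) (fun _ _ => abs_nonneg _)
      (Finset.mem_univ l)
  refine ⟨fun l => ?_, fun l => ?_⟩ <;>
    · have := abs_le.mp (key l)
      simp only [Pi.sub_apply, Pi.add_apply, Pi.one_apply]
      omega

end Site

/-- The configuration space `Ω = ℍ^(ℤ^N)`. -/
abbrev Config (N : ℕ) : Type := Site N → Heis

namespace Config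

variable {N : ℕ}

/-- The configuration `x •ᵢ ω`: coordinate `i` is `x`, all others are those of `ω`. -/
def glue (i : Site N) (x : Heis) (ω : Config N) : Config N := Function.update ω i x

/-- `f ∈ C^(n)(Ω)`: every `fᵢ(·|ω) = f(· •ᵢ ω)` is of class `C^n` on `ℍ`. -/
def IsC (n : WithTop ℕ∞) (f : Config N → ℝ) : Prop :=
  ∀ (i : Site N) (ω : Config N), ContDiff ℝ n (fun x => f (glue i x ω))

/-- `X_{i,k} f(ω) = X_k fᵢ(x|ω)` at `x = ωᵢ`. -/
def siteDeriv (i : Site N) (k : Fin 2) (f : Config N → ℝ) (ω : Config N) : ℝ :=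
  Heis.lieDeriv k (fun x => f (glue i x ω)) (ω i)

/-- `|∇ᵢ f|(ω)`, the Euclidean length of `∇ᵢ f = (X_{i,1} f, X_{i,2} f)`. -/
def siteGradNorm (i : Site N) (f : Config N → ℝ) (ω : Config N) : ℝ :=
  Real.sqrt (∑ k, siteDeriv i k f ω ^ 2)

/-- `Φ = (φ_{i,j})`, indexed by unordered pairs of nearest neighbours, is a bounded potential of
range 1: each `φ_{i,j}` is `C²`, localised in `{i,j}`, and `φ_{i,j}` and `∇ᵢ∇ⱼ φ_{i,j}` are
bounded uniformly in `i ∼ j`. (The values of `φ` on other pairs are never used.) -/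
def IsBoundedPotential (φ : Sym2 (Site N) → Config N → ℝ) : Prop :=
  ∃ M : ℝ, 0 < M ∧ ∀ i j : Site N, Site.dist1 i j = 1 →
    IsC 2 (φ s(i, j)) ∧
    DependsOn (φ s(i, j)) {i, j} ∧
    (∀ ω, |φ s(i, j) ω| ≤ M) ∧
    ∀ ω k l, |siteDeriv i k (siteDeriv j l (φ s(i, j))) ω| ≤ M

/-- The single-site energy
`U_i^ω(x) = α d(x)^p + ε ∑_{j ∼ i} (d(x) + ρ d(ω_j))² + θ ∑_{j ∼ i} φ_{i,j}(x, ω_j)`. -/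
def energy (α p ε ρ θ : ℝ) (φ : Sym2 (Site N) → Config N → ℝ)
    (i : Site N) (ω : Config N) (x : Heis) : ℝ :=
  α * Heis.d x ^ p
    + ε * ∑ j ∈ Site.neighbors i, (Heis.d x + ρ * Heis.d (ω j)) ^ 2
    + θ * ∑ j ∈ Site.neighbors i, φ s(i, j) (glue i x ω)

/-- The single-site measure `E_i^ω(dx) = e^{-U_i^ω(x)} dx / ∫ e^{-U_i^ω}` on `ℍ`. -/
def siteMeasure (α p ε ρ θ : ℝ) (φ : Sym2 (Site N) → Config N → ℝ)
    (i : Site N) (ω : Config N) : Measure Heis :=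
  (volume : Measure Heis).tilted (fun x => -energy α p ε ρ θ φ i ω x)

end Config

end

/-! Expanding the square shows that, up to an additive constant and a bounded perturbation, the
boundary condition enters the energy only through a term `L * d x` with `L = 2ερ ∑ d(ω_j) ≥ 0`.
Hence it suffices to prove the inequality with a constant independent of `L`. No differentiability
of `d` is used. All that is kept of the potential is `IsConfining`: up to bounded errors, `U`
behaves like a radial function of slope comparable to the rate `H(x) = L + (1 + d x)^(p-1)`.

Around `x` the natural scale is `1/H(x)`: at this distance `U` moves by a bounded amount and `H` by
a bounded factor. Translations on both sides preserve volume and a homogeneous ball of radius `r`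
has volume `8 r^4`. This gives the basic tool, `exists_pseudo_poincare`: increments of `f` at scale
`λ/H`, weighted by `e^{-U} H^{4+q}`, are bounded by `λ^{4+q} ∫ e^{-U}|∇f|^q`.

The first consequence is a Poincaré inequality with the extra weight `H^q`
(`exists_weighted_poincare`). Where `d * H ≥ A`, a step of length about `A/H` towards the identity
multiplies `e^{-U}` by a factor exponentially large in `A`, so for large `A` half of the mass of
`|f-m|^q` is absorbed and the rest is increments. Where `d * H < A`, any two points are within a
bounded multiple of the natural scale, and `f` is compared with one of its values `m`.

The second is a bound for `|f-m|^q log⁺|f-m|^q` (`exists_entropy_bound`). As `p` and `q` are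
conjugate, `H * d ≤ H^q`, so `U` and the logarithm of the natural local size `Q e^U H^4` of
`|f-m|^q` are controlled by `H^q`, the weight in the Poincaré inequality. Where `|f-m|^q` exceeds
this size by a factor of order `16^k`, the integral of `|f-m|^q` leaves no room for comparable
values in the ball of radius `2^{-k}/H`, so the value is bounded by increments at that scale. The
gain `2^{-kq}` beats the logarithm, which is of order `k`, and the levels can be summed.

Finally `entropy_le_of_centered`, a Rothaus type inequality, bounds the entropy of `|f|^q` by
quantities that depend on `f - m` alone, both already bounded by the gradient, so no defect remains.
-/

noncomputable section

/-! ### Group law, homogeneous norm and invariance of Lebesgue measure. -/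

namespace Heis

/-- The group law of the Heisenberg group. -/
def hmul (x v : Heis) : Heis :=
  (x.1 + v.1, x.2.1 + v.2.1, x.2.2 + v.2.2 + (x.1 * v.2.1 - x.2.1 * v.1) / 2)

/-- The homogeneous norm `max (|v₁|, |v₂|, |v₃|^(1/2))`. -/
def hnorm (v : Heis) : ℝ := max (max |v.1| |v.2.1|) (Real.sqrt |v.2.2|)

/-- The one-parameter subgroup generated by `X k`. -/
def flow (k : Fin 2) (t : ℝ) : Heis := ![((t, 0, 0) : Heis), (0, t, 0)] k

theorem hmul_assoc (x y z : Heis) : hmul (hmul x y) z = hmul x (hmul y z) := by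
  simp only [hmul, Prod.mk.injEq]
  refine ⟨by ring, by ring, by ring⟩

theorem hmul_zero (x : Heis) : hmul x 0 = x := by simp [hmul]

theorem zero_hmul (x : Heis) : hmul 0 x = x := by simp [hmul]

theorem neg_hmul_cancel (x v : Heis) : hmul (-x) (hmul x v) = v := by
  simp only [hmul, Prod.fst_neg, Prod.snd_neg]
  ext <;> simp only [] <;> ring

theorem hmul_neg_cancel (x v : Heis) : hmul x (hmul (-x) v) = v := by
  simpa using neg_hmul_cancel (-x) v

theorem hnorm_lt_iff {v : Heis} {r : ℝ} (hr : 0 < r) :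
    hnorm v < r ↔ |v.1| < r ∧ |v.2.1| < r ∧ |v.2.2| < r ^ 2 := by
  simp only [hnorm, max_lt_iff, Real.sqrt_lt' hr, and_assoc]

theorem hnorm_le_iff {v : Heis} {r : ℝ} (hr : 0 ≤ r) :
    hnorm v ≤ r ↔ |v.1| ≤ r ∧ |v.2.1| ≤ r ∧ |v.2.2| ≤ r ^ 2 := by
  simp only [hnorm, max_le_iff, Real.sqrt_le_left hr, and_assoc]

theorem hnorm_nonneg (v : Heis) : 0 ≤ hnorm v := le_max_of_le_right (Real.sqrt_nonneg _)

theorem hnorm_neg (v : Heis) : hnorm (-v) = hnorm v := by simp [hnorm]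

theorem hnorm_zero : hnorm 0 = 0 := by simp [hnorm]

theorem continuous_hnorm : Continuous hnorm := by
  unfold hnorm; fun_prop

theorem continuous_hmul : Continuous fun z : Heis × Heis => hmul z.1 z.2 := by
  unfold hmul; fun_prop

@[fun_prop]
theorem _root_.Continuous.hmul {α : Type*} [TopologicalSpace α] {f g : α → Heis} (hf : Continuous f)
    (hg : Continuous g) : Continuous fun a => hmul (f a) (g a) :=
  continuous_hmul.comp (hf.prodMk hg)

/-- The twist in the central coordinate is at most `hnorm v * hnorm u`, which fits into the cross
term of `(hnorm v + hnorm u)^2`; hence the constant 1. -/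
theorem hnorm_hmul_le (v u : Heis) : hnorm (hmul v u) ≤ hnorm v + hnorm u := by
  have hv := (hnorm_le_iff (hnorm_nonneg v)).1 le_rfl
  have hu := (hnorm_le_iff (hnorm_nonneg u)).1 le_rfl
  have h1 := hnorm_nonneg v
  have h2 := hnorm_nonneg u
  rw [hnorm_le_iff (by positivity)]
  obtain ⟨a1, a2, a3⟩ := hv
  obtain ⟨b1, b2, b3⟩ := hu
  refine ⟨(abs_add_le _ _).trans (by gcongr), (abs_add_le _ _).trans (by gcongr), ?_⟩
  have e1 : |v.1 * u.2.1| ≤ hnorm v * hnorm u := by rw [abs_mul]; gcongr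
  have e2 : |v.2.1 * u.1| ≤ hnorm v * hnorm u := by rw [abs_mul]; gcongr
  simp only [hmul]
  rw [abs_le] at *
  constructor <;> nlinarith

theorem volume_hnorm_lt {r : ℝ} (hr : 0 < r) :
    volume {v : Heis | hnorm v < r} = ENNReal.ofReal (8 * r ^ 4) := by
  have : {v : Heis | hnorm v < r} =
      Metric.ball (0 : ℝ) r ×ˢ Metric.ball (0 : ℝ) r ×ˢ Metric.ball (0 : ℝ) (r ^ 2) := by
    ext v
    simp [hnorm_lt_iff hr]
  rw [this, Measure.volume_eq_prod, Measure.prod_prod, Measure.volume_eq_prod, Measure.prod_prod,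
    Real.volume_ball, Real.volume_ball, ← ENNReal.ofReal_mul (by positivity),
    ← ENNReal.ofReal_mul (by positivity)]
  congr 1; ring

theorem measurableSet_hnorm_lt (r : ℝ) : MeasurableSet {v : Heis | hnorm v < r} :=
  measurableSet_lt continuous_hnorm.measurable measurable_const

/-- Left and right translations are both of this triangular form. Each coordinate is translated by
an amount depending on the preceding ones, so two skew products suffice. -/
theorem measurePreserving_shear (a b c e g : ℝ) : MeasurePreserving
    (fun x : Heis => ((x.1 + a, x.2.1 + b, x.2.2 + (c + e * x.1 + g * x.2.1)) : Heis)) := by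
  have h2 : ∀ c : ℝ, MeasurePreserving
      (fun y : ℝ × ℝ => (y.1 + b, y.2 + (c + g * y.1))) (volume.prod volume)
      (volume.prod volume) := by
    intro c
    refine (measurePreserving_add_right volume b).skew_product
      (g := fun a b => b + (c + g * a)) ?_ ?_
    · unfold Function.uncurry; fun_prop
    · exact .of_forall fun a => (measurePreserving_add_right volume _).map_eq
  refine (measurePreserving_add_right (volume : Measure ℝ) a).skew_product
    (μc := (volume : Measure (ℝ × ℝ))) (μd := (volume : Measure (ℝ × ℝ)))
    (g := fun x y => (y.1 + b, y.2 + (c + e * x + g * y.1))) ?_ ?_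
  · unfold Function.uncurry; fun_prop
  · exact .of_forall fun a => (h2 _).map_eq

theorem measurePreserving_hmul_right (v : Heis) : MeasurePreserving (fun x => hmul x v) := by
  have h := measurePreserving_shear v.1 v.2.1 v.2.2 (v.2.1 / 2) (-(v.1 / 2))
  have e : (fun x => hmul x v) = fun x : Heis => ((x.1 + v.1, x.2.1 + v.2.1,
      x.2.2 + (v.2.2 + v.2.1 / 2 * x.1 + -(v.1 / 2) * x.2.1)) : Heis) := by
    funext x
    simp only [hmul, Prod.mk.injEq, true_and]
    ring
  rwa [e]

theorem measurePreserving_hmul_left (x : Heis) : MeasurePreserving (fun v => hmul x v) := by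
  have h := measurePreserving_shear x.1 x.2.1 x.2.2 (-(x.2.1 / 2)) (x.1 / 2)
  have e : (fun v => hmul x v) = fun v : Heis => ((v.1 + x.1, v.2.1 + x.2.1,
      v.2.2 + (x.2.2 + -(x.2.1 / 2) * v.1 + x.1 / 2 * v.2.1)) : Heis) := by
    funext v
    simp only [hmul, Prod.mk.injEq]
    refine ⟨by ring, by ring, by ring⟩
  rwa [e]

/-- Every element is a product of six elements of the two one-parameter subgroups,
of length controlled by its homogeneous norm. -/
theorem exists_flow_factorization (v : Heis) : ∃ s t : ℝ, |s| ≤ 2 * hnorm v ∧ |t| ≤ 2 * hnorm v ∧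
    v = hmul (hmul (hmul (hmul (hmul (flow 0 v.1) (flow 1 v.2.1)) (flow 0 s)) (flow 1 t))
      (flow 0 (-s))) (flow 1 (-t)) := by
  obtain ⟨h1, h2, h3⟩ := (hnorm_le_iff (hnorm_nonneg v)).1 le_rfl
  -- The first two flows reach `(v₁, v₂, v₁v₂/2)`. The missing central part `c` is supplied by the
  -- commutator of `flow 0 s` and `flow 1 t`, which is `(0, 0, s * t)`.
  set c := v.2.2 - v.1 * v.2.1 / 2 with hc
  have hn := hnorm_nonneg v
  have e1 : |v.1 * v.2.1| ≤ hnorm v * hnorm v := by rw [abs_mul]; gcongr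
  have hcb : |c| ≤ (2 * hnorm v) ^ 2 := by
    rw [abs_le] at *
    constructor <;> nlinarith
  have hs : Real.sqrt |c| ≤ 2 * hnorm v := by
    rw [Real.sqrt_le_left (by positivity)]; exact hcb
  have hss : Real.sqrt |c| * Real.sqrt |c| = |c| := Real.mul_self_sqrt (abs_nonneg c)
  have key : ∀ s t : ℝ, s * t = c → v = hmul (hmul (hmul (hmul (hmul (flow 0 v.1) (flow 1 v.2.1))
      (flow 0 s)) (flow 1 t)) (flow 0 (-s))) (flow 1 (-t)) := by
    intro s t hst
    simp only [hmul, flow, Matrix.cons_val_zero, Matrix.cons_val_one]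
    refine Prod.ext (by ring) (Prod.ext (by ring) ?_)
    simp only []
    linear_combination hc - hst
  rcases le_total 0 c with h | h
  · exact ⟨Real.sqrt |c|, Real.sqrt |c|, by rwa [abs_of_nonneg (Real.sqrt_nonneg _)],
      by rwa [abs_of_nonneg (Real.sqrt_nonneg _)], key _ _ (by rw [hss, abs_of_nonneg h])⟩
  · exact ⟨Real.sqrt |c|, -Real.sqrt |c|, by rwa [abs_of_nonneg (Real.sqrt_nonneg _)],
      by rwa [abs_neg, abs_of_nonneg (Real.sqrt_nonneg _)],
      key _ _ (by rw [mul_neg, hss, abs_of_nonpos h, neg_neg])⟩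

/-! ### Admissible curves and the displacement they can achieve. -/

theorem IsAdmissible.ae_hasDerivAt_coord {x y : Heis} {γ : ℝ → Heis} {a₁ a₂ : ℝ → ℝ}
    (h : IsAdmissible x y γ a₁ a₂) : ∀ᵐ s ∂(volume.restrict (Set.Icc (0 : ℝ) 1)),
      HasDerivAt (fun s => (γ s).1) (a₁ s) s ∧ HasDerivAt (fun s => (γ s).2.1) (a₂ s) s ∧
      HasDerivAt (fun s => (γ s).2.2) (a₂ s * (γ s).1 / 2 - a₁ s * (γ s).2.1 / 2) s := by
  filter_upwards [h.deriv] with s hs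
  have h1 := (ContinuousLinearMap.fst ℝ ℝ (ℝ × ℝ)).hasFDerivAt.comp_hasDerivAt s hs
  have h2' := (ContinuousLinearMap.snd ℝ ℝ (ℝ × ℝ)).hasFDerivAt.comp_hasDerivAt s hs
  have h2 := (ContinuousLinearMap.fst ℝ ℝ ℝ).hasFDerivAt.comp_hasDerivAt s h2'
  have h3 := (ContinuousLinearMap.snd ℝ ℝ ℝ).hasFDerivAt.comp_hasDerivAt s h2'
  simp only [X₁, X₂, Prod.smul_mk, Prod.mk_add_mk, smul_eq_mul, ContinuousLinearMap.coe_fst',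
    ContinuousLinearMap.coe_snd'] at h1 h2 h3
  refine ⟨by convert! h1 using 1; ring, by convert! h2 using 1; ring, by convert! h3 using 1; ring⟩

theorem ae_bound_of_lipschitz {f b : ℝ → ℝ} {K : NNReal} (hf : LipschitzOnWith K f (Set.Icc 0 1))
    (hb : ∀ᵐ s ∂(volume.restrict (Set.Icc (0 : ℝ) 1)), HasDerivAt f (b s) s) :
    ∀ᵐ s ∂(volume.restrict (Set.Icc (0 : ℝ) 1)), |b s| ≤ K := by
  rw [← restrict_Ioo_eq_restrict_Icc] at hb ⊢
  filter_upwards [hb, ae_restrict_mem measurableSet_Ioo] with s hs hmem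
  have := norm_deriv_le_of_lipschitzOn (Icc_mem_nhds hmem.1 hmem.2) hf
  rwa [hs.deriv] at this

/-- Lipschitz functions are absolutely continuous, so the fundamental theorem of calculus holds
although the derivative is known only almost everywhere. -/
theorem integral_eq_sub_of_lipschitz {f b : ℝ → ℝ} {K : NNReal}
    (hf : LipschitzOnWith K f (Set.Icc 0 1))
    (hb : ∀ᵐ s ∂(volume.restrict (Set.Icc (0 : ℝ) 1)), HasDerivAt f (b s) s) {t : ℝ}
    (ht : t ∈ Set.Icc (0 : ℝ) 1) : ∫ s in (0 : ℝ)..t, b s = f t - f 0 := by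
  have hsub : Set.uIcc 0 t ⊆ Set.Icc (0 : ℝ) 1 := by
    rw [Set.uIcc_of_le ht.1]; exact Set.Icc_subset_Icc_right ht.2
  rw [← (hf.mono hsub).absolutelyContinuousOnInterval.integral_deriv_eq_sub]
  refine intervalIntegral.integral_congr_ae ?_
  have := (ae_restrict_iff' measurableSet_Icc).1 hb
  filter_upwards [this] with s hs hmem
  exact (hs (hsub (Set.uIoc_subset_uIcc hmem))).deriv.symm

/-- The speed of the curve with coefficients `a₁, a₂`. -/
def speed (a₁ a₂ : ℝ → ℝ) (s : ℝ) : ℝ := Real.sqrt (a₁ s ^ 2 + a₂ s ^ 2)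

theorem speed_nonneg (a₁ a₂ : ℝ → ℝ) (s : ℝ) : 0 ≤ speed a₁ a₂ s := Real.sqrt_nonneg _

theorem abs_fst_le_speed (a₁ a₂ : ℝ → ℝ) (s : ℝ) : |a₁ s| ≤ speed a₁ a₂ s :=
  Real.abs_le_sqrt (by nlinarith [sq_nonneg (a₂ s)])

theorem abs_snd_le_speed (a₁ a₂ : ℝ → ℝ) (s : ℝ) : |a₂ s| ≤ speed a₁ a₂ s :=
  Real.abs_le_sqrt (by nlinarith [sq_nonneg (a₁ s)])

theorem speed_le (a₁ a₂ : ℝ → ℝ) (s : ℝ) : speed a₁ a₂ s ≤ |a₁ s| + |a₂ s| := by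
  refine Real.sqrt_le_iff.2 ⟨by positivity, ?_⟩
  nlinarith [sq_abs (a₁ s), sq_abs (a₂ s), mul_nonneg (abs_nonneg (a₁ s)) (abs_nonneg (a₂ s))]

theorem IsAdmissible.exists_lipschitz_coord {x y : Heis} {γ : ℝ → Heis} {a₁ a₂ : ℝ → ℝ}
    (h : IsAdmissible x y γ a₁ a₂) : ∃ K, LipschitzOnWith K (fun t => (γ t).1) (Set.Icc 0 1) ∧
      LipschitzOnWith K (fun t => (γ t).2.1) (Set.Icc 0 1) ∧
      LipschitzOnWith K (fun t => (γ t).2.2) (Set.Icc 0 1) := by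
  obtain ⟨K, hK⟩ := h.lipschitz
  exact ⟨K, fun s hs t ht => (le_max_left _ _).trans (hK hs ht),
    fun s hs t ht => ((le_max_left _ _).trans (le_max_right _ _)).trans (hK hs ht),
    fun s hs t ht => ((le_max_right _ _).trans (le_max_right _ _)).trans (hK hs ht)⟩

theorem IsAdmissible.integrableOn {x y : Heis} {γ : ℝ → Heis} {a₁ a₂ : ℝ → ℝ}
    (h : IsAdmissible x y γ a₁ a₂) : IntegrableOn (speed a₁ a₂) (Set.Icc 0 1) := by
  obtain ⟨K, h1, h2, -⟩ := h.exists_lipschitz_coord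
  have hd := h.ae_hasDerivAt_coord
  have b1 := ae_bound_of_lipschitz h1 (hd.mono fun s hs => hs.1)
  have b2 := ae_bound_of_lipschitz h2 (hd.mono fun s hs => hs.2.1)
  have hm : Measurable (speed a₁ a₂) := by
    have := h.measurable₁; have := h.measurable₂
    unfold speed; fun_prop
  refine Measure.integrableOn_of_bounded (M := K + K) (by simp) hm.aestronglyMeasurable ?_
  filter_upwards [b1, b2] with s h1 h2
  rw [Real.norm_eq_abs, abs_of_nonneg (speed_nonneg _ _ _)]
  exact (speed_le _ _ _).trans (add_le_add h1 h2)

theorem IsAdmissible.intervalIntegrable {x y : Heis} {γ : ℝ → Heis} {a₁ a₂ : ℝ → ℝ}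
    (h : IsAdmissible x y γ a₁ a₂) {s t : ℝ} (hs : s ∈ Set.Icc (0 : ℝ) 1)
    (ht : t ∈ Set.Icc (0 : ℝ) 1) : IntervalIntegrable (speed a₁ a₂) volume s t :=
  (h.integrableOn.mono_set (Set.uIcc_subset_Icc hs ht)).intervalIntegrable

/-- The displacement along an admissible curve is bounded by its length. -/
theorem IsAdmissible.hnorm_le {x y : Heis} {γ : ℝ → Heis} {a₁ a₂ : ℝ → ℝ}
    (h : IsAdmissible x y γ a₁ a₂) {t : ℝ} (ht : t ∈ Set.Icc (0 : ℝ) 1) :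
    hnorm (hmul (-x) (γ t)) ≤ ∫ s in (0 : ℝ)..t, speed a₁ a₂ s := by
  obtain ⟨K, h1, h2, h3⟩ := h.exists_lipschitz_coord
  have hd := h.ae_hasDerivAt_coord
  have h0 : (0 : ℝ) ∈ Set.Icc (0 : ℝ) 1 := by simp
  have hx : γ 0 = x := h.source
  set l : ℝ → ℝ := fun t => ∫ s in (0 : ℝ)..t, speed a₁ a₂ s with hl
  have lmono : ∀ s ∈ Set.Icc (0 : ℝ) t, l s ≤ l t := by
    intro s hs
    have hs' : s ∈ Set.Icc (0 : ℝ) 1 := ⟨hs.1, hs.2.trans ht.2⟩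
    have := intervalIntegral.integral_add_adjacent_intervals
      (h.intervalIntegrable h0 hs') (h.intervalIntegrable hs' ht)
    have h4 : 0 ≤ ∫ r in s..t, speed a₁ a₂ r :=
      intervalIntegral.integral_nonneg hs.2 fun r _ => speed_nonneg _ _ r
    simp only [hl]; linarith
  have bound : ∀ (f b : ℝ → ℝ) (K' : NNReal) (C : ℝ), LipschitzOnWith K' f (Set.Icc 0 1) →
      (∀ᵐ s ∂(volume.restrict (Set.Icc (0 : ℝ) 1)), HasDerivAt f (b s) s) → ∀ s ∈ Set.Icc 0 t,
      (∀ r ∈ Set.Icc 0 s, |b r| ≤ C * speed a₁ a₂ r) → |f s - f 0| ≤ C * l s := by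
    intro f b K' C hf hb s hs hC
    have hs' : s ∈ Set.Icc (0 : ℝ) 1 := ⟨hs.1, hs.2.trans ht.2⟩
    rw [← integral_eq_sub_of_lipschitz hf hb hs', ← Real.norm_eq_abs]
    refine (intervalIntegral.norm_integral_le_of_norm_le (g := fun r => C * speed a₁ a₂ r) hs.1
      (.of_forall fun r hr => hC r ⟨hr.1.le, hr.2⟩)
      ((h.intervalIntegrable h0 hs').const_mul C)).trans ?_
    rw [intervalIntegral.integral_const_mul]
  have c1 : ∀ s ∈ Set.Icc 0 t, |(γ s).1 - x.1| ≤ l s := by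
    intro s hs
    have := bound _ _ K 1 h1 (hd.mono fun s hs => hs.1) s hs
      fun r _ => by simpa using abs_fst_le_speed a₁ a₂ r
    simpa [hx] using this
  have c2 : ∀ s ∈ Set.Icc 0 t, |(γ s).2.1 - x.2.1| ≤ l s := by
    intro s hs
    have := bound _ _ K 1 h2 (hd.mono fun s hs => hs.2.1) s hs
      fun r _ => by simpa using abs_snd_le_speed a₁ a₂ r
    simpa [hx] using this
  have htt : t ∈ Set.Icc 0 t := ⟨ht.1, le_rfl⟩
  have l0 : 0 ≤ l t := (abs_nonneg _).trans (c1 t htt)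
  -- After left translation to the identity, the central coordinate has derivative `((γ₁-x₁)a₂ -
  -- (γ₂-x₂)a₁)/2`. By `c1` and `c2` this is at most `l t` times the speed, whence the square of the
  -- length.
  have c3 : |(hmul (-x) (γ t)).2.2| ≤ l t * l t := by
    set f : ℝ → ℝ := fun s => (hmul (-x) (γ s)).2.2 with hf
    have lip : ∃ K', LipschitzOnWith K' f (Set.Icc 0 1) := by
      have e : f = fun s => ((γ s).2.2 + (-x.2.2)) + ((x.2.1 / 2) * (γ s).1 +
          (-(x.1 / 2)) * (γ s).2.1) := by
        funext s; simp [hf, hmul]; ring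
      rw [e]
      have l1 : ∀ c : ℝ, LipschitzWith ‖c‖₊ fun r : ℝ => c * r := fun c =>
        lipschitzWith_smul c
      exact ⟨_, (h3.add ((LipschitzWith.const _).lipschitzOnWith)).add
        (((l1 _).comp_lipschitzOnWith h1).add ((l1 _).comp_lipschitzOnWith h2))⟩
    obtain ⟨K', hK'⟩ := lip
    have hdf : ∀ᵐ s ∂(volume.restrict (Set.Icc (0 : ℝ) 1)), HasDerivAt f
        ((((γ s).1 - x.1) * a₂ s - ((γ s).2.1 - x.2.1) * a₁ s) / 2) s := by
      filter_upwards [hd] with s hs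
      obtain ⟨d1, d2, d3⟩ := hs
      have := (d3.const_add (-x.2.2)).add (((d2.const_mul (-x.1)).sub (d1.const_mul (-x.2.1))).div_const 2)
      convert! this using 1
      ring
    have := bound f _ K' (l t) hK' hdf t htt ?_
    · have f0 : f 0 = 0 := by simp only [hf, hx, hmul]; simp; ring
      simpa [f0] using this
    · intro r hr
      have e1 := (c1 r hr).trans (lmono r hr)
      have e2 := (c2 r hr).trans (lmono r hr)
      rw [abs_div, abs_two, div_le_iff₀ two_pos]
      refine (abs_sub _ _).trans ?_
      rw [abs_mul, abs_mul]
      have s1 := abs_fst_le_speed a₁ a₂ r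
      have s2 := abs_snd_le_speed a₁ a₂ r
      have := mul_le_mul e1 s2 (abs_nonneg _) l0
      have := mul_le_mul e2 s1 (abs_nonneg _) l0
      linarith
  rw [hnorm_le_iff l0]
  refine ⟨?_, ?_, by rw [sq]; exact c3⟩
  · have := c1 t htt
    simp only [hmul, Prod.fst_neg]
    rwa [neg_add_eq_sub]
  · have := c2 t htt
    simp only [hmul, Prod.fst_neg, Prod.snd_neg]
    rwa [neg_add_eq_sub]

/-! ### Operations on admissible curves and horizontal connectivity. -/

/-- The lengths of the admissible curves from `x` to `y`. -/
def lengths (x y : Heis) : Set ℝ :=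
  {l : ℝ | ∃ γ a₁ a₂, IsAdmissible x y γ a₁ a₂ ∧ l = ∫ s in (0 : ℝ)..1, speed a₁ a₂ s}

theorem lengths_nonneg {x y : Heis} {l : ℝ} (h : l ∈ lengths x y) : 0 ≤ l := by
  obtain ⟨γ, a₁, a₂, -, rfl⟩ := h
  exact intervalIntegral.integral_nonneg zero_le_one fun r _ => speed_nonneg _ _ r

theorem bddBelow_lengths (x y : Heis) : BddBelow (lengths x y) :=
  ⟨0, fun _ h => lengths_nonneg h⟩

theorem ae_comp_affine {P : ℝ → Prop} (b c u v : ℝ) (hc : c ≠ 0)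
    (hP : ∀ᵐ s ∂(volume.restrict (Set.Icc (0 : ℝ) 1)), P s)
    (h : ∀ t ∈ Set.Icc u v, b + c * t ∈ Set.Icc (0 : ℝ) 1) :
    ∀ᵐ t ∂(volume.restrict (Set.Icc u v)), P (b + c * t) := by
  rw [ae_restrict_iff' measurableSet_Icc] at hP ⊢
  have := ((measurePreserving_add_left (volume : Measure ℝ) b).quasiMeasurePreserving.comp
    (Measure.quasiMeasurePreserving_smul volume hc)).ae hP
  filter_upwards [this] with t ht hmem
  exact ht (h t hmem)

theorem hasDerivAt_comp_affine {γ : ℝ → Heis} {w : Heis} (b c t : ℝ)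
    (h : HasDerivAt γ w (b + c * t)) : HasDerivAt (fun s => γ (b + c * s)) (c • w) t := by
  have h1 : HasDerivAt (fun s : ℝ => b + c * s) c t := by
    simpa using ((hasDerivAt_id t).const_mul c).const_add b
  exact h.scomp t h1

theorem lipschitzWith_affine (b c : ℝ) : LipschitzWith ‖c‖₊ fun s : ℝ => b + c * s := by
  have : LipschitzWith (0 + ‖c‖₊) fun s : ℝ => b + c * s :=
    (LipschitzWith.const b).add (lipschitzWith_smul c)
  simpa using this

theorem speed_comp_affine (a₁ a₂ : ℝ → ℝ) {c : ℝ} (hc : 0 ≤ c) (b s : ℝ) :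
    speed (fun t => c * a₁ (b + c * t)) (fun t => c * a₂ (b + c * t)) s =
      c * speed a₁ a₂ (b + c * s) := by
  simp only [speed, mul_pow, ← mul_add]
  rw [Real.sqrt_mul (by positivity), Real.sqrt_sq hc]

theorem IsAdmissible.restrict {x y : Heis} {γ : ℝ → Heis} {a₁ a₂ : ℝ → ℝ}
    (h : IsAdmissible x y γ a₁ a₂) {s : ℝ} (hs : s ∈ Set.Ico (0 : ℝ) 1) :
    IsAdmissible (γ s) y (fun t => γ (s + (1 - s) * t))
      (fun t => (1 - s) * a₁ (s + (1 - s) * t)) (fun t => (1 - s) * a₂ (s + (1 - s) * t)) where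
  lipschitz := by
    obtain ⟨K, hK⟩ := h.lipschitz
    refine ⟨_, hK.comp ((lipschitzWith_affine s (1 - s)).lipschitzOnWith (s := Set.Icc 0 1)) ?_⟩
    intro t ht
    have := hs.1; have := hs.2; have := ht.1; have := ht.2
    constructor <;> nlinarith
  measurable₁ := by have := h.measurable₁; fun_prop
  measurable₂ := by have := h.measurable₂; fun_prop
  deriv := by
    have h1 : (1 - s) ≠ 0 := by have := hs.2; linarith
    have := ae_comp_affine s (1 - s) 0 1 h1 h.deriv ?_
    · filter_upwards [this] with t ht
      simpa [smul_smul] using hasDerivAt_comp_affine _ _ _ ht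
    · intro t ht
      have := hs.1; have := hs.2; have := ht.1; have := ht.2
      constructor <;> nlinarith
  source := by simp
  target := by simpa using h.target

theorem IsAdmissible.integral_restrict_mem {x y : Heis} {γ : ℝ → Heis} {a₁ a₂ : ℝ → ℝ}
    (h : IsAdmissible x y γ a₁ a₂) {s : ℝ} (hs : s ∈ Set.Ico (0 : ℝ) 1) :
    ∫ t in s..1, speed a₁ a₂ t ∈ lengths (γ s) y := by
  refine ⟨_, _, _, h.restrict hs, ?_⟩
  have h1 : 0 ≤ 1 - s := by have := hs.2; linarith
  simp_rw [speed_comp_affine a₁ a₂ h1]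
  rw [intervalIntegral.integral_const_mul, intervalIntegral.mul_integral_comp_add_mul]
  simp

theorem isAdmissible_const (x : Heis) : IsAdmissible x x (fun _ => x) 0 0 where
  lipschitz := ⟨0, (LipschitzWith.const x).lipschitzOnWith⟩
  measurable₁ := measurable_zero
  measurable₂ := measurable_zero
  deriv := .of_forall fun s => by simpa using hasDerivAt_const s x
  source := rfl
  target := rfl

theorem zero_mem_lengths (x : Heis) : 0 ∈ lengths x x :=
  ⟨_, _, _, isAdmissible_const x, by simp [speed]⟩

/-- Concatenation as one formula: on each half of `[0,1]` one of the two clamped curves rests at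
`y`, which is subtracted. This makes the Lipschitz property immediate; the parameters have the shape
`b + c * t` required by the affine lemmas. -/
theorem IsAdmissible.trans {x y z : Heis} {γ γ' : ℝ → Heis} {a₁ a₂ a₁' a₂' : ℝ → ℝ}
    (h : IsAdmissible x y γ a₁ a₂) (h' : IsAdmissible y z γ' a₁' a₂') :
    IsAdmissible x z (fun t => γ (min (0 + 2 * t) 1) + γ' (max (-1 + 2 * t) 0) - y)
      (fun t => if t < 1 / 2 then 2 * a₁ (0 + 2 * t) else 2 * a₁' (-1 + 2 * t))
      (fun t => if t < 1 / 2 then 2 * a₂ (0 + 2 * t) else 2 * a₂' (-1 + 2 * t)) where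
  lipschitz := by
    obtain ⟨K, hK⟩ := h.lipschitz
    obtain ⟨K', hK'⟩ := h'.lipschitz
    have l1 := ((lipschitzWith_affine 0 2).min_const 1).lipschitzOnWith (s := Set.Icc 0 1)
    have l2 := ((lipschitzWith_affine (-1) 2).max_const 0).lipschitzOnWith (s := Set.Icc 0 1)
    have c1 := hK.comp l1 fun t ht => ⟨le_min (by linarith [ht.1]) zero_le_one, min_le_right _ _⟩
    have c2 := hK'.comp l2 fun t ht => ⟨le_max_right _ _, max_le (by linarith [ht.2]) zero_le_one⟩
    exact ⟨_, (c1.add c2).sub ((LipschitzWith.const y).lipschitzOnWith)⟩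
  measurable₁ := by
    have := h.measurable₁; have := h'.measurable₁
    exact Measurable.ite measurableSet_Iio (by fun_prop) (by fun_prop)
  measurable₂ := by
    have := h.measurable₂; have := h'.measurable₂
    exact Measurable.ite measurableSet_Iio (by fun_prop) (by fun_prop)
  deriv := by
    have e1 := ae_comp_affine 0 2 0 (1 / 2) two_ne_zero h.deriv
      fun t ht => ⟨by linarith [ht.1], by linarith [ht.2]⟩
    have e2 := ae_comp_affine (-1) 2 (1 / 2) 1 two_ne_zero h'.deriv
      fun t ht => ⟨by linarith [ht.1], by linarith [ht.2]⟩
    rw [ae_restrict_iff' measurableSet_Icc] at e1 e2 ⊢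
    have e3 : ∀ᵐ t : ℝ, t ≠ 1 / 2 := by simp [ae_iff]
    filter_upwards [e1, e2, e3] with t h1 h2 h3 ht
    rcases lt_or_gt_of_ne h3 with hlt | hgt
    · have ev : (fun t => γ (min (0 + 2 * t) 1) + γ' (max (-1 + 2 * t) 0) - y) =ᶠ[nhds t]
          fun t => γ (0 + 2 * t) := by
        filter_upwards [Iio_mem_nhds hlt] with s hs
        rw [Set.mem_Iio] at hs
        rw [min_eq_left (by linarith), max_eq_right (by linarith), h'.source]
        simp
      have hm : min (0 + 2 * t) 1 = 0 + 2 * t := min_eq_left (by linarith)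
      have hM : max (-1 + 2 * t) 0 = 0 := max_eq_right (by linarith)
      simp only [if_pos hlt, hm, hM, h'.source, add_sub_cancel_right]
      refine HasDerivAt.congr_of_eventuallyEq ?_ ev
      simpa [smul_smul] using hasDerivAt_comp_affine 0 2 t (h1 ⟨ht.1, hlt.le⟩)
    · have ev : (fun t => γ (min (0 + 2 * t) 1) + γ' (max (-1 + 2 * t) 0) - y) =ᶠ[nhds t]
          fun t => γ' (-1 + 2 * t) := by
        filter_upwards [Ioi_mem_nhds hgt] with s hs
        rw [Set.mem_Ioi] at hs
        rw [min_eq_right (by linarith), max_eq_left (by linarith), h.target]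
        simp
      have hm : min (0 + 2 * t) 1 = 1 := min_eq_right (by linarith)
      have hM : max (-1 + 2 * t) 0 = -1 + 2 * t := max_eq_left (by linarith)
      simp only [if_neg hgt.le.not_gt, hm, hM, h.target, add_sub_cancel_left]
      refine HasDerivAt.congr_of_eventuallyEq ?_ ev
      simpa [smul_smul] using hasDerivAt_comp_affine (-1) 2 t (h2 ⟨hgt.le, ht.2⟩)
  source := by simp [h.source, h'.source]
  target := by norm_num [h.target, h'.target]

theorem add_mem_lengths {x y z : Heis} {l l' : ℝ} (h : l ∈ lengths x y) (h' : l' ∈ lengths y z) :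
    l + l' ∈ lengths x z := by
  obtain ⟨γ, a₁, a₂, hγ, rfl⟩ := h
  obtain ⟨γ', a₁', a₂', hγ', rfl⟩ := h'
  have hT := hγ.trans hγ'
  refine ⟨_, _, _, hT, ?_⟩
  rw [← intervalIntegral.integral_add_adjacent_intervals (b := 1 / 2)
    (hT.intervalIntegrable (by norm_num) (by norm_num))
    (hT.intervalIntegrable (by norm_num) (by norm_num))]
  congr 1
  · have : ∀ᵐ t : ℝ, t ∈ Set.uIoc (0 : ℝ) (1 / 2) →
        speed (fun t => if t < 1 / 2 then 2 * a₁ (0 + 2 * t) else 2 * a₁' (-1 + 2 * t))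
          (fun t => if t < 1 / 2 then 2 * a₂ (0 + 2 * t) else 2 * a₂' (-1 + 2 * t)) t =
        2 * speed a₁ a₂ (0 + 2 * t) := by
      have e3 : ∀ᵐ t : ℝ, t ≠ 1 / 2 := by simp [ae_iff]
      filter_upwards [e3] with t h3 ht
      rw [Set.uIoc_of_le (by norm_num)] at ht
      rw [← speed_comp_affine a₁ a₂ zero_le_two]
      simp only [speed, if_pos (lt_of_le_of_ne ht.2 h3)]
    rw [intervalIntegral.integral_congr_ae this, intervalIntegral.integral_const_mul,
      intervalIntegral.mul_integral_comp_add_mul]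
    norm_num
  · have : ∀ t ∈ Set.uIcc (1 / 2 : ℝ) 1,
        speed (fun t => if t < 1 / 2 then 2 * a₁ (0 + 2 * t) else 2 * a₁' (-1 + 2 * t))
          (fun t => if t < 1 / 2 then 2 * a₂ (0 + 2 * t) else 2 * a₂' (-1 + 2 * t)) t =
        2 * speed a₁' a₂' (-1 + 2 * t) := by
      intro t ht
      rw [Set.uIcc_of_le (by norm_num)] at ht
      rw [← speed_comp_affine a₁' a₂' zero_le_two]
      simp only [speed, if_neg ht.1.not_gt]
    rw [intervalIntegral.integral_congr this, intervalIntegral.integral_const_mul,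
      intervalIntegral.mul_integral_comp_add_mul]
    norm_num

/-- The integral curves of the left invariant fields are straight lines, `X k` being constant along
its own flow. -/
theorem hmul_flow (x : Heis) (k : Fin 2) (t : ℝ) : hmul x (flow k t) = x + t • X k x := by
  fin_cases k <;> ext <;> simp [hmul, flow, X, X₁, X₂] <;> ring

theorem X_hmul_flow (x : Heis) (k : Fin 2) (t : ℝ) : X k (hmul x (flow k t)) = X k x := by
  fin_cases k <;> simp [hmul, flow, X, X₁, X₂]

theorem abs_mem_lengths (x : Heis) (k : Fin 2) (t : ℝ) :
    |t| ∈ lengths (hmul x (flow k t)) x := by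
  have adm : IsAdmissible (hmul x (flow k t)) x (fun s => hmul x (flow k ((1 - s) * t)))
      (fun _ => if k = 0 then -t else 0) (fun _ => if k = 0 then 0 else -t) := by
    refine ⟨?_, measurable_const, measurable_const, ?_, by simp, by simp [hmul_flow]⟩
    · simp only [hmul_flow]
      have h1 : LipschitzWith ‖X k x‖₊ fun r : ℝ => r • X k x := by
        refine LipschitzWith.of_dist_le_mul fun r r' => ?_
        rw [dist_eq_norm, ← sub_smul, norm_smul, mul_comm, dist_eq_norm]
        rfl
      have h2 := (LipschitzWith.const x).add (h1.comp (lipschitzWith_affine t (-t)))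
      have e : (fun s : ℝ => x + ((1 - s) * t) • X k x) =
          fun s => x + ((fun r : ℝ => r • X k x) ∘ fun s => t + -t * s) s := by
        funext s
        simp only [Function.comp_apply]
        congr 2
        ring
      rw [e]
      exact ⟨_, h2.lipschitzOnWith⟩
    · refine .of_forall fun s => ?_
      have e : (if k = 0 then -t else 0) • X₁ (hmul x (flow k ((1 - s) * t))) +
          (if k = 0 then 0 else -t) • X₂ (hmul x (flow k ((1 - s) * t))) = (-t) • X k x := by
        rw [← X_hmul_flow x k ((1 - s) * t)]
        fin_cases k <;> simp [X]
      rw [e]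
      simp only [hmul_flow]
      have h1 : HasDerivAt (fun s : ℝ => (1 - s) * t) (-t) s := by
        simpa using ((hasDerivAt_id s).const_sub 1).mul_const t
      exact (h1.smul_const (X k x)).const_add x
  refine ⟨_, _, _, adm, ?_⟩
  fin_cases k <;> simp [speed, Real.sqrt_sq_eq_abs]

theorem lengths_hmul_nonempty {x y : Heis} (h : (lengths x y).Nonempty) (v : Heis) :
    (lengths (hmul x v) y).Nonempty := by
  have key : ∀ {x : Heis} (k : Fin 2) (t : ℝ), (lengths x y).Nonempty →
      (lengths (hmul x (flow k t)) y).Nonempty :=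
    fun k t ⟨l, hl⟩ => ⟨_, add_mem_lengths (abs_mem_lengths _ k t) hl⟩
  obtain ⟨s, t, -, -, hv⟩ := exists_flow_factorization v
  rw [hv]
  simp only [← hmul_assoc]
  exact key _ _ (key _ _ (key _ _ (key _ _ (key _ _ (key _ _ h)))))

/-- Connectivity by horizontal curves, from the six-factor decomposition. Without it the infimum
defining `d` could be the default value 0 of `sInf ∅`. -/
theorem lengths_zero_nonempty (x : Heis) : (lengths x 0).Nonempty := by
  have := lengths_hmul_nonempty ⟨0, zero_mem_lengths 0⟩ x
  rwa [zero_hmul] at this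

/-! ### The distance to the identity and its comparison with the homogeneous norm. -/

theorem d_nonneg (x : Heis) : 0 ≤ d x := Real.sInf_nonneg fun _ h => lengths_nonneg h

theorem d_le_of_mem {x : Heis} {l : ℝ} (h : l ∈ lengths x 0) : d x ≤ l :=
  csInf_le (bddBelow_lengths x 0) h

theorem d_zero : d 0 = 0 := le_antisymm (d_le_of_mem (zero_mem_lengths 0)) (d_nonneg 0)

theorem exists_mem_lengths_lt {x : Heis} {l : ℝ} (h : d x < l) : ∃ l' ∈ lengths x 0, l' < l :=
  exists_lt_of_csInf_lt (lengths_zero_nonempty x) h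

theorem d_hmul_flow_le (x : Heis) (k : Fin 2) (t : ℝ) : d (hmul x (flow k t)) ≤ d x + |t| := by
  refine le_of_forall_gt_imp_ge_of_dense fun l hl => ?_
  obtain ⟨l', h', hlt⟩ := exists_mem_lengths_lt (x := x) (l := l - |t|) (by linarith)
  have := d_le_of_mem (add_mem_lengths (abs_mem_lengths x k t) h')
  linarith

theorem hmul_flow_neg (x : Heis) (k : Fin 2) (t : ℝ) :
    hmul (hmul x (flow k t)) (flow k (-t)) = x := by
  fin_cases k <;> simp only [hmul, flow] <;> ext <;> simp <;> ring

theorem abs_d_hmul_flow_sub_le (x : Heis) (k : Fin 2) (t : ℝ) :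
    |d (hmul x (flow k t)) - d x| ≤ |t| := by
  have h1 := d_hmul_flow_le x k t
  have h2 := d_hmul_flow_le (hmul x (flow k t)) k (-t)
  rw [hmul_flow_neg, abs_neg] at h2
  rw [abs_le]; constructor <;> linarith

/-- The six flow factors cost at most 1 + 1 + 2 + 2 + 2 + 2 = 10 times `hnorm v`. -/
theorem abs_d_hmul_sub_le (x v : Heis) : |d (hmul x v) - d x| ≤ 10 * hnorm v := by
  obtain ⟨s, t, hs, ht, hv⟩ := exists_flow_factorization v
  obtain ⟨h1, h2, -⟩ := (hnorm_le_iff (hnorm_nonneg v)).1 le_rfl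
  have e : d (hmul x v) = d (hmul (hmul (hmul (hmul (hmul (hmul x (flow 0 v.1)) (flow 1 v.2.1))
      (flow 0 s)) (flow 1 t)) (flow 0 (-s))) (flow 1 (-t))) := by
    conv_lhs => rw [hv]
    simp only [← hmul_assoc]
  rw [e]
  set x1 := hmul x (flow 0 v.1)
  set x2 := hmul x1 (flow 1 v.2.1)
  set x3 := hmul x2 (flow 0 s)
  set x4 := hmul x3 (flow 1 t)
  set x5 := hmul x4 (flow 0 (-s))
  have b1 := abs_le.1 ((abs_d_hmul_flow_sub_le x 0 v.1).trans h1)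
  have b2 := abs_le.1 ((abs_d_hmul_flow_sub_le x1 1 v.2.1).trans h2)
  have b3 := abs_le.1 ((abs_d_hmul_flow_sub_le x2 0 s).trans hs)
  have b4 := abs_le.1 ((abs_d_hmul_flow_sub_le x3 1 t).trans ht)
  have b5 := abs_le.1 ((abs_d_hmul_flow_sub_le x4 0 (-s)).trans ((abs_neg s).le.trans hs))
  have b6 := abs_le.1 ((abs_d_hmul_flow_sub_le x5 1 (-t)).trans ((abs_neg t).le.trans ht))
  rw [abs_le]
  constructor <;> linarith [b1.1, b1.2, b2.1, b2.2, b3.1, b3.2, b4.1, b4.2, b5.1, b5.2, b6.1, b6.2]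

theorem d_le_hnorm (x : Heis) : d x ≤ 10 * hnorm x := by
  have := (abs_le.1 (abs_d_hmul_sub_le 0 x)).2
  rwa [zero_hmul, d_zero, sub_zero] at this

theorem hnorm_le_d (x : Heis) : hnorm x ≤ d x := by
  refine le_of_forall_gt_imp_ge_of_dense fun l hl => ?_
  obtain ⟨l', ⟨γ, a₁, a₂, h, rfl⟩, hlt⟩ := exists_mem_lengths_lt hl
  have := h.hnorm_le (t := 1) (by simp)
  rw [h.target, hmul_zero, hnorm_neg] at this
  exact this.trans hlt.le

theorem continuous_d : Continuous d := by
  rw [continuous_iff_continuousAt]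
  intro x
  have h1 : Filter.Tendsto (fun y => 10 * hnorm (hmul (-x) y)) (nhds x) (nhds 0) := by
    have : Continuous fun y => 10 * hnorm (hmul (-x) y) :=
      continuous_const.mul (continuous_hnorm.comp (continuous_const.hmul continuous_id))
    have h := this.tendsto x
    have e : hmul (-x) x = 0 := by simpa [hmul_zero] using neg_hmul_cancel x 0
    simpa [e, hnorm_zero] using h
  refine tendsto_iff_dist_tendsto_zero.2 (squeeze_zero (fun _ => dist_nonneg) (fun y => ?_) h1)
  have := abs_d_hmul_sub_le x (hmul (-x) y)
  rwa [hmul_neg_cancel] at this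

/-- Along an almost minimizing curve one gets closer to the identity at almost unit speed. -/
theorem exists_hmul_d_le (x : Heis) {l : ℝ} (hl : 0 < l) (hx : l ≤ d x) :
    ∃ v, hnorm v ≤ l ∧ d (hmul x v) ≤ d x - l / 2 := by
  -- The curve is within `l / 2` of optimal. Cutting it after arc length `l` leaves a remainder of
  -- length less than `d x - l / 2`.
  obtain ⟨L, ⟨γ, a₁, a₂, h, rfl⟩, hlt⟩ := exists_mem_lengths_lt (x := x) (l := d x + l / 2)
    (by linarith)
  have hd : d x ≤ ∫ s in (0 : ℝ)..1, speed a₁ a₂ s := d_le_of_mem ⟨γ, a₁, a₂, h, rfl⟩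
  have hcont : ContinuousOn (fun t => ∫ s in (0 : ℝ)..t, speed a₁ a₂ s) (Set.Icc 0 1) :=
    (intervalIntegral.continuousOn_primitive_interval' (b₁ := 0) (b₂ := 1)
      (h.intervalIntegrable (by simp) (by simp)) (by simp)).mono (by simp)
  obtain ⟨s, hs, hsl⟩ := intermediate_value_Icc zero_le_one hcont
    (show l ∈ Set.Icc _ _ from ⟨by simpa using hl.le, hx.trans hd⟩)
  simp only at hsl
  refine ⟨hmul (-x) (γ s), by rw [← hsl]; exact h.hnorm_le hs, ?_⟩
  rw [hmul_neg_cancel]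
  rcases eq_or_lt_of_le hs.2 with rfl | hs1
  · rw [h.target, d_zero]; linarith
  · have h1 := d_le_of_mem (h.integral_restrict_mem ⟨hs.1, hs1⟩)
    have := intervalIntegral.integral_add_adjacent_intervals
      (h.intervalIntegrable (s := 0) (by simp) hs) (h.intervalIntegrable (t := 1) hs (by simp))
    linarith

end Heis

/-! ### Power inequalities in the extended nonnegative reals. -/

/-- Jensen's inequality for the power `q` and a finite measure. -/
theorem ENNReal.rpow_lintegral_le {α : Type*} [MeasurableSpace α] (μ : Measure α) {q : ℝ}
    (hq : 1 < q) {g : α → ENNReal} (hg : AEMeasurable g μ) :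
    (∫⁻ a, g a ∂μ) ^ q ≤ μ Set.univ ^ (q - 1) * ∫⁻ a, g a ^ q ∂μ := by
  have hc := Real.HolderConjugate.conjExponent hq
  have h := ENNReal.lintegral_mul_le_Lp_mul_Lq μ hc hg (aemeasurable_const (b := (1 : ENNReal)))
  simp only [Pi.mul_apply, mul_one, ENNReal.one_rpow, lintegral_const, one_mul] at h
  have h2 := ENNReal.rpow_le_rpow h (zero_le_one.trans hq.le)
  rw [ENNReal.mul_rpow_of_nonneg _ _ (zero_le_one.trans hq.le), ← ENNReal.rpow_mul,
    ← ENNReal.rpow_mul, one_div_mul_cancel (by positivity), ENNReal.rpow_one, mul_comm] at h2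
  convert h2 using 3
  have : q - 1 ≠ 0 := by linarith
  rw [Real.conjExponent]
  field_simp

theorem Real.abs_add_rpow_le {q : ℝ} (hq0 : 0 ≤ q) (hq : q ≤ 2) (a b : ℝ) :
    |a + b| ^ q ≤ 4 * (|a| ^ q + |b| ^ q) := by
  have ha : 0 ≤ |a| ^ q := by positivity
  have hb : 0 ≤ |b| ^ q := by positivity
  have h2 : (2 : ℝ) ^ q ≤ 4 := by
    calc (2 : ℝ) ^ q ≤ 2 ^ (2 : ℝ) := Real.rpow_le_rpow_of_exponent_le one_le_two hq
      _ = 4 := by norm_num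
  have key : ∀ c : ℝ, 0 ≤ c → |a + b| ≤ 2 * c → |a + b| ^ q ≤ 4 * c ^ q := by
    intro c hc h
    calc |a + b| ^ q ≤ (2 * c) ^ q := by gcongr
      _ = 2 ^ q * c ^ q := Real.mul_rpow zero_le_two hc
      _ ≤ 4 * c ^ q := by gcongr
  have hab := abs_add_le a b
  rcases le_total |a| |b| with h | h
  · linarith [key |b| (abs_nonneg b) (by linarith)]
  · linarith [key |a| (abs_nonneg a) (by linarith)]

theorem ENNReal.ofReal_abs_add_rpow_le {q : ℝ} (hq0 : 0 ≤ q) (hq : q ≤ 2) (a b : ℝ) :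
    ENNReal.ofReal (|a + b| ^ q) ≤
      4 * (ENNReal.ofReal (|a| ^ q) + ENNReal.ofReal (|b| ^ q)) := by
  rw [← ENNReal.ofReal_add (by positivity) (by positivity),
    show (4 : ENNReal) = ENNReal.ofReal 4 by simp, ← ENNReal.ofReal_mul (by norm_num)]
  exact ENNReal.ofReal_le_ofReal (Real.abs_add_rpow_le hq0 hq a b)

namespace Heis

/-! ### The sub-gradient and weighted increments along translations. -/

/-- The length `|∇ f|` of the sub-gradient. -/
def gradNorm (f : Heis → ℝ) (x : Heis) : ℝ := Real.sqrt (∑ k, lieDeriv k f x ^ 2)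

theorem gradNorm_nonneg (f : Heis → ℝ) (x : Heis) : 0 ≤ gradNorm f x := Real.sqrt_nonneg _

theorem abs_lieDeriv_le (k : Fin 2) (f : Heis → ℝ) (x : Heis) : |lieDeriv k f x| ≤ gradNorm f x :=
  Real.abs_le_sqrt (Finset.single_le_sum (f := fun k => lieDeriv k f x ^ 2)
    (fun _ _ => sq_nonneg _) (Finset.mem_univ k))

theorem continuous_X (k : Fin 2) : Continuous (X k) := by
  fin_cases k
  · change Continuous X₁
    unfold X₁; fun_prop
  · change Continuous X₂
    unfold X₂; fun_prop

theorem continuous_lieDeriv (k : Fin 2) {f : Heis → ℝ} (hf : ContDiff ℝ 1 f) :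
    Continuous (lieDeriv k f) :=
  (hf.continuous_fderiv one_ne_zero).clm_apply (continuous_X k)

theorem continuous_gradNorm {f : Heis → ℝ} (hf : ContDiff ℝ 1 f) : Continuous (gradNorm f) :=
  Real.continuous_sqrt.comp
    (continuous_finsetSum _ fun k _ => (continuous_lieDeriv k hf).pow 2)

theorem continuous_flow (k : Fin 2) : Continuous (flow k) := by
  fin_cases k
  · change Continuous fun t : ℝ => ((t, 0, 0) : Heis)
    fun_prop
  · change Continuous fun t : ℝ => ((0, t, 0) : Heis)
    fun_prop

theorem hasDerivAt_comp_flow {f : Heis → ℝ} (hf : ContDiff ℝ 1 f) (y : Heis) (k : Fin 2) (s : ℝ) :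
    HasDerivAt (fun s => f (hmul y (flow k s))) (lieDeriv k f (hmul y (flow k s))) s := by
  have h1 : HasDerivAt (fun s => hmul y (flow k s)) (X k y) s := by
    simp only [hmul_flow]
    simpa using ((hasDerivAt_id s).smul_const (X k y)).const_add y
  have h2 := ((hf.differentiable one_ne_zero) (hmul y (flow k s))).hasFDerivAt.comp_hasDerivAt s h1
  rw [lieDeriv, X_hmul_flow]
  exact h2

/-- Fundamental theorem of calculus along a flow line, then Jensen. Integrating over the whole
window `[-r, r]` makes the right side independent of `t`. -/
theorem ofReal_abs_sub_flow_rpow_le {f : Heis → ℝ} (hf : ContDiff ℝ 1 f) {q : ℝ} (hq : 1 < q)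
    (y : Heis) (k : Fin 2) {t r : ℝ} (ht : |t| ≤ r) :
    ENNReal.ofReal (|f (hmul y (flow k t)) - f y| ^ q) ≤ ENNReal.ofReal ((2 * r) ^ (q - 1)) *
      ∫⁻ s in Set.Icc (-r) r, ENNReal.ofReal (gradNorm f (hmul y (flow k s)) ^ q) := by
  have hr : 0 ≤ r := (abs_nonneg t).trans ht
  have hq0 : 0 ≤ q := by linarith
  have hcont : Continuous fun s => lieDeriv k f (hmul y (flow k s)) :=
    (continuous_lieDeriv k hf).comp (continuous_const.hmul (continuous_flow k))
  have e1 : f (hmul y (flow k t)) - f y = ∫ s in (0 : ℝ)..t, lieDeriv k f (hmul y (flow k s)) := by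
    have := intervalIntegral.integral_eq_sub_of_hasDerivAt
      (fun s _ => hasDerivAt_comp_flow hf y k s) (hcont.intervalIntegrable 0 t)
    rw [this]
    simp [hmul_flow]
  have hsub : Set.uIoc 0 t ⊆ Set.Icc (-r) r := by
    refine Set.uIoc_subset_uIcc.trans (Set.uIcc_subset_Icc ⟨by linarith, hr⟩ ?_)
    exact abs_le.1 ht
  have e2 : ENNReal.ofReal |f (hmul y (flow k t)) - f y| ≤
      ∫⁻ s in Set.Icc (-r) r, ENNReal.ofReal (gradNorm f (hmul y (flow k s))) := by
    rw [e1]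
    calc ENNReal.ofReal |∫ s in (0 : ℝ)..t, lieDeriv k f (hmul y (flow k s))|
        = ENNReal.ofReal ‖∫ s in Set.uIoc 0 t, lieDeriv k f (hmul y (flow k s))‖ := by
          rw [← intervalIntegral.norm_integral_eq_norm_integral_uIoc, Real.norm_eq_abs]
      _ = ‖∫ s in Set.uIoc 0 t, lieDeriv k f (hmul y (flow k s))‖ₑ := ofReal_norm _
      _ ≤ ∫⁻ s in Set.uIoc 0 t, ‖lieDeriv k f (hmul y (flow k s))‖ₑ :=
          enorm_integral_le_lintegral_enorm _
      _ ≤ ∫⁻ s in Set.Icc (-r) r, ‖lieDeriv k f (hmul y (flow k s))‖ₑ :=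
          lintegral_mono_set hsub
      _ ≤ _ := by
          refine lintegral_mono fun s => ?_
          rw [← ofReal_norm, Real.norm_eq_abs]
          exact ENNReal.ofReal_le_ofReal (abs_lieDeriv_le _ _ _)
  have hm : Measurable fun s => ENNReal.ofReal (gradNorm f (hmul y (flow k s))) :=
    ((continuous_gradNorm hf).comp
      (continuous_const.hmul (continuous_flow k))).measurable.ennreal_ofReal
  have e3 := ENNReal.rpow_lintegral_le (volume.restrict (Set.Icc (-r) r)) hq hm.aemeasurable
  rw [← ENNReal.ofReal_rpow_of_nonneg (abs_nonneg _) hq0]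
  refine (ENNReal.rpow_le_rpow e2 hq0).trans (e3.trans ?_)
  rw [Measure.restrict_apply_univ, Real.volume_Icc,
    ENNReal.ofReal_rpow_of_nonneg (by linarith) (by linarith)]
  simp only [ENNReal.ofReal_rpow_of_nonneg (gradNorm_nonneg _ _) hq0]
  rw [show r - -r = 2 * r by ring]

theorem measurable_ofReal_gradNorm_rpow {f : Heis → ℝ} (hf : ContDiff ℝ 1 f) {q : ℝ} :
    Measurable fun x => ENNReal.ofReal (gradNorm f x ^ q) :=
  ((continuous_gradNorm hf).measurable.pow_const q).ennreal_ofReal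

/-- After Fubini, each `s` contributes an integral over a right translate, and right translations
preserve volume; the window contributes the last factor `2 * r`. The weight is carried along by
`hww`. -/
theorem lintegral_flow_le {f : Heis → ℝ} (hf : ContDiff ℝ 1 f) {q : ℝ} (hq : 1 < q)
    {w w' : Heis → ENNReal} (hw' : Measurable w') (u : Heis) (k : Fin 2) {t r : ℝ} (ht : |t| ≤ r)
    (hww : ∀ x s, |s| ≤ r → w x ≤ w' (hmul (hmul x u) (flow k s))) :
    ∫⁻ x, w x * ENNReal.ofReal (|f (hmul (hmul x u) (flow k t)) - f (hmul x u)| ^ q) ≤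
      ENNReal.ofReal ((2 * r) ^ q) * ∫⁻ z, w' z * ENNReal.ofReal (gradNorm f z ^ q) := by
  have hr : 0 ≤ r := (abs_nonneg t).trans ht
  set F : Heis → ENNReal := fun z => w' z * ENNReal.ofReal (gradNorm f z ^ q) with hF
  have hFm : Measurable F := hw'.mul (measurable_ofReal_gradNorm_rpow hf)
  have hcont : Continuous fun z : Heis × ℝ => hmul (hmul z.1 u) (flow k z.2) :=
    (continuous_fst.hmul continuous_const).hmul ((continuous_flow k).comp continuous_snd)
  have e1 : ∀ x, w x * ENNReal.ofReal (|f (hmul (hmul x u) (flow k t)) - f (hmul x u)| ^ q) ≤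
      ENNReal.ofReal ((2 * r) ^ (q - 1)) *
        ∫⁻ s in Set.Icc (-r) r, F (hmul (hmul x u) (flow k s)) := by
    intro x
    calc _ ≤ w x * (ENNReal.ofReal ((2 * r) ^ (q - 1)) * ∫⁻ s in Set.Icc (-r) r,
          ENNReal.ofReal (gradNorm f (hmul (hmul x u) (flow k s)) ^ q)) := by
          gcongr
          exact ofReal_abs_sub_flow_rpow_le hf hq _ k ht
      _ = ENNReal.ofReal ((2 * r) ^ (q - 1)) * (w x * ∫⁻ s in Set.Icc (-r) r,
          ENNReal.ofReal (gradNorm f (hmul (hmul x u) (flow k s)) ^ q)) := by ring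
      _ ≤ _ := by
          gcongr
          rw [← lintegral_const_mul]
          · refine setLIntegral_mono' measurableSet_Icc fun s hs => ?_
            simp only [hF]
            gcongr
            exact hww x s (abs_le.2 hs)
          · exact (measurable_ofReal_gradNorm_rpow hf).comp
              (hcont.comp (continuous_const.prodMk continuous_id)).measurable
  refine (lintegral_mono e1).trans ?_
  rw [lintegral_const_mul' _ _ ENNReal.ofReal_ne_top, lintegral_lintegral_swap]
  · have e2 : ∀ s, ∫⁻ x, F (hmul (hmul x u) (flow k s)) = ∫⁻ z, F z := by
      intro s
      simp only [hmul_assoc]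
      exact (measurePreserving_hmul_right (hmul u (flow k s))).lintegral_comp hFm
    simp only [e2, lintegral_const, Measure.restrict_apply_univ, Real.volume_Icc]
    rw [mul_comm (∫⁻ z, F z), ← mul_assoc, ← ENNReal.ofReal_mul (by positivity)]
    gcongr
    rcases hr.eq_or_lt with h0 | h0
    · simp [← h0]; positivity
    · rw [show r - -r = 2 * r by ring, ← Real.rpow_add_one (by positivity), sub_add_cancel]
  · exact (hFm.comp hcont.measurable).aemeasurable

/-- Weighted `L^q` bound for the increments of `f` along a fixed right translation. -/
theorem lintegral_hmul_sub_le {f : Heis → ℝ} (hf : ContDiff ℝ 1 f) {q : ℝ} (hq : 1 < q)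
    (hq2 : q ≤ 2) {w w' : Heis → ENNReal} (hw : Measurable w) (hw' : Measurable w') (v : Heis)
    (hww : ∀ x z, |d z - d x| ≤ 12 * hnorm v → w x ≤ w' z) :
    ∫⁻ x, w x * ENNReal.ofReal (|f (hmul x v) - f x| ^ q) ≤
      10 ^ 6 * ENNReal.ofReal (hnorm v ^ q) * ∫⁻ z, w' z * ENNReal.ofReal (gradNorm f z ^ q) := by
  have hn := hnorm_nonneg v
  have hq0 : 0 ≤ q := by linarith
  set r := 2 * hnorm v with hr
  have hr0 : 0 ≤ r := by positivity
  set I := ∫⁻ z, w' z * ENNReal.ofReal (gradNorm f z ^ q) with hI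
  -- Invariant after `n` of the six factors. A step turns `16 * 5^n` into `4 * (4 + 16 * 5^n) ≤ 16 *
  -- 5^(n+1)`; at the end `16 * 5^6 * 4 = 10^6`, and the total displacement is `6 * r = 12 * hnorm
  -- v`.
  let Q : ℕ → Heis → Prop := fun n u => (∀ x, |d (hmul x u) - d x| ≤ n * r) ∧
    ∫⁻ x, w x * ENNReal.ofReal (|f (hmul x u) - f x| ^ q) ≤
      16 * 5 ^ n * (ENNReal.ofReal (r ^ q) * I)
  have two_rpow : ∀ c : ℝ, 0 ≤ c → ENNReal.ofReal ((2 * c) ^ q) ≤ 4 * ENNReal.ofReal (c ^ q) := by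
    intro c hc
    rw [show (4 : ENNReal) = ENNReal.ofReal 4 by simp, ← ENNReal.ofReal_mul (by norm_num)]
    refine ENNReal.ofReal_le_ofReal ?_
    rw [Real.mul_rpow zero_le_two hc]
    gcongr
    calc (2 : ℝ) ^ q ≤ 2 ^ (2 : ℝ) := Real.rpow_le_rpow_of_exponent_le one_le_two hq2
      _ = 4 := by norm_num
  have Q0 : Q 0 0 := by
    have hq' : q ≠ 0 := by linarith
    simp [Q, hmul_zero, Real.zero_rpow hq']
  have Qs : ∀ (n : ℕ) (u : Heis) (k : Fin 2) (t : ℝ), n < 6 → |t| ≤ r → Q n u →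
      Q (n + 1) (hmul u (flow k t)) := by
    intro n u k t hn6 ht ⟨h1, h2⟩
    have hd : ∀ x s, |s| ≤ r → |d (hmul (hmul x u) (flow k s)) - d x| ≤ (n + 1) * r := by
      intro x s hs
      have a1 := abs_le.1 ((abs_d_hmul_flow_sub_le (hmul x u) k s).trans hs)
      have a2 := abs_le.1 (h1 x)
      rw [abs_le]; constructor <;> linarith [a1.1, a1.2, a2.1, a2.2]
    refine ⟨fun x => ?_, ?_⟩
    · rw [← hmul_assoc]; push_cast; exact hd x t ht
    · have step := lintegral_flow_le hf hq hw' u k ht (w := w) fun x s hs => by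
        refine hww _ _ ((hd x s hs).trans ?_)
        have : (n : ℝ) + 1 ≤ 6 := by exact_mod_cast hn6
        nlinarith
      rw [← hI] at step
      have hfc := hf.continuous
      calc ∫⁻ x, w x * ENNReal.ofReal (|f (hmul x (hmul u (flow k t))) - f x| ^ q)
          ≤ ∫⁻ x, 4 * (w x * ENNReal.ofReal (|f (hmul (hmul x u) (flow k t)) - f (hmul x u)| ^ q) +
              w x * ENNReal.ofReal (|f (hmul x u) - f x| ^ q)) := by
            refine lintegral_mono fun x => ?_
            have := ENNReal.ofReal_abs_add_rpow_le hq0 hq2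
              (f (hmul (hmul x u) (flow k t)) - f (hmul x u)) (f (hmul x u) - f x)
            rw [sub_add_sub_cancel, hmul_assoc] at this
            calc _ ≤ w x * _ := mul_le_mul_right this _
              _ = _ := by rw [hmul_assoc]; ring
        _ = 4 * ((∫⁻ x, w x * ENNReal.ofReal
              (|f (hmul (hmul x u) (flow k t)) - f (hmul x u)| ^ q)) +
              ∫⁻ x, w x * ENNReal.ofReal (|f (hmul x u) - f x| ^ q)) := by
            rw [lintegral_const_mul' _ _ (by simp), lintegral_add_right]
            have : Measurable fun x => |f (hmul x u) - f x| ^ q :=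
              ((hfc.comp (continuous_id.hmul continuous_const)).sub hfc).abs.measurable.pow_const q
            exact hw.mul this.ennreal_ofReal
        _ ≤ 4 * (4 * ENNReal.ofReal (r ^ q) * I + 16 * 5 ^ n * (ENNReal.ofReal (r ^ q) * I)) := by
            gcongr
            exact step.trans (by gcongr; exact two_rpow r hr0)
        _ = (16 + 64 * 5 ^ n) * (ENNReal.ofReal (r ^ q) * I) := by ring
        _ ≤ (16 * 5 ^ n + 64 * 5 ^ n) * (ENNReal.ofReal (r ^ q) * I) := by
            gcongr
            exact le_mul_of_one_le_right (by simp) (one_le_pow₀ (by norm_num))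
        _ = 16 * 5 ^ (n + 1) * (ENNReal.ofReal (r ^ q) * I) := by ring
  obtain ⟨s, t, hs, ht, hv⟩ := exists_flow_factorization v
  obtain ⟨h1, h2, -⟩ := (hnorm_le_iff hn).1 le_rfl
  have fin : Q 6 v := by
    rw [hv]
    refine Qs 5 _ 1 (-t) (by norm_num) (by rwa [abs_neg]) <|
      Qs 4 _ 0 (-s) (by norm_num) (by rwa [abs_neg]) <|
      Qs 3 _ 1 t (by norm_num) ht <| Qs 2 _ 0 s (by norm_num) hs <|
      Qs 1 _ 1 v.2.1 (by norm_num) (by linarith) ?_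
    have := Qs 0 _ 0 v.1 (by norm_num) (by linarith) Q0
    rwa [zero_hmul] at this
  refine fin.2.trans ?_
  calc 16 * 5 ^ 6 * (ENNReal.ofReal (r ^ q) * I)
      ≤ 16 * 5 ^ 6 * (4 * ENNReal.ofReal (hnorm v ^ q) * I) := by
        gcongr; exact two_rpow _ hn
    _ = (16 * 5 ^ 6 * 4) * ENNReal.ofReal (hnorm v ^ q) * I := by ring
    _ = _ := by norm_num

/-! ### Confining potentials and their rate. -/

/-- The slope `L + (1 + t)^(p - 1)` of the confining potential at distance `t`. -/
def rate (p L t : ℝ) : ℝ := L + (1 + t) ^ (p - 1)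

/-- `U` behaves like a radial potential with slope comparable to `rate p L`,
up to bounded errors. -/
structure IsConfining (p c₁ C₁ C₂ L : ℝ) (U : Heis → ℝ) : Prop where
  measurable : Measurable U
  nonneg : 0 ≤ L
  zero : |U 0| ≤ C₂
  upper : ∀ x y, d y ≤ d x → U x - U y ≤ C₁ * (rate p L (d x) * (d x - d y)) + C₂
  lower : ∀ x y, d y ≤ d x → c₁ * (rate p L (d x) * (d x - d y)) - C₂ ≤ U x - U y

theorem one_le_rate {p L t : ℝ} (hp : 1 ≤ p) (hL : 0 ≤ L) (ht : 0 ≤ t) : 1 ≤ rate p L t := by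
  have : 1 ≤ (1 + t) ^ (p - 1) := Real.one_le_rpow (by linarith) (by linarith)
  unfold rate; linarith

theorem rate_mono {p L s t : ℝ} (hp : 1 ≤ p) (hs : 0 ≤ s) (hst : s ≤ t) :
    rate p L s ≤ rate p L t := by
  unfold rate
  have : (1 + s) ^ (p - 1) ≤ (1 + t) ^ (p - 1) :=
    Real.rpow_le_rpow (by linarith) (by linarith) (by linarith)
  linarith

/-- The rate varies slowly, since `1 + t ≤ (1 + R)(1 + s)`. The factor does not depend on `L`,
because it is at least 1 and the summand `L` is common to both sides. -/
theorem rate_le {p L s t R : ℝ} (hp : 1 ≤ p) (hL : 0 ≤ L) (hs : 0 ≤ s) (ht : 0 ≤ t)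
    (hR : |t - s| ≤ R) : rate p L t ≤ (1 + R) ^ (p - 1) * rate p L s := by
  have hR0 : 0 ≤ R := (abs_nonneg _).trans hR
  have h1 : 1 ≤ (1 + R) ^ (p - 1) := Real.one_le_rpow (by linarith) (by linarith)
  have h2 : (1 + t) ^ (p - 1) ≤ (1 + R) ^ (p - 1) * (1 + s) ^ (p - 1) := by
    rw [← Real.mul_rpow (by linarith) (by linarith)]
    refine Real.rpow_le_rpow (by linarith) ?_ (by linarith)
    have := (abs_le.1 hR).2
    nlinarith
  unfold rate
  nlinarith

theorem measurable_rate (p L : ℝ) : Measurable fun x => rate p L (d x) := by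
  unfold rate
  exact measurable_const.add ((measurable_const.add continuous_d.measurable).pow_const _)

section

variable {p c₁ C₁ C₂ L : ℝ} {U : Heis → ℝ}

theorem IsConfining.one_le_rate (h : IsConfining p c₁ C₁ C₂ L U) (hp : 1 ≤ p) (x : Heis) :
    1 ≤ rate p L (d x) := Heis.one_le_rate hp h.nonneg (d_nonneg x)

/-- Used with `R` of order `1 / rate`: the energy then increases by a bounded amount only, so `1 /
rate` is the scale on which `e^{-U}` is essentially constant. -/
theorem IsConfining.sub_le (h : IsConfining p c₁ C₁ C₂ L U) (hp : 1 ≤ p) (hc : 0 ≤ c₁)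
    (hC : 0 ≤ C₁) {x z : Heis} {R : ℝ} (hR : |d z - d x| ≤ R) :
    U z - U x ≤ C₁ * ((1 + R) ^ (p - 1) * rate p L (d x) * R) + C₂ := by
  have hx := h.one_le_rate hp x
  have hR0 : 0 ≤ R := (abs_nonneg _).trans hR
  have hnn : 0 ≤ C₁ * ((1 + R) ^ (p - 1) * rate p L (d x) * R) := by positivity
  rcases le_total (d x) (d z) with hle | hle
  · have h1 := h.upper z x hle
    have h2 := rate_le hp h.nonneg (d_nonneg x) (d_nonneg z) hR
    have h3 := h.one_le_rate hp z
    have h4 := (abs_le.1 hR).2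
    refine h1.trans ?_
    gcongr
  · have h1 := h.lower x z hle
    have : 0 ≤ c₁ * (rate p L (d x) * (d x - d z)) :=
      mul_nonneg hc (mul_nonneg (by linarith) (by linarith))
    linarith

end

/-! ### The pseudo-Poincaré inequality at scale `1 / rate`. -/

/-- The kernel `e^{-U} H^{4+q}` at `x`, cut off to `r < lam / H`, where `H` is the rate at `x`. -/
def kernelWeight (p q L : ℝ) (U : Heis → ℝ) (lam r : ℝ) (x : Heis) : ENNReal :=
  if r * rate p L (d x) < lam then
    ENNReal.ofReal (Real.exp (-U x) * rate p L (d x) ^ (4 + q)) else 0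

theorem measurable_kernelWeight {p q L : ℝ} {U : Heis → ℝ} (hU : Measurable U) (lam : ℝ) :
    Measurable fun z : Heis × ℝ => kernelWeight p q L U lam z.2 z.1 := by
  have h1 : Measurable fun z : Heis × ℝ => rate p L (d z.1) :=
    (measurable_rate p L).comp measurable_fst
  refine Measurable.ite (measurableSet_lt (measurable_snd.mul h1) measurable_const) ?_
    measurable_const
  exact ((hU.comp measurable_fst).neg.exp.mul (h1.pow_const _)).ennreal_ofReal

/-- On the support of the cutoff `r * rate < lam`, moving by `12 * r` changes `U` and `rate` in a
controlled way. The only price is a constant and a cutoff enlarged by the distortion of the rate. -/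
theorem kernelWeight_le {p q c₁ C₁ C₂ L lam Lam r : ℝ} {U : Heis → ℝ}
    (h : IsConfining p c₁ C₁ C₂ L U) (hp : 1 ≤ p) (hq : 1 < q) (hc : 0 ≤ c₁) (hC : 0 ≤ C₁)
    (hlam : lam ≤ Lam) (hLam : 0 ≤ Lam) (hr : 0 ≤ r) {x z : Heis}
    (hxz : |d z - d x| ≤ 12 * r) :
    kernelWeight p q L U lam r x ≤
      ENNReal.ofReal (Real.exp (C₁ * ((1 + 12 * Lam) ^ (p - 1) * (12 * Lam)) + C₂) *
        ((1 + 12 * Lam) ^ (p - 1)) ^ (4 + q)) *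
      kernelWeight p q L U ((1 + 12 * Lam) ^ (p - 1) * lam) r z := by
  set κ := (1 + 12 * Lam) ^ (p - 1) with hκ
  have hx := h.one_le_rate hp x
  have hz := h.one_le_rate hp z
  have hκ0 : 0 < κ := by positivity
  unfold kernelWeight
  by_cases hcond : r * rate p L (d x) < lam
  swap
  · rw [if_neg hcond]; exact zero_le
  have hrL : 12 * r ≤ 12 * Lam := by nlinarith
  have hxz' := hxz.trans hrL
  have k1 : rate p L (d z) ≤ κ * rate p L (d x) :=
    rate_le hp h.nonneg (d_nonneg x) (d_nonneg z) hxz'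
  have k2 : rate p L (d x) ≤ κ * rate p L (d z) :=
    rate_le hp h.nonneg (d_nonneg z) (d_nonneg x) (by rwa [abs_sub_comm])
  have k3 : r * rate p L (d z) < κ * lam := by
    calc r * rate p L (d z) ≤ r * (κ * rate p L (d x)) := by gcongr
      _ = κ * (r * rate p L (d x)) := by ring
      _ < κ * lam := by gcongr
  rw [if_pos hcond, if_pos k3, ← ENNReal.ofReal_mul (by positivity)]
  refine ENNReal.ofReal_le_ofReal ?_
  have u1 := h.sub_le hp hc hC hxz
  have u2 : (1 + 12 * r) ^ (p - 1) * rate p L (d x) * (12 * r) ≤ κ * (12 * Lam) := by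
    calc (1 + 12 * r) ^ (p - 1) * rate p L (d x) * (12 * r)
        = (1 + 12 * r) ^ (p - 1) * (12 * (r * rate p L (d x))) := by ring
      _ ≤ κ * (12 * Lam) := by
        rw [hκ]
        have : r * rate p L (d x) ≤ Lam := by linarith
        have hp1 : 0 ≤ p - 1 := by linarith
        gcongr
  have u3 : -U x ≤ (C₁ * (κ * (12 * Lam)) + C₂) + -U z := by
    have := mul_le_mul_of_nonneg_left u2 hC
    linarith
  calc Real.exp (-U x) * rate p L (d x) ^ (4 + q)
      ≤ Real.exp ((C₁ * (κ * (12 * Lam)) + C₂) + -U z) * (κ * rate p L (d z)) ^ (4 + q) := by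
        gcongr
    _ = _ := by
        rw [Real.exp_add, Real.mul_rpow hκ0.le (by linarith)]; ring

/-- Pseudo-Poincaré inequality: increments of `f` at scale `lam / rate` are controlled by the
sub-gradient, with constants uniform over confining potentials. -/
theorem exists_pseudo_poincare {p q c₁ C₁ C₂ Lam : ℝ} (hp : 1 ≤ p) (hq : 1 < q) (hq2 : q ≤ 2)
    (hc : 0 ≤ c₁) (hC : 0 ≤ C₁) (hLam : 0 ≤ Lam) :
    ∃ C : ℝ, 0 < C ∧ ∀ (L : ℝ) (U : Heis → ℝ), IsConfining p c₁ C₁ C₂ L U →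
      ∀ f : Heis → ℝ, ContDiff ℝ 1 f → ∀ lam : ℝ, 0 < lam → lam ≤ Lam →
      ∫⁻ x, ∫⁻ v, kernelWeight p q L U lam (hnorm v) x * ENNReal.ofReal (|f (hmul x v) - f x| ^ q) ≤
        ENNReal.ofReal (C * lam ^ (4 + q)) *
          ∫⁻ x, ENNReal.ofReal (Real.exp (-U x)) * ENNReal.ofReal (gradNorm f x ^ q) := by
  set κ := (1 + 12 * Lam) ^ (p - 1) with hκ
  have hκ0 : 0 < κ := by positivity
  set D := Real.exp (C₁ * (κ * (12 * Lam)) + C₂) * κ ^ (4 + q) with hD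
  have hD0 : 0 < D := by positivity
  refine ⟨10 ^ 6 * D * (8 * κ ^ (4 + q)), by positivity, ?_⟩
  intro L U h f hf lam hlam0 hlam
  have hU := h.measurable
  set G : Heis → ENNReal := fun x => ENNReal.ofReal (gradNorm f x ^ q) with hG
  have hGm : Measurable G := measurable_ofReal_gradNorm_rpow hf
  have hfc := hf.continuous
  have m1 : ∀ lam, Measurable fun z : Heis × Heis => kernelWeight p q L U lam (hnorm z.2) z.1 :=
    fun lam => (measurable_kernelWeight hU lam).comp
      (measurable_fst.prodMk (continuous_hnorm.measurable.comp measurable_snd))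
  have m2 : Measurable fun z : Heis × Heis => ENNReal.ofReal (|f (hmul z.1 z.2) - f z.1| ^ q) :=
    (((hfc.comp continuous_hmul).sub (hfc.comp continuous_fst)).abs.measurable.pow_const
      q).ennreal_ofReal
  have m3 : ∀ lam r, Measurable (kernelWeight p q L U lam r) := fun lam r =>
    (measurable_kernelWeight hU lam).comp (measurable_id.prodMk measurable_const)
  rw [lintegral_lintegral_swap ((m1 lam).mul m2).aemeasurable]
  have step : ∀ v, ∫⁻ x, kernelWeight p q L U lam (hnorm v) x *
      ENNReal.ofReal (|f (hmul x v) - f x| ^ q) ≤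
      10 ^ 6 * ENNReal.ofReal D * ∫⁻ z, ENNReal.ofReal (hnorm v ^ q) *
        (kernelWeight p q L U (κ * lam) (hnorm v) z * G z) := by
    intro v
    refine (lintegral_hmul_sub_le hf hq hq2 (m3 lam _) ((m3 (κ * lam) (hnorm v)).const_mul
      (ENNReal.ofReal D)) v fun x z hxz =>
      kernelWeight_le h hp hq hc hC hlam hLam (hnorm_nonneg v) hxz).trans (le_of_eq ?_)
    simp only [mul_assoc]
    rw [lintegral_const_mul' _ _ ENNReal.ofReal_ne_top, lintegral_const_mul' _ _
      ENNReal.ofReal_ne_top]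
    ring
  refine (lintegral_mono step).trans ?_
  rw [lintegral_const_mul' _ _ (by finiteness), lintegral_lintegral_swap]
  swap
  · refine Measurable.aemeasurable ?_
    refine ((continuous_hnorm.measurable.comp measurable_fst).pow_const q).ennreal_ofReal.mul
      (((m1 _).comp measurable_swap).mul (hGm.comp measurable_snd))
  -- The exponent `4 + q` of the kernel is exactly compensated: the ball of radius `κ * lam / H` has
  -- volume of order `H^(-4)`, and `hnorm v ^ q` contributes `H^(-q)`.
  have inner : ∀ z, ∫⁻ v, ENNReal.ofReal (hnorm v ^ q) *
      (kernelWeight p q L U (κ * lam) (hnorm v) z * G z) ≤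
      ENNReal.ofReal (8 * (κ * lam) ^ (4 + q)) * (ENNReal.ofReal (Real.exp (-U z)) * G z) := by
    intro z
    have hz := h.one_le_rate hp z
    set H := rate p L (d z) with hH
    have hH0 : 0 < H := by linarith
    have hr0 : 0 < κ * lam / H := by positivity
    calc ∫⁻ v, ENNReal.ofReal (hnorm v ^ q) * (kernelWeight p q L U (κ * lam) (hnorm v) z * G z)
        ≤ ∫⁻ v, {v | hnorm v < κ * lam / H}.indicator (fun _ =>
            ENNReal.ofReal ((κ * lam / H) ^ q) *
              (ENNReal.ofReal (Real.exp (-U z) * H ^ (4 + q)) * G z)) v := by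
          refine lintegral_mono fun v => ?_
          by_cases hv : hnorm v < κ * lam / H
          · rw [Set.indicator_of_mem (by exact hv), kernelWeight,
              if_pos ((lt_div_iff₀ hH0).1 hv)]
            have := hnorm_nonneg v
            gcongr
          · rw [Set.indicator_of_notMem (by exact hv), kernelWeight,
              if_neg (fun h' => hv ((lt_div_iff₀ hH0).2 h'))]
            simp
      _ = ENNReal.ofReal ((κ * lam / H) ^ q) *
              (ENNReal.ofReal (Real.exp (-U z) * H ^ (4 + q)) * G z) *
              ENNReal.ofReal (8 * (κ * lam / H) ^ 4) := by
          rw [lintegral_indicator (measurableSet_hnorm_lt _), setLIntegral_const,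
            volume_hnorm_lt hr0]
      _ = (ENNReal.ofReal ((κ * lam / H) ^ q) * ENNReal.ofReal (Real.exp (-U z) * H ^ (4 + q)) *
            ENNReal.ofReal (8 * (κ * lam / H) ^ 4)) * G z := by ring
      _ = ENNReal.ofReal (8 * (κ * lam) ^ (4 + q)) * (ENNReal.ofReal (Real.exp (-U z)) * G z) := by
          rw [← mul_assoc (ENNReal.ofReal (8 * (κ * lam) ^ (4 + q)))]
          congr 1
          rw [← ENNReal.ofReal_mul (by positivity), ← ENNReal.ofReal_mul (by positivity),
            ← ENNReal.ofReal_mul (by positivity)]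
          congr 1
          have e : (κ * lam / H) ^ q * (κ * lam / H) ^ 4 = (κ * lam) ^ (4 + q) / H ^ (4 + q) := by
            rw [← Real.rpow_natCast, ← Real.rpow_add hr0, ← Real.div_rpow (by positivity) hH0.le]
            congr 1; push_cast; ring
          have hHp : H ^ (4 + q) ≠ 0 := by positivity
          calc _ = 8 * Real.exp (-U z) * H ^ (4 + q) * ((κ * lam / H) ^ q * (κ * lam / H) ^ 4) := by
                ring
            _ = _ := by rw [e]; field_simp
  calc _ ≤ 10 ^ 6 * ENNReal.ofReal D * (ENNReal.ofReal (8 * (κ * lam) ^ (4 + q)) *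
        ∫⁻ z, ENNReal.ofReal (Real.exp (-U z)) * G z) := by
        gcongr
        rw [← lintegral_const_mul' _ _ ENNReal.ofReal_ne_top]
        exact lintegral_mono inner
    _ = _ := by
        rw [← mul_assoc, show (10 ^ 6 : ENNReal) = ENNReal.ofReal (10 ^ 6) by norm_num,
          ← ENNReal.ofReal_mul (by positivity), ← ENNReal.ofReal_mul (by positivity),
          Real.mul_rpow hκ0.le hlam0.le]
        congr 2
        ring

/-! ### Integrability of the weights. -/

theorem one_add_norm_le (x : Heis) : 1 + ‖x‖ ≤ (1 + d x) ^ 2 := by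
  obtain ⟨h1, h2, h3⟩ := (hnorm_le_iff (d_nonneg x)).1 (hnorm_le_d x)
  have h0 := d_nonneg x
  have : ‖x‖ ≤ d x ^ 2 + 2 * d x := by
    rw [Prod.norm_def, Prod.norm_def]
    simp only [Real.norm_eq_abs]
    refine max_le (by nlinarith) (max_le (by nlinarith) (by nlinarith))
  nlinarith

theorem exists_one_add_rpow_mul_exp_le (c m : ℝ) (hc : 0 < c) :
    ∃ K : ℝ, 0 < K ∧ ∀ t : ℝ, 0 ≤ t → Real.exp (-(c * t)) * (1 + t) ^ m ≤ K := by
  obtain ⟨n, hn⟩ := exists_nat_ge m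
  refine ⟨Real.exp c * n.factorial / c ^ n, by positivity, fun t ht => ?_⟩
  have h1 : (1 + t) ^ m ≤ (1 + t) ^ n := by
    rw [← Real.rpow_natCast]
    exact Real.rpow_le_rpow_of_exponent_le (by linarith) hn
  have h2 := Real.pow_div_factorial_le_exp (x := c * (1 + t)) (by positivity) n
  rw [div_le_iff₀ (by positivity), mul_pow] at h2
  have h3 : Real.exp (c * (1 + t)) * Real.exp (-(c * t)) = Real.exp c := by
    rw [← Real.exp_add]; congr 1; ring
  rw [le_div_iff₀ (by positivity)]
  calc Real.exp (-(c * t)) * (1 + t) ^ m * c ^ n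
      ≤ Real.exp (-(c * t)) * (1 + t) ^ n * c ^ n := by gcongr
    _ = Real.exp (-(c * t)) * (c ^ n * (1 + t) ^ n) := by ring
    _ ≤ Real.exp (-(c * t)) * (Real.exp (c * (1 + t)) * n.factorial) := by gcongr
    _ = _ := by rw [← h3]; ring

/-- Comparison with `(1 + ‖x‖)^(-4)`, integrable in dimension 3. Since `‖x‖` may grow like `d²`,
this costs eight powers of `1 + d`, which the exponential absorbs. -/
theorem lintegral_exp_neg_d_lt_top (c m : ℝ) (hc : 0 < c) :
    ∫⁻ x, ENNReal.ofReal (Real.exp (-(c * d x)) * (1 + d x) ^ m) < ⊤ := by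
  obtain ⟨K, hK, hb⟩ := exists_one_add_rpow_mul_exp_le c (m + 8) hc
  have hfin : ∫⁻ x : Heis, ENNReal.ofReal ((1 + ‖x‖) ^ (-(4 : ℝ))) < ⊤ := by
    have h2 : (volume : Measure (ℝ × ℝ)).IsAddHaarMeasure :=
      Measure.prod.instIsAddHaarMeasure volume volume
    have h3 : (volume : Measure Heis).IsAddHaarMeasure :=
      Measure.prod.instIsAddHaarMeasure (volume : Measure ℝ) (volume : Measure (ℝ × ℝ))
    refine finite_integral_one_add_norm ?_
    simp only [Module.finrank_prod, Module.finrank_self]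
    norm_num
  calc _ ≤ ∫⁻ x : Heis, ENNReal.ofReal K * ENNReal.ofReal ((1 + ‖x‖) ^ (-(4 : ℝ))) := by
        refine lintegral_mono fun x => ?_
        rw [← ENNReal.ofReal_mul hK.le]
        refine ENNReal.ofReal_le_ofReal ?_
        have h0 := d_nonneg x
        have h1 := hb (d x) h0
        have h2 : (1 + d x) ^ (-(8 : ℝ)) ≤ (1 + ‖x‖) ^ (-(4 : ℝ)) := by
          have : (1 + d x) ^ (-(8 : ℝ)) = ((1 + d x) ^ 2) ^ (-(4 : ℝ)) := by
            rw [← Real.rpow_natCast, ← Real.rpow_mul (by linarith)]; norm_num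
          rw [this]
          exact Real.rpow_le_rpow_of_nonpos (by positivity) (one_add_norm_le x) (by norm_num)
        calc Real.exp (-(c * d x)) * (1 + d x) ^ m
            = Real.exp (-(c * d x)) * (1 + d x) ^ (m + 8) * (1 + d x) ^ (-(8 : ℝ)) := by
              rw [mul_assoc, ← Real.rpow_add (by linarith)]; simp
          _ ≤ _ := by gcongr
    _ = ENNReal.ofReal K * ∫⁻ x : Heis, ENNReal.ofReal ((1 + ‖x‖) ^ (-(4 : ℝ))) :=
        lintegral_const_mul' _ _ ENNReal.ofReal_ne_top
    _ < ⊤ := ENNReal.mul_lt_top ENNReal.ofReal_lt_top hfin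

section

variable {p q c₁ C₁ C₂ L : ℝ} {U : Heis → ℝ}

theorem IsConfining.neg_le (h : IsConfining p c₁ C₁ C₂ L U) (hp : 1 ≤ p) (hc : 0 < c₁) (x : Heis) :
    -U x ≤ 2 * C₂ + -(c₁ * d x) := by
  have h1 := h.lower x 0 (by rw [d_zero]; exact d_nonneg x)
  have h2 := (abs_le.1 h.zero).1
  have h3 := h.one_le_rate hp x
  rw [d_zero, sub_zero] at h1
  have : c₁ * d x ≤ c₁ * (rate p L (d x) * d x) := by
    gcongr; exact le_mul_of_one_le_left (d_nonneg x) h3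
  linarith

theorem IsConfining.lintegral_exp_le (h : IsConfining p c₁ C₁ C₂ L U) (hp : 1 ≤ p) (hc : 0 < c₁) :
    ∫⁻ x, ENNReal.ofReal (Real.exp (-U x)) ≤ ENNReal.ofReal (Real.exp (2 * C₂)) *
      ∫⁻ x, ENNReal.ofReal (Real.exp (-(c₁ * d x)) * (1 + d x) ^ (0 : ℝ)) := by
  rw [← lintegral_const_mul' _ _ ENNReal.ofReal_ne_top]
  refine lintegral_mono fun x => ?_
  rw [← ENNReal.ofReal_mul (Real.exp_pos _).le, Real.rpow_zero, mul_one, ← Real.exp_add]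
  exact ENNReal.ofReal_le_ofReal (Real.exp_le_exp.2 (h.neg_le hp hc x))

/-- Unlike the previous bound this one depends on `L`. Only finiteness matters: it allows a multiple
of the same integral to be absorbed. -/
theorem IsConfining.lintegral_exp_mul_rate_lt_top (h : IsConfining p c₁ C₁ C₂ L U) (hp : 1 ≤ p)
    (hq : 1 < q) (hc : 0 < c₁) :
    ∫⁻ x, ENNReal.ofReal (Real.exp (-U x) * rate p L (d x) ^ q) < ⊤ := by
  have hL := h.nonneg
  refine lt_of_le_of_lt (b := ENNReal.ofReal (Real.exp (2 * C₂) * (L + 1) ^ q) *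
    ∫⁻ x, ENNReal.ofReal (Real.exp (-(c₁ * d x)) * (1 + d x) ^ ((p - 1) * q))) ?_
    (ENNReal.mul_lt_top ENNReal.ofReal_lt_top (lintegral_exp_neg_d_lt_top _ _ hc))
  rw [← lintegral_const_mul' _ _ ENNReal.ofReal_ne_top]
  refine lintegral_mono fun x => ?_
  rw [← ENNReal.ofReal_mul (by positivity)]
  refine ENNReal.ofReal_le_ofReal ?_
  have h0 := d_nonneg x
  have h1 := h.one_le_rate hp x
  have h2 : rate p L (d x) ≤ (L + 1) * (1 + d x) ^ (p - 1) := by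
    have : 1 ≤ (1 + d x) ^ (p - 1) := Real.one_le_rpow (by linarith) (by linarith)
    unfold rate
    nlinarith
  calc Real.exp (-U x) * rate p L (d x) ^ q
      ≤ Real.exp (2 * C₂ + -(c₁ * d x)) * ((L + 1) * (1 + d x) ^ (p - 1)) ^ q := by
        gcongr; exact h.neg_le hp hc x
    _ = _ := by
        rw [Real.exp_add, Real.mul_rpow (by positivity) (by positivity),
          Real.rpow_mul (by positivity)]; ring

theorem IsConfining.lintegral_kernelWeight_le (h : IsConfining p c₁ C₁ C₂ L U) (hp : 1 ≤ p)
    {lam : ℝ} (hlam : 0 < lam) (z : Heis) :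
    ∫⁻ v, kernelWeight p q L U lam (hnorm v) z ≤
      ENNReal.ofReal (8 * lam ^ 4) * ENNReal.ofReal (Real.exp (-U z) * rate p L (d z) ^ q) := by
  have hz := h.one_le_rate hp z
  set H := rate p L (d z) with hH
  have hH0 : 0 < H := by linarith
  have hr0 : 0 < lam / H := by positivity
  calc ∫⁻ v, kernelWeight p q L U lam (hnorm v) z
      ≤ ∫⁻ v, {v | hnorm v < lam / H}.indicator
          (fun _ => ENNReal.ofReal (Real.exp (-U z) * H ^ (4 + q))) v := by
        refine lintegral_mono fun v => ?_
        by_cases hv : hnorm v < lam / H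
        · rw [Set.indicator_of_mem (by exact hv), kernelWeight, if_pos ((lt_div_iff₀ hH0).1 hv)]
        · rw [Set.indicator_of_notMem (by exact hv), kernelWeight,
            if_neg (fun h' => hv ((lt_div_iff₀ hH0).2 h'))]
    _ = ENNReal.ofReal (Real.exp (-U z) * H ^ (4 + q)) * ENNReal.ofReal (8 * (lam / H) ^ 4) := by
        rw [lintegral_indicator (measurableSet_hnorm_lt _), setLIntegral_const,
          volume_hnorm_lt hr0]
    _ = _ := by
        rw [← ENNReal.ofReal_mul (by positivity), ← ENNReal.ofReal_mul (by positivity)]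
        congr 1
        have e : H ^ (4 + q) = H ^ 4 * H ^ q := by
          rw [Real.rpow_add hH0]; norm_num
        rw [e]; field_simp

end

/-! ### The Poincaré inequality with weight `rate ^ q`. -/

/-- The volume of the set of displacements from `x` that get closer to the identity. -/
theorem volume_closer_ge (x : Heis) {l : ℝ} (hl : 0 < l) (hx : l ≤ d x) :
    ENNReal.ofReal (8 * (l / 40) ^ 4) ≤
      volume {v | hnorm v < 2 * l ∧ d (hmul x v) ≤ d x - l / 4} := by
  obtain ⟨v₀, h1, h2⟩ := exists_hmul_d_le x hl hx
  rw [← volume_hnorm_lt (by positivity)]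
  -- A perturbation of norm less than `l / 40` changes `d` by at most `10 * (l / 40) = l / 4`, half
  -- of the gain achieved by `v₀`.
  have hsub : {u | hnorm u < l / 40} ⊆ (fun u => hmul v₀ u) ⁻¹'
      {v | hnorm v < 2 * l ∧ d (hmul x v) ≤ d x - l / 4} := by
    intro u hu
    simp only [Set.mem_ofPred_eq, Set.mem_preimage] at hu ⊢
    refine ⟨(hnorm_hmul_le _ _).trans_lt (by linarith), ?_⟩
    rw [← hmul_assoc]
    have := (abs_le.1 (abs_d_hmul_sub_le (hmul x v₀) u)).2
    linarith
  refine (measure_mono hsub).trans (le_of_eq ?_)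
  refine (measurePreserving_hmul_left v₀).measure_preimage (MeasurableSet.nullMeasurableSet ?_)
  exact (measurableSet_hnorm_lt _).inter (measurableSet_le
    (continuous_d.comp (continuous_const.hmul continuous_id)).measurable measurable_const)

/-- The exponential gain of an inward step of size `A / rate` beats the polynomial loss from the
variation of the rate. Here `20 * A` bounds the change of `d`, and `c / 80` is `c / 4` divided by
20. -/
theorem exists_exp_neg_mul_rpow_le {p q c C₂ η : ℝ} (hc : 0 < c) (hη : 0 < η) (A₀ : ℝ) :
    ∃ A : ℝ, A₀ ≤ A ∧ 0 < A ∧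
      Real.exp (-(c * (A / 4)) + C₂) * ((1 + 20 * A) ^ (p - 1)) ^ (4 + q) ≤ η := by
  have h1 := tendsto_rpow_mul_exp_neg_mul_atTop_nhds_zero ((p - 1) * (4 + q)) (c / 80)
    (by positivity)
  have h2 : Filter.Tendsto (fun A : ℝ => 1 + 20 * A) Filter.atTop Filter.atTop :=
    Filter.tendsto_atTop_add_const_left _ _ (Filter.tendsto_id.const_mul_atTop (by norm_num))
  have h3 := (h1.comp h2).const_mul (Real.exp (c / 80 + C₂))
  rw [mul_zero] at h3
  obtain ⟨A, hA1, hA2, hA3⟩ := ((h3.eventually (ge_mem_nhds hη)).and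
    ((Filter.eventually_ge_atTop A₀).and (Filter.eventually_gt_atTop 0))).exists
  refine ⟨A, hA2, hA3, le_trans (le_of_eq ?_) hA1⟩
  simp only [Function.comp_apply]
  rw [← Real.rpow_mul (by positivity), mul_comm ((1 + 20 * A) ^ _), ← mul_assoc, ← Real.exp_add]
  congr 2
  ring

/-- Getting closer by `A / (4 * rate)` lowers `U` by at least `c₁ * A / 4 - C₂`, so the weight at
`x` is a small multiple of the one at the new point. -/
theorem kernelWeight_closer_le {p q c₁ C₁ C₂ L A : ℝ} {U : Heis → ℝ}
    (h : IsConfining p c₁ C₁ C₂ L U) (hp : 1 ≤ p) (hq : 1 < q) (hc : 0 < c₁) (hA : 0 < A)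
    {x v : Heis} (hv : hnorm v * rate p L (d x) < 2 * A)
    (hd : d (hmul x v) ≤ d x - A / rate p L (d x) / 4) :
    ENNReal.ofReal (Real.exp (-U x) * rate p L (d x) ^ (4 + q)) ≤
      ENNReal.ofReal (Real.exp (-(c₁ * (A / 4)) + C₂) * ((1 + 20 * A) ^ (p - 1)) ^ (4 + q)) *
        kernelWeight p q L U (2 * A) (hnorm v) (hmul x v) := by
  have hx := h.one_le_rate hp x
  have hz := h.one_le_rate hp (hmul x v)
  set z := hmul x v with hzdef
  set H := rate p L (d x) with hH
  have hH0 : 0 < H := by linarith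
  have hn := hnorm_nonneg v
  have hle : d z ≤ d x := by
    have : 0 < A / H / 4 := by positivity
    linarith
  have hrm : rate p L (d z) ≤ H := rate_mono hp (d_nonneg z) hle
  have hdist : |d x - d z| ≤ 20 * A := by
    rw [abs_sub_comm]
    refine (abs_d_hmul_sub_le x v).trans ?_
    nlinarith
  have hr2 : H ≤ (1 + 20 * A) ^ (p - 1) * rate p L (d z) :=
    rate_le hp h.nonneg (d_nonneg z) (d_nonneg x) hdist
  have hcond : hnorm v * rate p L (d z) < 2 * A := lt_of_le_of_lt (by gcongr) hv
  rw [kernelWeight, if_pos hcond, ← ENNReal.ofReal_mul (by positivity)]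
  refine ENNReal.ofReal_le_ofReal ?_
  have hlow := h.lower x z hle
  have h3 : A / 4 ≤ H * (d x - d z) := by
    have : A / H / 4 ≤ d x - d z := by linarith
    calc A / 4 = H * (A / H / 4) := by field_simp
      _ ≤ _ := by gcongr
  have h4 : -U x ≤ (-(c₁ * (A / 4)) + C₂) + -U z := by
    have := mul_le_mul_of_nonneg_left h3 hc.le
    linarith
  calc Real.exp (-U x) * H ^ (4 + q)
      ≤ Real.exp ((-(c₁ * (A / 4)) + C₂) + -U z) *
          ((1 + 20 * A) ^ (p - 1) * rate p L (d z)) ^ (4 + q) := by gcongr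
    _ = _ := by
        rw [Real.exp_add, Real.mul_rpow (by positivity) (by linarith)]; ring

theorem IsConfining.measurable_weight {p q c₁ C₁ C₂ L : ℝ} {U : Heis → ℝ}
    (h : IsConfining p c₁ C₁ C₂ L U) :
    Measurable fun x => ENNReal.ofReal (Real.exp (-U x) * rate p L (d x) ^ q) :=
  (h.measurable.neg.exp.mul ((measurable_rate p L).pow_const q)).ennreal_ofReal

/-- Away from the identity, the mass of `|g|^q` is controlled by moving towards the identity,
where the weight is much larger. -/
theorem exists_far_bound {p q c₁ C₁ C₂ : ℝ} (hp : 1 ≤ p) (hq : 1 < q) (hq2 : q ≤ 2)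
    (hc : 0 < c₁) (hC : 0 ≤ C₁) (A₀ : ℝ) :
    ∃ A : ℝ, A₀ ≤ A ∧ 0 < A ∧ ∃ C : ℝ, 0 < C ∧ ∀ (L : ℝ) (U : Heis → ℝ),
      IsConfining p c₁ C₁ C₂ L U → ∀ f : Heis → ℝ, ContDiff ℝ 1 f → ∀ g : Heis → ℝ, Measurable g →
      (∀ x y, |g x - g y| ≤ |f x - f y|) →
      ∫⁻ x in {x | A ≤ d x * rate p L (d x)},
          ENNReal.ofReal (Real.exp (-U x) * rate p L (d x) ^ q) * ENNReal.ofReal (|g x| ^ q) ≤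
        2⁻¹ * (∫⁻ x, ENNReal.ofReal (Real.exp (-U x) * rate p L (d x) ^ q) *
          ENNReal.ofReal (|g x| ^ q)) +
        ENNReal.ofReal C *
          ∫⁻ x, ENNReal.ofReal (Real.exp (-U x)) * ENNReal.ofReal (gradNorm f x ^ q) := by
  -- With `σ = 8 * (A/40)^4` this value of `η` is what `4 * B * 8 * (2 * A)^4 ≤ σ / 2` requires;
  -- that is the factor `2⁻¹` in the conclusion.
  obtain ⟨A, hA0, hA, hB⟩ := exists_exp_neg_mul_rpow_le (p := p) (q := q) (C₂ := C₂) hc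
    (η := 1 / (128 * 40 ^ 4)) (by positivity) A₀
  obtain ⟨C, hC0, hPP⟩ := exists_pseudo_poincare (C₂ := C₂) (Lam := 2 * A) hp hq hq2 hc.le hC
    (by positivity)
  set B := Real.exp (-(c₁ * (A / 4)) + C₂) * ((1 + 20 * A) ^ (p - 1)) ^ (4 + q) with hBdef
  have hB0 : 0 < B := by positivity
  set σ := 8 * (A / 40) ^ 4 with hσ
  have hσ0 : 0 < σ := by positivity
  refine ⟨A, hA0, hA, 4 * (C * (2 * A) ^ (4 + q)) / σ, by positivity, ?_⟩
  intro L U h f hf g hg hfg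
  set W : Heis → ENNReal := fun x => ENNReal.ofReal (Real.exp (-U x) * rate p L (d x) ^ q) with hW
  set P : Heis → ENNReal := fun x => ENNReal.ofReal (|g x| ^ q) with hP
  set I := ∫⁻ x, ENNReal.ofReal (Real.exp (-U x)) * ENNReal.ofReal (gradNorm f x ^ q) with hI
  have hWm : Measurable W := h.measurable_weight
  have hPm : Measurable P := (hg.abs.pow_const q).ennreal_ofReal
  have hfc := hf.continuous
  have m1 : Measurable fun z : Heis × Heis => kernelWeight p q L U (2 * A) (hnorm z.2) z.1 :=
    (measurable_kernelWeight h.measurable _).comp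
      (measurable_fst.prodMk (continuous_hnorm.measurable.comp measurable_snd))
  have m2 : Measurable fun z : Heis × Heis => ENNReal.ofReal (|f (hmul z.1 z.2) - f z.1| ^ q) :=
    (((hfc.comp continuous_hmul).sub (hfc.comp continuous_fst)).abs.measurable.pow_const
      q).ennreal_ofReal
  have m3 : Measurable fun z : Heis × Heis => kernelWeight p q L U (2 * A) (hnorm z.2)
      (hmul z.1 z.2) * P (hmul z.1 z.2) :=
    (m1.comp (continuous_hmul.measurable.prodMk measurable_snd)).mul
      (hPm.comp continuous_hmul.measurable)
  -- Average `|g x|^q ≤ 4 (|g(xv)|^q + |g(xv) - g x|^q)` over the displacements `v` leading inward.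
  -- The first term gains the small factor `B`, the second is an increment of `f`.
  have pointwise : ∀ x, A ≤ d x * rate p L (d x) → ENNReal.ofReal σ * (W x * P x) ≤
      4 * (ENNReal.ofReal B * ∫⁻ v, kernelWeight p q L U (2 * A) (hnorm v) (hmul x v) *
        P (hmul x v)) + 4 * ∫⁻ v, kernelWeight p q L U (2 * A) (hnorm v) x *
          ENNReal.ofReal (|f (hmul x v) - f x| ^ q) := by
    intro x hxA
    have hx := h.one_le_rate hp x
    set H := rate p L (d x) with hH
    have hH0 : 0 < H := by linarith
    set l := A / H with hl
    have hl0 : 0 < l := by positivity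
    have hvol := volume_closer_ge x hl0 ((div_le_iff₀ hH0).2 hxA)
    set S := {v | hnorm v < 2 * l ∧ d (hmul x v) ≤ d x - l / 4} with hS
    have hSm : MeasurableSet S := (measurableSet_hnorm_lt _).inter (measurableSet_le
      (continuous_d.comp (continuous_const.hmul continuous_id)).measurable measurable_const)
    have e0 : ENNReal.ofReal σ * (W x * P x) =
        ENNReal.ofReal (Real.exp (-U x) * H ^ (4 + q)) * P x *
          ENNReal.ofReal (8 * (l / 40) ^ 4) := by
      have e : H ^ (4 + q) = H ^ 4 * H ^ q := by
        rw [Real.rpow_add hH0]; norm_num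
      rw [mul_right_comm, ← mul_assoc]
      congr 1
      rw [hW, ← ENNReal.ofReal_mul hσ0.le, ← ENNReal.ofReal_mul (by positivity)]
      congr 1
      rw [hσ, hl, e]; field_simp; rw [hH]
    rw [e0]
    have msec : Measurable fun v => kernelWeight p q L U (2 * A) (hnorm v) (hmul x v) *
        P (hmul x v) := m3.comp (measurable_const.prodMk measurable_id)
    calc ENNReal.ofReal (Real.exp (-U x) * H ^ (4 + q)) * P x * ENNReal.ofReal (8 * (l / 40) ^ 4)
        ≤ ENNReal.ofReal (Real.exp (-U x) * H ^ (4 + q)) * P x * volume S := by gcongr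
      _ = ∫⁻ v in S, ENNReal.ofReal (Real.exp (-U x) * H ^ (4 + q)) * P x :=
          (setLIntegral_const _ _).symm
      _ ≤ ∫⁻ v in S, 4 * (ENNReal.ofReal B * (kernelWeight p q L U (2 * A) (hnorm v) (hmul x v) *
            P (hmul x v))) + 4 * (kernelWeight p q L U (2 * A) (hnorm v) x *
              ENNReal.ofReal (|f (hmul x v) - f x| ^ q)) := by
          refine setLIntegral_mono' hSm fun v hv => ?_
          have hv1 : hnorm v * H < 2 * A := by
            have := hv.1
            rw [hl, ← mul_div_assoc, lt_div_iff₀ hH0] at this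
            exact this
          have k1 := kernelWeight_closer_le h hp hq hc hA hv1 hv.2
          rw [← hBdef] at k1
          have k2 : kernelWeight p q L U (2 * A) (hnorm v) x =
              ENNReal.ofReal (Real.exp (-U x) * H ^ (4 + q)) := by
            rw [kernelWeight, if_pos hv1]
          rw [k2]
          have a1 := ENNReal.ofReal_abs_add_rpow_le (by linarith : 0 ≤ q) hq2 (g (hmul x v))
            (g x - g (hmul x v))
          rw [add_sub_cancel] at a1
          have a2 : ENNReal.ofReal (|g x - g (hmul x v)| ^ q) ≤
              ENNReal.ofReal (|f (hmul x v) - f x| ^ q) := by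
            refine ENNReal.ofReal_le_ofReal (Real.rpow_le_rpow (abs_nonneg _) ?_ (by linarith))
            rw [abs_sub_comm (f _)]; exact hfg _ _
          calc _ ≤ ENNReal.ofReal (Real.exp (-U x) * H ^ (4 + q)) * (4 * (P (hmul x v) +
                ENNReal.ofReal (|f (hmul x v) - f x| ^ q))) := by
                gcongr
                exact a1.trans (by gcongr)
            _ = 4 * (ENNReal.ofReal (Real.exp (-U x) * H ^ (4 + q)) * P (hmul x v)) +
                4 * (ENNReal.ofReal (Real.exp (-U x) * H ^ (4 + q)) *
                  ENNReal.ofReal (|f (hmul x v) - f x| ^ q)) := by ring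
            _ ≤ _ := by
                rw [← mul_assoc (ENNReal.ofReal B)]
                gcongr
      _ ≤ ∫⁻ v, 4 * (ENNReal.ofReal B * (kernelWeight p q L U (2 * A) (hnorm v) (hmul x v) *
            P (hmul x v))) + 4 * (kernelWeight p q L U (2 * A) (hnorm v) x *
              ENNReal.ofReal (|f (hmul x v) - f x| ^ q)) := setLIntegral_le_lintegral _ _
      _ = _ := by
          rw [lintegral_add_left ((msec.const_mul _).const_mul _),
            lintegral_const_mul' _ _ (by simp), lintegral_const_mul' _ _ ENNReal.ofReal_ne_top,
            lintegral_const_mul' _ _ (by simp)]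
  have T1 : ∫⁻ x, ∫⁻ v, kernelWeight p q L U (2 * A) (hnorm v) (hmul x v) * P (hmul x v) ≤
      ENNReal.ofReal (8 * (2 * A) ^ 4) * ∫⁻ z, W z * P z := by
    rw [lintegral_lintegral_swap m3.aemeasurable]
    have e : ∀ v, ∫⁻ x, kernelWeight p q L U (2 * A) (hnorm v) (hmul x v) * P (hmul x v) =
        ∫⁻ z, kernelWeight p q L U (2 * A) (hnorm v) z * P z := fun v =>
      (measurePreserving_hmul_right v).lintegral_comp
        ((m1.comp (measurable_id.prodMk measurable_const)).mul hPm)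
    simp only [e]
    rw [lintegral_lintegral_swap
      ((m1.comp measurable_swap).mul (hPm.comp measurable_snd)).aemeasurable,
      ← lintegral_const_mul' _ _ ENNReal.ofReal_ne_top]
    refine lintegral_mono fun z => ?_
    have m4 : Measurable fun v => kernelWeight p q L U (2 * A) (hnorm v) z :=
      m1.comp (measurable_const.prodMk measurable_id)
    rw [lintegral_mul_const _ m4, ← mul_assoc]
    gcongr
    exact h.lintegral_kernelWeight_le hp (by positivity) z
  have T2 := hPP L U h f hf (2 * A) (by positivity) le_rfl
  rw [← hI] at T2
  set Y := ∫⁻ z, W z * P z with hY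
  have hmeasfar : MeasurableSet {x | A ≤ d x * rate p L (d x)} :=
    measurableSet_le measurable_const (continuous_d.measurable.mul (measurable_rate p L))
  have total : ENNReal.ofReal σ * ∫⁻ x in {x | A ≤ d x * rate p L (d x)}, W x * P x ≤
      ENNReal.ofReal σ * (2⁻¹ * Y + ENNReal.ofReal (4 * (C * (2 * A) ^ (4 + q)) / σ) * I) := by
    calc ENNReal.ofReal σ * ∫⁻ x in {x | A ≤ d x * rate p L (d x)}, W x * P x
        = ∫⁻ x in {x | A ≤ d x * rate p L (d x)}, ENNReal.ofReal σ * (W x * P x) :=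
          (lintegral_const_mul' _ _ ENNReal.ofReal_ne_top).symm
      _ ≤ ∫⁻ x in {x | A ≤ d x * rate p L (d x)}, _ :=
          setLIntegral_mono' hmeasfar fun x hx => pointwise x hx
      _ ≤ ∫⁻ x, _ := setLIntegral_le_lintegral _ _
      _ = 4 * (ENNReal.ofReal B * ∫⁻ x, ∫⁻ v, kernelWeight p q L U (2 * A) (hnorm v) (hmul x v) *
            P (hmul x v)) + 4 * ∫⁻ x, ∫⁻ v, kernelWeight p q L U (2 * A) (hnorm v) x *
            ENNReal.ofReal (|f (hmul x v) - f x| ^ q) := by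
          rw [lintegral_add_right _ ((Measurable.lintegral_prod_right (m1.mul m2)).const_mul _),
            lintegral_const_mul' _ _ (by simp), lintegral_const_mul' _ _ ENNReal.ofReal_ne_top,
            lintegral_const_mul' _ _ (by simp)]
      _ ≤ 4 * (ENNReal.ofReal B * (ENNReal.ofReal (8 * (2 * A) ^ 4) * Y)) +
            4 * (ENNReal.ofReal (C * (2 * A) ^ (4 + q)) * I) := by gcongr
      _ = ENNReal.ofReal (4 * (B * (8 * (2 * A) ^ 4))) * Y +
            ENNReal.ofReal (4 * (C * (2 * A) ^ (4 + q))) * I := by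
          rw [ENNReal.ofReal_mul (by norm_num : (0 : ℝ) ≤ 4), ENNReal.ofReal_mul hB0.le,
            ENNReal.ofReal_mul (by norm_num : (0 : ℝ) ≤ 4), ENNReal.ofReal_ofNat]
          ring
      _ ≤ ENNReal.ofReal (σ * 2⁻¹) * Y +
            ENNReal.ofReal (σ * (4 * (C * (2 * A) ^ (4 + q)) / σ)) * I := by
          refine add_le_add (mul_le_mul_left (ENNReal.ofReal_le_ofReal ?_) _)
            (mul_le_mul_left (ENNReal.ofReal_le_ofReal ?_) _)
          · rw [hσ]
            have : B * (128 * 40 ^ 4) ≤ 1 := by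
              rwa [le_div_iff₀ (by positivity)] at hB
            have h4 : 0 < A ^ 4 := by positivity
            have : (B * (128 * 40 ^ 4)) * A ^ 4 ≤ 1 * A ^ 4 := by gcongr
            nlinarith
          · exact le_of_eq (by field_simp)
      _ = _ := by
          rw [ENNReal.ofReal_mul hσ0.le, ENNReal.ofReal_mul hσ0.le,
            ENNReal.ofReal_inv_of_pos two_pos, ENNReal.ofReal_ofNat]
          ring
  exact (ENNReal.mul_le_mul_iff_right (by simpa using hσ0) ENNReal.ofReal_ne_top).1 total

/-- Near the identity, `f` is close to one of its values. -/
theorem exists_near_bound {p q c₁ C₁ C₂ A : ℝ} (hp : 1 ≤ p) (hq : 1 < q) (hq2 : q ≤ 2)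
    (hc : 0 ≤ c₁) (hC : 0 ≤ C₁) (hA : (1 + 1) ^ (p - 1) ≤ A) :
    ∃ C : ℝ, 0 < C ∧ ∀ (L : ℝ) (U : Heis → ℝ), IsConfining p c₁ C₁ C₂ L U →
      ∀ f : Heis → ℝ, ContDiff ℝ 1 f →
      ∃ m : ℝ, ∫⁻ x in {x | d x * rate p L (d x) < A},
          ENNReal.ofReal (Real.exp (-U x) * rate p L (d x) ^ q) *
            ENNReal.ofReal (|f x - m| ^ q) ≤
        ENNReal.ofReal C *
          ∫⁻ x, ENNReal.ofReal (Real.exp (-U x)) * ENNReal.ofReal (gradNorm f x ^ q) := by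
  have hA0 : 0 < A := lt_of_lt_of_le (by positivity) hA
  set κ := (1 + A) ^ (p - 1) with hκ
  have hκ0 : 0 < κ := by positivity
  set lam := A * (1 + κ) with hlam
  have hlam0 : 0 < lam := by positivity
  obtain ⟨C, hC0, hPP⟩ := exists_pseudo_poincare (C₂ := C₂) (Lam := lam) hp hq hq2 hc hC hlam0.le
  refine ⟨C * lam ^ (4 + q) * (10 ^ 4 / 8), by positivity, ?_⟩
  intro L U h f hf
  set I := ∫⁻ x, ENNReal.ofReal (Real.exp (-U x)) * ENNReal.ofReal (gradNorm f x ^ q) with hI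
  have hfc := hf.continuous
  have hPP' := hPP L U h f hf lam hlam0 le_rfl
  rw [← hI] at hPP'
  set S := {x | d x * rate p L (d x) < A} with hS
  have hSm : MeasurableSet S :=
    measurableSet_lt (continuous_d.measurable.mul (measurable_rate p L)) measurable_const
  set H₀ := rate p L 0 with hH₀
  have hH₀1 : 1 ≤ H₀ := one_le_rate hp h.nonneg le_rfl
  have hH₀0 : 0 < H₀ := by linarith
  have hd_lt : ∀ x ∈ S, d x < A := by
    intro x hx
    have hx' : d x * rate p L (d x) < A := hx
    have := h.one_le_rate hp x
    nlinarith [d_nonneg x]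
  -- The near region is a single patch at the natural scale: any two of its points are within `lam /
  -- rate`, whatever `L` is.
  have hclose : ∀ x ∈ S, ∀ y ∈ S, hnorm (hmul (-x) y) * rate p L (d x) < lam := by
    intro x hx y hy
    have hx' : d x * rate p L (d x) < A := hx
    have hy' : d y * rate p L (d y) < A := hy
    have h1 := h.one_le_rate hp x
    have h2 : rate p L (d x) ≤ κ * rate p L (d y) := by
      refine rate_le hp h.nonneg (d_nonneg y) (d_nonneg x) ?_
      have := hd_lt x hx; have := hd_lt y hy
      have := d_nonneg x; have := d_nonneg y
      rw [abs_le]; constructor <;> linarith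
    have h3 : hnorm (hmul (-x) y) ≤ d x + d y := by
      refine (hnorm_hmul_le _ _).trans (add_le_add ?_ (hnorm_le_d y))
      rw [hnorm_neg]; exact hnorm_le_d x
    calc hnorm (hmul (-x) y) * rate p L (d x) ≤ (d x + d y) * rate p L (d x) := by gcongr
      _ = d x * rate p L (d x) + d y * rate p L (d x) := by ring
      _ ≤ d x * rate p L (d x) + d y * (κ * rate p L (d y)) := by
          have := d_nonneg y
          gcongr
      _ = d x * rate p L (d x) + κ * (d y * rate p L (d y)) := by ring
      _ < A + κ * A := by gcongr
      _ = lam := by rw [hlam]; ring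
  -- The near region contains a ball of radius `1 / (10 * H₀)`, so `H₀ ^ 4 * volume S` is bounded
  -- below independently of `L`.
  have hvol : ENNReal.ofReal (8 * (1 / (10 * H₀)) ^ 4) ≤ volume S := by
    rw [← volume_hnorm_lt (by positivity)]
    refine measure_mono fun x hx => ?_
    have hx' : hnorm x < 1 / (10 * H₀) := hx
    have h1 : d x * H₀ < 1 := by
      rw [lt_div_iff₀ (by positivity)] at hx'
      have := d_le_hnorm x
      nlinarith
    have h2 : d x ≤ 1 := by nlinarith [d_nonneg x]
    have h3 : rate p L (d x) ≤ (1 + 1) ^ (p - 1) * H₀ := by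
      refine rate_le hp h.nonneg le_rfl (d_nonneg x) ?_
      rw [sub_zero, abs_of_nonneg (d_nonneg x)]; exact h2
    have h4 := d_nonneg x
    change d x * rate p L (d x) < A
    calc d x * rate p L (d x) ≤ d x * ((1 + 1) ^ (p - 1) * H₀) := by gcongr
      _ = (1 + 1) ^ (p - 1) * (d x * H₀) := by ring
      _ < (1 + 1) ^ (p - 1) * 1 := by gcongr
      _ ≤ A := by rwa [mul_one]
  set W : Heis → ENNReal := fun x => ENNReal.ofReal (Real.exp (-U x) * rate p L (d x) ^ q) with hW
  have hWm : Measurable W := h.measurable_weight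
  set Φ : Heis → ENNReal := fun y => ∫⁻ x in S, W x * ENNReal.ofReal (|f x - f y| ^ q) with hΦ
  have mjoint : Measurable fun z : Heis × Heis =>
      W z.1 * ENNReal.ofReal (|f z.1 - f z.2| ^ q) :=
    (hWm.comp measurable_fst).mul (((hfc.comp continuous_fst).sub
      (hfc.comp continuous_snd)).abs.measurable.pow_const q).ennreal_ofReal
  have key : ENNReal.ofReal (H₀ ^ 4) * ∫⁻ y in S, Φ y ≤ ENNReal.ofReal (C * lam ^ (4 + q)) * I := by
    calc ENNReal.ofReal (H₀ ^ 4) * ∫⁻ y in S, Φ y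
        = ENNReal.ofReal (H₀ ^ 4) * ∫⁻ x in S, ∫⁻ y in S, W x * ENNReal.ofReal (|f x - f y| ^ q) := by
          rw [hΦ]
          congr 1
          exact lintegral_lintegral_swap
            (f := fun y x => W x * ENNReal.ofReal (|f x - f y| ^ q))
            (mjoint.comp measurable_swap).aemeasurable
      _ = ∫⁻ x in S, ∫⁻ y in S, ENNReal.ofReal (H₀ ^ 4) *
            (W x * ENNReal.ofReal (|f x - f y| ^ q)) := by
          rw [← lintegral_const_mul' _ _ ENNReal.ofReal_ne_top]
          simp only [← lintegral_const_mul' _ _ ENNReal.ofReal_ne_top]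
      _ ≤ ∫⁻ x in S, ∫⁻ y in S, kernelWeight p q L U lam (hnorm (hmul (-x) y)) x *
            ENNReal.ofReal (|f y - f x| ^ q) := by
          refine setLIntegral_mono' hSm fun x hx => setLIntegral_mono' hSm fun y hy => ?_
          rw [kernelWeight, if_pos (hclose x hx y hy), abs_sub_comm, ← mul_assoc]
          gcongr
          rw [hW, ← ENNReal.ofReal_mul (by positivity)]
          refine ENNReal.ofReal_le_ofReal ?_
          have h1 := h.one_le_rate hp x
          have h2 : H₀ ≤ rate p L (d x) := rate_mono hp le_rfl (d_nonneg x)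
          rw [Real.rpow_add (by linarith), show (4 : ℝ) = ((4 : ℕ) : ℝ) by norm_num,
            Real.rpow_natCast]
          calc _ = Real.exp (-U x) * (H₀ ^ 4 * rate p L (d x) ^ q) := by ring
            _ ≤ _ := by gcongr
      _ ≤ ∫⁻ x in S, ∫⁻ y, kernelWeight p q L U lam (hnorm (hmul (-x) y)) x *
            ENNReal.ofReal (|f y - f x| ^ q) :=
          lintegral_mono fun x => setLIntegral_le_lintegral _ _
      _ ≤ ∫⁻ x, ∫⁻ y, kernelWeight p q L U lam (hnorm (hmul (-x) y)) x *
            ENNReal.ofReal (|f y - f x| ^ q) := setLIntegral_le_lintegral _ _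
      _ = ∫⁻ x, ∫⁻ v, kernelWeight p q L U lam (hnorm v) x *
            ENNReal.ofReal (|f (hmul x v) - f x| ^ q) := by
          refine lintegral_congr fun x => ?_
          have mx : Measurable fun y => kernelWeight p q L U lam (hnorm (hmul (-x) y)) x *
              ENNReal.ofReal (|f y - f x| ^ q) := by
            refine Measurable.mul ?_ ?_
            · exact (measurable_kernelWeight h.measurable lam).comp (measurable_const.prodMk
                (continuous_hnorm.comp (continuous_const.hmul continuous_id)).measurable)
            · exact ((hfc.sub continuous_const).abs.measurable.pow_const q).ennreal_ofReal
          rw [← (measurePreserving_hmul_left x).lintegral_comp mx]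
          simp only [neg_hmul_cancel]
      _ ≤ _ := hPP'
  have hS0 : volume S ≠ 0 := by
    refine (lt_of_lt_of_le ?_ hvol).ne'
    rw [ENNReal.ofReal_pos]; positivity
  have hStop : volume S ≠ ⊤ := by
    have : S ⊆ {x | hnorm x < A} := fun x hx => (hnorm_le_d x).trans_lt (hd_lt x hx)
    refine ((measure_mono this).trans_lt ?_).ne
    rw [volume_hnorm_lt hA0]; exact ENNReal.ofReal_lt_top
  have hpos : ENNReal.ofReal (H₀ ^ 4) ≠ 0 := by
    rw [← pos_iff_ne_zero, ENNReal.ofReal_pos]; positivity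
  have mΦ : Measurable Φ := Measurable.lintegral_prod_left' mjoint
  -- Some `y` in `S` does no worse than the average of `Φ`; the constant `m` is the value of `f`
  -- there.
  obtain ⟨y, hyS, hy⟩ := exists_le_setLAverage hS0 hStop mΦ.aemeasurable
  refine ⟨f y, hy.trans ?_⟩
  rw [setLAverage_eq]
  refine ENNReal.div_le_of_le_mul ?_
  refine (ENNReal.mul_le_mul_iff_right hpos ENNReal.ofReal_ne_top).1 (key.trans ?_)
  calc ENNReal.ofReal (C * lam ^ (4 + q)) * I
      = ENNReal.ofReal (H₀ ^ 4) * (ENNReal.ofReal (C * lam ^ (4 + q) * (10 ^ 4 / 8)) * I *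
          ENNReal.ofReal (8 * (1 / (10 * H₀)) ^ 4)) := by
        rw [mul_right_comm, ← mul_assoc, ← ENNReal.ofReal_mul (by positivity),
          ← ENNReal.ofReal_mul (by positivity)]
        congr 2
        field_simp
    _ ≤ _ := by gcongr

/-- Weighted Poincaré inequality with weight `rate ^ q`, uniform over confining potentials. -/
theorem exists_weighted_poincare {p q c₁ C₁ C₂ : ℝ} (hp : 1 ≤ p) (hq : 1 < q) (hq2 : q ≤ 2)
    (hc : 0 < c₁) (hC : 0 ≤ C₁) :
    ∃ C : ℝ, 0 < C ∧ ∀ (L : ℝ) (U : Heis → ℝ), IsConfining p c₁ C₁ C₂ L U →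
      ∀ f : Heis → ℝ, ContDiff ℝ 1 f →
      ∃ m : ℝ, ∫⁻ x, ENNReal.ofReal (Real.exp (-U x) * rate p L (d x) ^ q) *
            ENNReal.ofReal (|f x - m| ^ q) ≤
        ENNReal.ofReal C *
          ∫⁻ x, ENNReal.ofReal (Real.exp (-U x)) * ENNReal.ofReal (gradNorm f x ^ q) := by
  obtain ⟨A, hA0, hA, C, hC0, hfar⟩ := exists_far_bound (C₂ := C₂) hp hq hq2 hc hC
    ((1 + 1) ^ (p - 1))
  obtain ⟨C', hC0', hnear⟩ := exists_near_bound (C₂ := C₂) hp hq hq2 hc.le hC hA0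
  refine ⟨2 * (C' + C), by positivity, ?_⟩
  intro L U h f hf
  obtain ⟨m, hm⟩ := hnear L U h f hf
  refine ⟨m, ?_⟩
  set I := ∫⁻ x, ENNReal.ofReal (Real.exp (-U x)) * ENNReal.ofReal (gradNorm f x ^ q) with hI
  have hfc := hf.continuous
  set W : Heis → ENNReal := fun x => ENNReal.ofReal (Real.exp (-U x) * rate p L (d x) ^ q) with hW
  have hWm : Measurable W := h.measurable_weight
  -- Absorbing `2⁻¹ * Y` requires `Y < ∞`, which truncation ensures. The truncation is 1-Lipschitz,
  -- so its increments are dominated by those of `f`; Fatou's lemma removes it.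
  let clip : ℕ → ℝ → ℝ := fun n t => max (-(n : ℝ)) (min (n : ℝ) t)
  have clip_lip : ∀ n, LipschitzWith 1 (clip n) := fun n => by
    exact (LipschitzWith.id.const_min (n : ℝ)).const_max (-(n : ℝ))
  have clip_sub : ∀ n s t, |clip n s - clip n t| ≤ |s - t| := fun n s t => by
    simpa [Real.dist_eq] using (clip_lip n).dist_le_mul s t
  have clip_zero : ∀ n, clip n 0 = 0 := fun n => by simp [clip]
  have clip_abs : ∀ n t, |clip n t| ≤ |t| := fun n t => by
    simpa [clip_zero] using clip_sub n t 0
  have clip_le : ∀ n t, |clip n t| ≤ n := fun n t => by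
    have h0 : (0 : ℝ) ≤ n := n.cast_nonneg
    exact abs_le.2 ⟨le_max_left _ _, max_le (by linarith) (min_le_left _ _)⟩
  have clip_eq : ∀ (n : ℕ) (t : ℝ), |t| ≤ n → clip n t = t := fun n t ht => by
    simp only [clip]
    rw [min_eq_right (abs_le.1 ht).2, max_eq_right (abs_le.1 ht).1]
  have bound : ∀ n : ℕ, ∫⁻ x, W x * ENNReal.ofReal (|clip n (f x - m)| ^ q) ≤
      ENNReal.ofReal (2 * (C' + C)) * I := by
    intro n
    set g : Heis → ℝ := fun x => clip n (f x - m) with hg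
    have hgm : Measurable g :=
      ((clip_lip n).continuous.comp (hfc.sub continuous_const)).measurable
    have hfar' := hfar L U h f hf g hgm fun x y => by
      refine (clip_sub n _ _).trans (le_of_eq ?_)
      congr 1; ring
    rw [← hI] at hfar'
    set Y := ∫⁻ x, W x * ENNReal.ofReal (|g x| ^ q) with hY
    have hYfin : Y ≠ ⊤ := by
      refine ne_top_of_le_ne_top (b := ENNReal.ofReal ((n : ℝ) ^ q) * ∫⁻ x, W x) ?_ ?_
      · exact (ENNReal.mul_lt_top ENNReal.ofReal_lt_top
          (h.lintegral_exp_mul_rate_lt_top hp hq hc)).ne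
      · rw [← lintegral_const_mul' _ _ ENNReal.ofReal_ne_top]
        refine lintegral_mono fun x => ?_
        rw [mul_comm]
        gcongr
        exact clip_le n _
    have hSm : MeasurableSet {x | d x * rate p L (d x) < A} :=
      measurableSet_lt (continuous_d.measurable.mul (measurable_rate p L)) measurable_const
    have hcompl : {x | d x * rate p L (d x) < A}ᶜ = {x | A ≤ d x * rate p L (d x)} := by
      ext x; simp
    have split : Y = (∫⁻ x in {x | d x * rate p L (d x) < A}, W x * ENNReal.ofReal (|g x| ^ q)) +
        ∫⁻ x in {x | A ≤ d x * rate p L (d x)}, W x * ENNReal.ofReal (|g x| ^ q) := by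
      rw [hY, ← hcompl, lintegral_add_compl _ hSm]
    have near' : ∫⁻ x in {x | d x * rate p L (d x) < A}, W x * ENNReal.ofReal (|g x| ^ q) ≤
        ENNReal.ofReal C' * I := by
      refine le_trans (lintegral_mono fun x => ?_) hm
      gcongr W x * ENNReal.ofReal (?_ ^ q)
      exact clip_abs n _
    have sum_le : 2⁻¹ * Y + 2⁻¹ * Y ≤ 2⁻¹ * Y + ENNReal.ofReal (C' + C) * I := by
      calc 2⁻¹ * Y + 2⁻¹ * Y = Y := by
            rw [← add_mul, ENNReal.inv_two_add_inv_two, one_mul]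
        _ ≤ ENNReal.ofReal C' * I + (2⁻¹ * Y + ENNReal.ofReal C * I) := by
            conv_lhs => rw [split]
            exact add_le_add near' hfar'
        _ = _ := by rw [ENNReal.ofReal_add hC0'.le hC0.le]; ring
    have half := ENNReal.le_of_add_le_add_left (by finiteness) sum_le
    calc Y = 2 * (2⁻¹ * Y) := by
          rw [← mul_assoc, ENNReal.mul_inv_cancel (by simp) (by simp), one_mul]
      _ ≤ 2 * (ENNReal.ofReal (C' + C) * I) := by gcongr
      _ = _ := by rw [ENNReal.ofReal_mul zero_le_two, ENNReal.ofReal_ofNat, mul_assoc]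
  have lim : ∀ x, W x * ENNReal.ofReal (|f x - m| ^ q) =
      Filter.liminf (fun n : ℕ => W x * ENNReal.ofReal (|clip n (f x - m)| ^ q)) Filter.atTop := by
    intro x
    have ev : (fun n : ℕ => W x * ENNReal.ofReal (|clip n (f x - m)| ^ q)) =ᶠ[Filter.atTop]
        fun _ => W x * ENNReal.ofReal (|f x - m| ^ q) := by
      obtain ⟨n₀, hn₀⟩ := exists_nat_ge |f x - m|
      filter_upwards [Filter.eventually_ge_atTop n₀] with n hn
      rw [clip_eq n _ (hn₀.trans (by exact_mod_cast hn))]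
    rw [Filter.liminf_congr ev, Filter.liminf_const]
  calc ∫⁻ x, W x * ENNReal.ofReal (|f x - m| ^ q)
      = ∫⁻ x, Filter.liminf (fun n : ℕ => W x * ENNReal.ofReal (|clip n (f x - m)| ^ q))
          Filter.atTop := lintegral_congr lim
    _ ≤ Filter.liminf (fun n : ℕ => ∫⁻ x, W x * ENNReal.ofReal (|clip n (f x - m)| ^ q))
          Filter.atTop := lintegral_liminf_le fun n => hWm.mul
            ((((clip_lip n).continuous.comp (hfc.sub continuous_const)).abs.measurable.pow_const
              q).ennreal_ofReal)
    _ ≤ Filter.liminf (fun _ : ℕ => ENNReal.ofReal (2 * (C' + C)) * I) Filter.atTop :=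
        Filter.liminf_le_liminf (.of_forall bound)
    _ = _ := Filter.liminf_const _

/-! ### From the weighted Poincaré inequality to an `L^q log L` bound. -/

section

variable {p q c₁ C₁ C₂ L : ℝ} {U : Heis → ℝ}

/-- This is where conjugacy of the exponents enters: `d ≤ ((1 + d)^(p-1))^(q-1) ≤ rate^(q-1)`. It
puts `U` under the control of the Poincaré weight. -/
theorem IsConfining.rate_mul_d_le (h : IsConfining p c₁ C₁ C₂ L U) (hp : 1 ≤ p) (hq : 1 < q)
    (hpq : (p - 1) * (q - 1) = 1) (x : Heis) :
    rate p L (d x) * d x ≤ rate p L (d x) ^ q := by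
  have hx := h.one_le_rate hp x
  have h0 := d_nonneg x
  have h1 : (1 + d x) ^ (p - 1) ≤ rate p L (d x) := by
    have := h.nonneg
    unfold rate; linarith
  have h2 : d x ≤ rate p L (d x) ^ (q - 1) := by
    calc d x ≤ 1 + d x := by linarith
      _ = ((1 + d x) ^ (p - 1)) ^ (q - 1) := by
          rw [← Real.rpow_mul (by linarith), hpq, Real.rpow_one]
      _ ≤ _ := Real.rpow_le_rpow (by positivity) h1 (by linarith)
  calc rate p L (d x) * d x ≤ rate p L (d x) * rate p L (d x) ^ (q - 1) := by gcongr
    _ = rate p L (d x) ^ q := by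
        conv_lhs => rw [← Real.rpow_one (rate p L (d x)), ← Real.rpow_mul (by linarith), one_mul,
          ← Real.rpow_add (by linarith)]
        congr 1; ring

/-- The logarithm of the local density is controlled by `rate ^ q`. -/
theorem IsConfining.posLog_le (h : IsConfining p c₁ C₁ C₂ L U) (hp : 1 ≤ p) (hq : 1 < q)
    (hpq : (p - 1) * (q - 1) = 1) (hC : 0 ≤ C₁) {C₃ Z Zm : ℝ} (hC₃ : 0 ≤ C₃) (hZ : 0 < Z)
    (hZm : Z ≤ Zm) (x : Heis) :
    Real.posLog (Real.exp C₃ * Z * Real.exp (U x) * rate p L (d x) ^ 4) ≤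
      (C₃ + Real.posLog Zm + C₁ + 2 * C₂ + 4) * rate p L (d x) ^ q := by
  have hx := h.one_le_rate hp x
  have hHd := h.rate_mul_d_le hp hq hpq x
  set H := rate p L (d x) with hH
  have hH0 : 0 < H := by linarith
  have hC2 : 0 ≤ C₂ := (abs_nonneg _).trans h.zero
  have hHq : H ≤ H ^ q := by
    conv_lhs => rw [← Real.rpow_one H]
    exact Real.rpow_le_rpow_of_exponent_le hx hq.le
  have hZ' : Real.log Z ≤ Real.posLog Zm :=
    (Real.log_le_log hZ hZm).trans (le_max_right _ _)
  have hU : U x ≤ C₁ * H ^ q + 2 * C₂ := by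
    have h1 := h.upper x 0 (by rw [d_zero]; exact d_nonneg x)
    have h2 := (abs_le.1 h.zero).2
    rw [d_zero, sub_zero, ← hH] at h1
    have := mul_le_mul_of_nonneg_left hHd hC
    linarith
  have hl : Real.log H ≤ H := (Real.log_le_sub_one_of_pos hH0).trans (by linarith)
  have hp0 : 0 ≤ Real.posLog Zm := Real.posLog_nonneg
  refine max_le (by positivity) ?_
  rw [Real.log_mul (by positivity) (by positivity), Real.log_mul (by positivity) (by positivity),
    Real.log_mul (by positivity) (by positivity), Real.log_exp, Real.log_exp, Real.log_pow]
  push_cast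
  have hHq1 : 1 ≤ H ^ q := by linarith
  nlinarith [mul_le_mul_of_nonneg_left hHq1 (by positivity : 0 ≤ C₃ + Real.posLog Zm + 2 * C₂)]

/-- At a point where `|g|^q` is large compared to its mean, its value is controlled by the
increments of `g` at a small scale. -/
theorem IsConfining.ofReal_rpow_le_of_large (h : IsConfining p c₁ C₁ C₂ L U) (hp : 1 ≤ p)
    (hq : 1 < q) (hq2 : q ≤ 2) (hc : 0 ≤ c₁) (hC : 0 ≤ C₁) {g : Heis → ℝ} (hg : Continuous g)
    {Q : ℝ} (hgQ : ∫⁻ x, ENNReal.ofReal (Real.exp (-U x)) *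
      ENNReal.ofReal (|g x| ^ q) ≤ ENNReal.ofReal Q) (k : ℕ) (x : Heis)
    (hx : 16 ^ k * (Real.exp (C₁ * (11 ^ (p - 1) * 10) + C₂) * Q * Real.exp (U x) *
      rate p L (d x) ^ 4) ≤ |g x| ^ q) :
    ENNReal.ofReal (Real.exp (-U x)) * ENNReal.ofReal (|g x| ^ q) ≤
      ENNReal.ofReal (16 ^ k) * ∫⁻ v, kernelWeight p q L U ((1 / 2) ^ k) (hnorm v) x *
        ENNReal.ofReal (|g (hmul x v) - g x| ^ q) := by
  have hH1 := h.one_le_rate hp x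
  set H := rate p L (d x) with hH
  have hH0 : 0 < H := by linarith
  set C₃ := C₁ * (11 ^ (p - 1) * 10) + C₂ with hC₃
  set r := (1 / 2) ^ k / H with hr
  have hr0 : 0 < r := by positivity
  have hrH : r ≤ 1 / H := by
    rw [hr]; gcongr; exact pow_le_one₀ (by norm_num) (by norm_num)
  set S := {v : Heis | hnorm v < r} with hS
  have hSm : MeasurableSet S := measurableSet_hnorm_lt r
  set P : Heis → ENNReal := fun x => ENNReal.ofReal (|g x| ^ q) with hP
  have hPm : Measurable P := (hg.abs.measurable.pow_const q).ennreal_ofReal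
  have hEm : Measurable fun x => ENNReal.ofReal (Real.exp (-U x)) :=
    h.measurable.neg.exp.ennreal_ofReal
  set Y := ∫⁻ v in S, ENNReal.ofReal (|g (hmul x v) - g x| ^ q) with hY
  -- On the ball `S`, `U` exceeds `U x` by at most `C₃`, because `d` changes by at most `10 / H ≤
  -- 10`. The largeness of `|g x|^q` then makes the integral of `|g|^q` over `S` at most one eighth
  -- of `|g x|^q * volume S`.
  have hX : ∫⁻ v in S, P (hmul x v) ≤ ENNReal.ofReal (r ^ 4 * |g x| ^ q) := by
    calc ∫⁻ v in S, P (hmul x v)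
        ≤ ∫⁻ v in S, ENNReal.ofReal (Real.exp (C₃ + U x)) *
            (ENNReal.ofReal (Real.exp (-U (hmul x v))) * P (hmul x v)) := by
          refine setLIntegral_mono' hSm fun v hv => ?_
          have hv' : hnorm v < r := hv
          have h1 : |d (hmul x v) - d x| ≤ 10 * (1 / H) :=
            (abs_d_hmul_sub_le x v).trans (by linarith)
          have h2 := h.sub_le hp hc hC h1
          have h3 : (1 + 10 * (1 / H)) ^ (p - 1) * H * (10 * (1 / H)) ≤ 11 ^ (p - 1) * 10 := by
            have e1 : 1 / H ≤ 1 := by rw [div_le_one hH0]; exact hH1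
            calc (1 + 10 * (1 / H)) ^ (p - 1) * H * (10 * (1 / H))
                = (1 + 10 * (1 / H)) ^ (p - 1) * 10 := by field_simp
              _ ≤ 11 ^ (p - 1) * 10 := by
                  have : 0 ≤ p - 1 := by linarith
                  gcongr
                  linarith
          have h4 : 0 ≤ C₃ + U x + -U (hmul x v) := by
            have := mul_le_mul_of_nonneg_left h3 hC
            linarith
          rw [← mul_assoc, ← ENNReal.ofReal_mul (Real.exp_pos _).le, ← Real.exp_add]
          refine le_mul_of_one_le_left (by simp) ?_
          rw [ENNReal.one_le_ofReal]
          exact Real.one_le_exp h4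
      _ ≤ ∫⁻ v, ENNReal.ofReal (Real.exp (C₃ + U x)) *
            (ENNReal.ofReal (Real.exp (-U (hmul x v))) * P (hmul x v)) :=
          setLIntegral_le_lintegral _ _
      _ = ENNReal.ofReal (Real.exp (C₃ + U x)) *
            ∫⁻ y, ENNReal.ofReal (Real.exp (-U y)) * P y := by
          rw [lintegral_const_mul' _ _ ENNReal.ofReal_ne_top,
            (measurePreserving_hmul_left x).lintegral_comp
              (f := fun y => ENNReal.ofReal (Real.exp (-U y)) * P y) (hEm.mul hPm)]
      _ ≤ ENNReal.ofReal (Real.exp (C₃ + U x)) * ENNReal.ofReal Q := by gcongr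
      _ = ENNReal.ofReal (Real.exp (C₃ + U x) * Q) := (ENNReal.ofReal_mul (Real.exp_pos _).le).symm
      _ ≤ _ := by
          refine ENNReal.ofReal_le_ofReal ?_
          have e : r ^ 4 * (16 ^ k * H ^ 4) = 1 := by
            have e16 : ((1 / 2 : ℝ) ^ k) ^ 4 * 16 ^ k = 1 := by
              rw [← pow_mul, mul_comm k 4, pow_mul, ← mul_pow]; norm_num
            calc r ^ 4 * (16 ^ k * H ^ 4) = ((1 / 2 : ℝ) ^ k) ^ 4 * 16 ^ k := by
                  rw [hr]; field_simp
              _ = 1 := e16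
          calc Real.exp (C₃ + U x) * Q
              = r ^ 4 * (16 ^ k * (Real.exp C₃ * Q * Real.exp (U x) * H ^ 4)) := by
                rw [Real.exp_add]
                linear_combination -(Real.exp C₃ * Real.exp (U x) * Q) * e
            _ ≤ _ := by gcongr
  -- Of the total `8 r^4 |g x|^q`, at most half comes from the values of `g` on the ball, so the
  -- increments account for the other half.
  have hYge : ENNReal.ofReal (r ^ 4 * |g x| ^ q) ≤ Y := by
    have h8 : ENNReal.ofReal (8 * (r ^ 4 * |g x| ^ q)) ≤
        4 * ENNReal.ofReal (r ^ 4 * |g x| ^ q) + 4 * Y := by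
      calc ENNReal.ofReal (8 * (r ^ 4 * |g x| ^ q)) = P x * volume S := by
            rw [hS, volume_hnorm_lt hr0, hP, ← ENNReal.ofReal_mul (by positivity)]
            congr 1; ring
        _ = ∫⁻ v in S, P x := (setLIntegral_const _ _).symm
        _ ≤ ∫⁻ v in S, (4 * P (hmul x v) + 4 * ENNReal.ofReal (|g (hmul x v) - g x| ^ q)) := by
            refine lintegral_mono fun v => ?_
            have a1 := ENNReal.ofReal_abs_add_rpow_le (by linarith : 0 ≤ q) hq2 (g (hmul x v))
              (g x - g (hmul x v))
            rw [add_sub_cancel, abs_sub_comm (g x), mul_add] at a1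
            exact a1
        _ = 4 * (∫⁻ v in S, P (hmul x v)) + 4 * Y := by
            have mm : Measurable fun v => P (hmul x v) :=
              hPm.comp (continuous_const.hmul continuous_id).measurable
            rw [lintegral_add_left (mm.const_mul _), lintegral_const_mul' _ _ (by simp),
              lintegral_const_mul' _ _ (by simp)]
        _ ≤ _ := by gcongr
    have h84 : ENNReal.ofReal (8 * (r ^ 4 * |g x| ^ q)) =
        4 * ENNReal.ofReal (r ^ 4 * |g x| ^ q) + 4 * ENNReal.ofReal (r ^ 4 * |g x| ^ q) := by
      rw [ENNReal.ofReal_mul (by norm_num), ENNReal.ofReal_ofNat]; ring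
    rw [h84] at h8
    have h4 := ENNReal.le_of_add_le_add_left (by finiteness) h8
    exact (ENNReal.mul_le_mul_iff_right (by simp) (by simp)).1 h4
  calc ENNReal.ofReal (Real.exp (-U x)) * ENNReal.ofReal (|g x| ^ q)
      = ENNReal.ofReal (16 ^ k) * (ENNReal.ofReal (Real.exp (-U x) * H ^ 4) *
          ENNReal.ofReal (r ^ 4 * |g x| ^ q)) := by
        rw [← ENNReal.ofReal_mul (by positivity), ← ENNReal.ofReal_mul (by positivity),
          ← ENNReal.ofReal_mul (by positivity)]
        congr 1
        have e16 : ((1 / 2 : ℝ) ^ k) ^ 4 * 16 ^ k = 1 := by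
          rw [← pow_mul, mul_comm k 4, pow_mul, ← mul_pow]; norm_num
        have e : r ^ 4 * H ^ 4 = ((1 / 2 : ℝ) ^ k) ^ 4 := by rw [hr]; field_simp
        linear_combination -(Real.exp (-U x) * |g x| ^ q) * (16 ^ k * e + e16)
    _ ≤ ENNReal.ofReal (16 ^ k) * (ENNReal.ofReal (Real.exp (-U x) * H ^ 4) * Y) := by gcongr
    _ = ENNReal.ofReal (16 ^ k) * ∫⁻ v in S, ENNReal.ofReal (Real.exp (-U x) * H ^ 4) *
          ENNReal.ofReal (|g (hmul x v) - g x| ^ q) := by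
        rw [lintegral_const_mul' _ _ ENNReal.ofReal_ne_top]
    _ ≤ ENNReal.ofReal (16 ^ k) * ∫⁻ v in S, kernelWeight p q L U ((1 / 2) ^ k) (hnorm v) x *
        ENNReal.ofReal (|g (hmul x v) - g x| ^ q) := by
        gcongr ENNReal.ofReal (16 ^ k) * ?_
        refine setLIntegral_mono' hSm fun v hv => ?_
        have hv' : hnorm v < r := hv
        rw [kernelWeight, if_pos ((lt_div_iff₀ hH0).1 hv'), ← hH]
        gcongr
        rw [← Real.rpow_natCast]
        exact Real.rpow_le_rpow_of_exponent_le hH1 (by push_cast; linarith)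
    _ ≤ _ := by
        gcongr ENNReal.ofReal (16 ^ k) * ?_
        exact setLIntegral_le_lintegral _ _

end

theorem summable_succ_mul_half_pow : Summable fun k : ℕ => 4 * ((k : ℝ) + 1) * (1 / 2) ^ k := by
  have h1 := summable_pow_mul_geometric_of_norm_lt_one (R := ℝ) 1 (r := 1 / 2) (by norm_num)
  have h2 := summable_geometric_of_lt_one (r := (1 / 2 : ℝ)) (by norm_num) (by norm_num)
  refine ((h1.add h2).mul_left 4).congr fun k => ?_
  ring

/-- Defective logarithmic Sobolev inequality, centred at a suitable constant. -/
theorem exists_entropy_bound {p q c₁ C₁ C₂ : ℝ} (hp : 1 ≤ p) (hq : 1 < q) (hq2 : q ≤ 2)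
    (hpq : (p - 1) * (q - 1) = 1) (hc : 0 < c₁) (hC : 0 ≤ C₁) (hC₂ : 0 ≤ C₂) :
    ∃ C : ℝ, 0 < C ∧ ∀ (L : ℝ) (U : Heis → ℝ), IsConfining p c₁ C₁ C₂ L U →
      ∀ f : Heis → ℝ, ContDiff ℝ 1 f → ∃ m : ℝ,
      ∫⁻ x, ENNReal.ofReal (Real.exp (-U x)) * ENNReal.ofReal (|f x - m| ^ q) ≤
        ENNReal.ofReal C *
          ∫⁻ x, ENNReal.ofReal (Real.exp (-U x)) * ENNReal.ofReal (gradNorm f x ^ q) ∧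
      ∀ Q Z : ℝ, 0 < Q → 0 < Z → ENNReal.ofReal Z ≤ ∫⁻ x, ENNReal.ofReal (Real.exp (-U x)) →
      ∫⁻ x, ENNReal.ofReal (Real.exp (-U x)) * ENNReal.ofReal (|f x - m| ^ q) ≤
        ENNReal.ofReal Q →
      ∫⁻ x, ENNReal.ofReal (Real.exp (-U x)) *
          ENNReal.ofReal (|f x - m| ^ q * Real.posLog (|f x - m| ^ q / (Q / Z))) ≤
        ENNReal.ofReal C *
          ∫⁻ x, ENNReal.ofReal (Real.exp (-U x)) * ENNReal.ofReal (gradNorm f x ^ q) := by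
  obtain ⟨C, hC0, hwp⟩ := exists_weighted_poincare (C₂ := C₂) hp hq hq2 hc hC
  obtain ⟨D, hD0, hPP⟩ := exists_pseudo_poincare (C₂ := C₂) (Lam := 1) hp hq hq2 hc.le hC
    zero_le_one
  set Zm := (ENNReal.ofReal (Real.exp (2 * C₂)) *
      ∫⁻ x, ENNReal.ofReal (Real.exp (-(c₁ * d x)) * (1 + d x) ^ (0 : ℝ))).toReal with hZm
  have hZmfin := (ENNReal.mul_lt_top (ENNReal.ofReal_lt_top (r := Real.exp (2 * C₂)))
    (lintegral_exp_neg_d_lt_top c₁ 0 hc)).ne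
  set C₃ := C₁ * (11 ^ (p - 1) * 10) + C₂ with hC₃
  have hC₃0 : 0 ≤ C₃ := by positivity
  have hpl : 0 ≤ Real.posLog Zm := Real.posLog_nonneg
  set K := C₃ + Real.posLog Zm + C₁ + 2 * C₂ + 4 with hK
  have hK4 : 4 ≤ K := by rw [hK]; linarith
  set T := ∑' k : ℕ, 4 * ((k : ℝ) + 1) * (1 / 2) ^ k with hT
  have hT0 : 0 ≤ T := tsum_nonneg fun k => by positivity
  refine ⟨K * C + D * T, by positivity, ?_⟩
  intro L U h f hf
  obtain ⟨m, hm⟩ := hwp L U h f hf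
  refine ⟨m, ?_, ?_⟩
  · calc ∫⁻ x, ENNReal.ofReal (Real.exp (-U x)) * ENNReal.ofReal (|f x - m| ^ q)
        ≤ ∫⁻ x, ENNReal.ofReal (Real.exp (-U x) * rate p L (d x) ^ q) *
            ENNReal.ofReal (|f x - m| ^ q) := by
          refine lintegral_mono fun x => ?_
          gcongr
          exact le_mul_of_one_le_right (Real.exp_pos _).le
            (Real.one_le_rpow (h.one_le_rate hp x) (by linarith))
      _ ≤ _ := hm
      _ ≤ _ := by
          gcongr
          nlinarith [mul_nonneg hD0.le hT0]
  intro Q Z hQ hZ hZle hgQ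
  set I := ∫⁻ x, ENNReal.ofReal (Real.exp (-U x)) * ENNReal.ofReal (gradNorm f x ^ q) with hI
  have hZZ : Z ≤ Zm :=
    (ENNReal.ofReal_le_iff_le_toReal hZmfin).1 (hZle.trans (h.lintegral_exp_le hp hc))
  set g : Heis → ℝ := fun x => f x - m with hg
  have hgc : Continuous g := hf.continuous.sub continuous_const
  let t : ℕ → Heis → ENNReal := fun k x => ∫⁻ v, kernelWeight p q L U ((1 / 2) ^ k) (hnorm v) x *
        ENNReal.ofReal (|g (hmul x v) - g x| ^ q)
  have mt : ∀ k, Measurable (t k) := fun k => by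
    refine Measurable.lintegral_prod_right (Measurable.mul ?_ ?_)
    · exact (measurable_kernelWeight h.measurable _).comp
        (measurable_fst.prodMk (continuous_hnorm.measurable.comp measurable_snd))
    · exact (((hgc.comp continuous_hmul).sub (hgc.comp continuous_fst)).abs.measurable.pow_const
        q).ennreal_ofReal
  have pointwise : ∀ x, ENNReal.ofReal (Real.exp (-U x)) *
      ENNReal.ofReal (|g x| ^ q * Real.posLog (|g x| ^ q / (Q / Z))) ≤
      ENNReal.ofReal K * (ENNReal.ofReal (Real.exp (-U x) * rate p L (d x) ^ q) *
            ENNReal.ofReal (|g x| ^ q)) +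
      ∑' k : ℕ, ENNReal.ofReal (4 * ((k : ℝ) + 1) * 16 ^ k) * t k x := by
    intro x
    have hH1 := h.one_le_rate hp x
    set H := rate p L (d x) with hH
    have hH0 : 0 < H := by linarith
    -- The ratio splits as `y * R`: `log y` is bounded by `rate ^ q`, while `R` measures the excess
    -- of `|g x|^q` over its natural local size.
    set y := Real.exp C₃ * Z * Real.exp (U x) * H ^ 4 with hy
    set R := |g x| ^ q / (Real.exp C₃ * Q * Real.exp (U x) * H ^ 4) with hR
    have hR0 : 0 ≤ R := by positivity
    have hprod : |g x| ^ q / (Q / Z) = y * R := by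
      rw [hy, hR]; field_simp
    have h1 : Real.posLog (|g x| ^ q / (Q / Z)) ≤ K * H ^ q + Real.posLog R := by
      rw [hprod]
      exact Real.posLog_mul.trans
        (add_le_add (h.posLog_le hp hq hpq hC hC₃0 hZ hZZ x) le_rfl)
    have h2 : ENNReal.ofReal (Real.exp (-U x)) * ENNReal.ofReal (|g x| ^ q * Real.posLog R) ≤
        ∑' k : ℕ, ENNReal.ofReal (4 * ((k : ℝ) + 1) * 16 ^ k) * t k x := by
      rcases le_or_gt R 1 with hR1 | hR1
      · have : Real.posLog R = 0 := by
          rw [Real.posLog_eq_zero_iff, abs_of_nonneg hR0]; exact hR1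
        rw [this]; simp
      -- Here `16^k ≤ R < 16^(k+1)`. The level `k` depends on `x`, and bounding its term by the
      -- whole series removes this dependence before integration.
      · obtain ⟨k, hk1, hk2⟩ := exists_nat_pow_near hR1.le (by norm_num : (1 : ℝ) < 16)
        refine le_trans ?_ (ENNReal.le_tsum k)
        have hlog : Real.posLog R ≤ 4 * ((k : ℝ) + 1) := by
          refine max_le (by positivity) ?_
          have e1 : Real.log R ≤ Real.log (16 ^ (k + 1)) := Real.log_le_log (by linarith) hk2.le
          have e2 : Real.log 16 ≤ 4 := by
            rw [show (16 : ℝ) = 2 ^ 4 by norm_num, Real.log_pow]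
            have := Real.log_two_lt_d9
            push_cast; linarith
          rw [Real.log_pow] at e1
          push_cast at e1
          nlinarith
        have hlarge := h.ofReal_rpow_le_of_large hp hq hq2 hc.le hC hgc hgQ k x (by
          rw [hR, le_div_iff₀ (by positivity)] at hk1
          exact hk1)
        calc ENNReal.ofReal (Real.exp (-U x)) * ENNReal.ofReal (|g x| ^ q * Real.posLog R)
            ≤ ENNReal.ofReal (Real.exp (-U x)) *
                ENNReal.ofReal (|g x| ^ q * (4 * ((k : ℝ) + 1))) := by gcongr
          _ = ENNReal.ofReal (4 * ((k : ℝ) + 1)) *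
                (ENNReal.ofReal (Real.exp (-U x)) * ENNReal.ofReal (|g x| ^ q)) := by
              rw [ENNReal.ofReal_mul (by positivity)]; ring
          _ ≤ ENNReal.ofReal (4 * ((k : ℝ) + 1)) * (ENNReal.ofReal (16 ^ k) * t k x) := by
              gcongr
          _ = _ := by rw [← mul_assoc, ← ENNReal.ofReal_mul (by positivity)]
    calc ENNReal.ofReal (Real.exp (-U x)) *
          ENNReal.ofReal (|g x| ^ q * Real.posLog (|g x| ^ q / (Q / Z)))
        ≤ ENNReal.ofReal (Real.exp (-U x)) *
          ENNReal.ofReal (|g x| ^ q * (K * H ^ q) + |g x| ^ q * Real.posLog R) := by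
          rw [← mul_add]; gcongr
      _ = ENNReal.ofReal (Real.exp (-U x)) * ENNReal.ofReal (|g x| ^ q * (K * H ^ q)) +
          ENNReal.ofReal (Real.exp (-U x)) * ENNReal.ofReal (|g x| ^ q * Real.posLog R) := by
          rw [ENNReal.ofReal_add (by positivity)
            (mul_nonneg (by positivity) Real.posLog_nonneg), mul_add]
      _ ≤ _ := by
          refine add_le_add (le_of_eq ?_) h2
          rw [← ENNReal.ofReal_mul (by positivity), ← ENNReal.ofReal_mul (by positivity),
            ← ENNReal.ofReal_mul (by positivity)]
          congr 1; ring
  -- At `lam = 2^(-k)` the factor `lam^4` cancels `16^k`, and what is left, `lam^q ≤ 2^(-k)`, makes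
  -- the series converge.
  have sum_t : ∑' k : ℕ, ENNReal.ofReal (4 * ((k : ℝ) + 1) * 16 ^ k) * ∫⁻ x, t k x ≤
      ENNReal.ofReal (D * T) * I := by
    have each : ∀ k : ℕ, ENNReal.ofReal (4 * ((k : ℝ) + 1) * 16 ^ k) * ∫⁻ x, t k x ≤
        ENNReal.ofReal (4 * ((k : ℝ) + 1) * (1 / 2) ^ k) * (ENNReal.ofReal D * I) := by
      intro k
      have hk := hPP L U h f hf ((1 / 2) ^ k) (by positivity)
        (pow_le_one₀ (by norm_num) (by norm_num))
      rw [← hI] at hk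
      have ht : ∫⁻ x, t k x ≤ ENNReal.ofReal (D * ((1 / 2) ^ k) ^ (4 + q)) * I := by
        simpa [t, hg] using hk
      calc _ ≤ ENNReal.ofReal (4 * ((k : ℝ) + 1) * 16 ^ k) *
            (ENNReal.ofReal (D * ((1 / 2) ^ k) ^ (4 + q)) * I) := by gcongr
        _ = ENNReal.ofReal (4 * ((k : ℝ) + 1) * 16 ^ k * (D * ((1 / 2) ^ k) ^ (4 + q))) * I := by
            rw [← mul_assoc, ← ENNReal.ofReal_mul (by positivity)]
        _ ≤ ENNReal.ofReal (4 * ((k : ℝ) + 1) * (1 / 2) ^ k * D) * I := by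
            refine mul_le_mul_left (ENNReal.ofReal_le_ofReal ?_) _
            have e16 : 16 ^ k * ((1 / 2 : ℝ) ^ k) ^ 4 = 1 := by
              rw [← pow_mul, mul_comm k 4, pow_mul, ← mul_pow]; norm_num
            have e1 : ((1 / 2 : ℝ) ^ k) ^ q ≤ (1 / 2) ^ k := by
              conv_rhs => rw [← Real.rpow_one ((1 / 2 : ℝ) ^ k)]
              exact Real.rpow_le_rpow_of_exponent_ge (by positivity)
                (pow_le_one₀ (by norm_num) (by norm_num)) hq.le
            rw [Real.rpow_add (by positivity), show (4 : ℝ) = ((4 : ℕ) : ℝ) by norm_num,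
              Real.rpow_natCast]
            calc ((4 : ℕ) : ℝ) * ((k : ℝ) + 1) * 16 ^ k * (D * (((1 / 2) ^ k) ^ 4 *
                  ((1 / 2) ^ k) ^ q))
                = ((4 : ℕ) : ℝ) * ((k : ℝ) + 1) * D * ((1 / 2) ^ k) ^ q := by
                  linear_combination ((4 : ℕ) : ℝ) * ((k : ℝ) + 1) * D * ((1 / 2) ^ k) ^ q * e16
              _ ≤ ((4 : ℕ) : ℝ) * ((k : ℝ) + 1) * D * (1 / 2) ^ k := by gcongr
              _ = _ := by ring
        _ = _ := by rw [← mul_assoc, ← ENNReal.ofReal_mul (by positivity)]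
    refine (ENNReal.tsum_le_tsum each).trans (le_of_eq ?_)
    rw [ENNReal.tsum_mul_right, ← ENNReal.ofReal_tsum_of_nonneg (fun k => by positivity)
      summable_succ_mul_half_pow, ← hT, ← mul_assoc, ← ENNReal.ofReal_mul hT0, mul_comm T]
  have mW : Measurable fun x => ENNReal.ofReal K *
      (ENNReal.ofReal (Real.exp (-U x) * rate p L (d x) ^ q) * ENNReal.ofReal (|g x| ^ q)) :=
    (h.measurable_weight.mul (hgc.abs.measurable.pow_const q).ennreal_ofReal).const_mul _
  calc _ ≤ ∫⁻ x, _ := lintegral_mono pointwise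
    _ = ENNReal.ofReal K * (∫⁻ x, ENNReal.ofReal (Real.exp (-U x) * rate p L (d x) ^ q) *
            ENNReal.ofReal (|g x| ^ q)) +
        ∑' k : ℕ, ENNReal.ofReal (4 * ((k : ℝ) + 1) * 16 ^ k) * ∫⁻ x, t k x := by
        rw [lintegral_add_left mW, lintegral_const_mul' _ _ ENNReal.ofReal_ne_top,
          lintegral_tsum fun k => ((mt k).const_mul _).aemeasurable]
        simp only [lintegral_const_mul' _ _ ENNReal.ofReal_ne_top]
    _ ≤ ENNReal.ofReal K * (ENNReal.ofReal C * I) + ENNReal.ofReal (D * T) * I := by gcongr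
    _ = _ := by
        rw [← mul_assoc, ← ENNReal.ofReal_mul (by positivity), ← add_mul,
          ← ENNReal.ofReal_add (by positivity) (by positivity)]

end Heis

/-! ### Passing from the centred function to the entropy of `|f|^q`. -/

theorem Real.rpow_sub_rpow_le {p a b : ℝ} (hp : 1 ≤ p) (ha : 0 ≤ a) (hab : a ≤ b) :
    b ^ p - a ^ p ≤ p * b ^ (p - 1) * (b - a) := by
  rcases (ha.trans hab).eq_or_lt with hb | hb
  · have : a = 0 := le_antisymm (hb ▸ hab) ha
    simp [this, ← hb]
  have h := one_add_mul_self_le_rpow_one_add (s := a / b - 1)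
    (by have : 0 ≤ a / b := by positivity
        linarith) hp
  rw [add_sub_cancel, Real.div_rpow ha hb.le] at h
  have hbp : 0 < b ^ p := by positivity
  have h2 : (1 + p * (a / b - 1)) * b ^ p ≤ a ^ p := by
    rwa [← le_div_iff₀ hbp]
  have h3 : b ^ p = b ^ (p - 1) * b := by
    rw [← Real.rpow_add_one hb.ne', sub_add_cancel]
  have h4 : (a / b - 1) * b ^ p = -(b ^ (p - 1) * (b - a)) := by
    rw [h3]; field_simp; ring
  nlinarith

theorem Real.mul_log_le_of_le {F b s : ℝ} (hF : 0 ≤ F) (hs : 0 < s) (hFb : F ≤ 8 * b) :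
    F * Real.log (F / s) ≤ 8 * b * (3 + Real.posLog (b / s)) := by
  have hb : 0 ≤ b := by linarith
  have h1 : Real.log (F / s) ≤ Real.posLog (8 * (b / s)) := by
    refine (le_max_right 0 _).trans (Real.posLog_le_posLog (by positivity) ?_)
    rw [← mul_div_assoc]; gcongr
  have h8 : Real.posLog 8 ≤ 3 := by
    refine max_le (by norm_num) ?_
    rw [show (8 : ℝ) = 2 ^ 3 by norm_num, Real.log_pow]
    have := Real.log_two_lt_d9
    push_cast; linarith
  have h2 : Real.posLog (8 * (b / s)) ≤ 3 + Real.posLog (b / s) :=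
    Real.posLog_mul.trans (by linarith)
  have h3 : 0 ≤ Real.posLog (b / s) := Real.posLog_nonneg
  calc F * Real.log (F / s) ≤ F * (3 + Real.posLog (b / s)) := by gcongr; linarith
    _ ≤ _ := by gcongr

/-- Pointwise bound for the relative entropy density of `|m + y|^q` with respect to
`max (|m|^q) t`. -/
theorem Real.entropy_density_le {q : ℝ} (hq : 1 < q) (hq2 : q ≤ 2) (m y : ℝ) {t : ℝ} (ht : 0 < t) :
    |m + y| ^ q * Real.log (|m + y| ^ q / max (|m| ^ q) t) - |m + y| ^ q + max (|m| ^ q) t ≤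
      25 * (t + |y| ^ q + |y| ^ q * Real.posLog (|y| ^ q / t)) := by
  have hq0 : 0 ≤ q := by linarith
  set F := |m + y| ^ q with hF
  set a := |y| ^ q with ha
  have hF0 : 0 ≤ F := by positivity
  have ha0 : 0 ≤ a := by positivity
  have hpl : 0 ≤ Real.posLog (a / t) := Real.posLog_nonneg
  have hapl : 0 ≤ a * Real.posLog (a / t) := mul_nonneg ha0 hpl
  have hFle : F ≤ 4 * (|m| ^ q + a) := Real.abs_add_rpow_le hq0 hq2 m y
  rcases le_or_gt t (|m| ^ q) with hm | hm
  · rw [max_eq_left hm]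
    set s := |m| ^ q with hs
    have hs0 : 0 < s := by linarith
    have hm0 : 0 < |m| := by
      rcases (abs_nonneg m).eq_or_lt with h | h
      · rw [hs, ← h, Real.zero_rpow (by linarith)] at hs0
        exact absurd hs0 (lt_irrefl _)
      · exact h
    -- If `|y| ≤ |m|`, the density is at most quadratic, `(F - s)^2 / s`, and `|F - s| ≤
    -- 4|m|^(q-1)|y|`; then `q ≤ 2` gives `|y|^2 ≤ |y|^q |m|^(2-q)`. Otherwise `F ≤ 8 * a`, and `25`
    -- arises as `8 * 3 + 1`.
    rcases le_or_gt |y| |m| with hy | hy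
    · have h1 : F * Real.log (F / s) - F + s ≤ (F - s) ^ 2 / s := by
        have : F * Real.log (F / s) ≤ F * (F / s - 1) := by
          rcases hF0.eq_or_lt with h | h
          · rw [← h]; simp
          · exact mul_le_mul_of_nonneg_left (Real.log_le_sub_one_of_pos (by positivity)) hF0
        have e : (F - s) ^ 2 / s = F * (F / s - 1) - F + s := by field_simp; ring
        linarith
      have h2 : |F - s| ≤ 4 * (|m| ^ (q - 1) * |y|) := by
        have hmy : |m + y| ≤ 2 * |m| := (abs_add_le _ _).trans (by linarith)
        have hdiff : |(|m + y| - |m|)| ≤ |y| := by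
          have := abs_abs_sub_abs_le_abs_sub (m + y) m
          rwa [add_sub_cancel_left] at this
        have gen : ∀ b : ℝ, 0 ≤ b → b ≤ 2 * |m| → q * b ^ (q - 1) ≤ 4 * |m| ^ (q - 1) := by
          intro b hb hb2
          have e1 : b ^ (q - 1) ≤ 2 * |m| ^ (q - 1) := by
            calc b ^ (q - 1) ≤ (2 * |m|) ^ (q - 1) := by
                  exact Real.rpow_le_rpow hb hb2 (by linarith)
              _ = 2 ^ (q - 1) * |m| ^ (q - 1) := Real.mul_rpow (by norm_num) hm0.le
              _ ≤ 2 ^ (1 : ℝ) * |m| ^ (q - 1) := by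
                  gcongr
                  · norm_num
                  · linarith
              _ = _ := by rw [Real.rpow_one]
          have : 0 ≤ |m| ^ (q - 1) := by positivity
          have : 0 ≤ b ^ (q - 1) := by positivity
          nlinarith
        rcases le_total |m + y| |m| with hle | hle
        · have h3 := Real.rpow_sub_rpow_le hq.le (abs_nonneg (m + y)) hle
          have h4 := gen |m| hm0.le (by linarith)
          have h5 : F ≤ s := Real.rpow_le_rpow (abs_nonneg _) hle hq0
          rw [abs_sub_comm, abs_of_nonneg (by linarith)]
          calc s - F ≤ _ := h3
            _ ≤ (4 * |m| ^ (q - 1)) * |y| := by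
                have : |m| - |m + y| ≤ |y| := by
                  have := (abs_le.1 hdiff).1; linarith
                have : 0 ≤ |m| - |m + y| := by linarith
                gcongr
            _ = _ := by ring
        · have h3 := Real.rpow_sub_rpow_le hq.le hm0.le hle
          have h4 := gen |m + y| (abs_nonneg _) hmy
          have h5 : s ≤ F := Real.rpow_le_rpow (abs_nonneg _) hle hq0
          rw [abs_of_nonneg (by linarith)]
          calc F - s ≤ _ := h3
            _ ≤ (4 * |m| ^ (q - 1)) * |y| := by
                have : |m + y| - |m| ≤ |y| := (abs_le.1 hdiff).2
                have : 0 ≤ |m + y| - |m| := by linarith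
                gcongr
            _ = _ := by ring
      have h3 : (F - s) ^ 2 / s ≤ 16 * a := by
        rw [div_le_iff₀ hs0, ← sq_abs]
        have h4 : (|m| ^ (q - 1) * |y|) ^ 2 ≤ a * s := by
          rcases (abs_nonneg y).eq_or_lt with h | h
          · rw [← h]; simp; positivity
          · have e1 : |y| ^ (2 : ℝ) = a * |y| ^ (2 - q) := by
              rw [ha, ← Real.rpow_add h]; congr 1; ring
            have e2 : |y| ^ (2 - q) ≤ |m| ^ (2 - q) := Real.rpow_le_rpow h.le hy (by linarith)
            have e3 : (|m| ^ (q - 1)) ^ 2 * |m| ^ (2 - q) = s := by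
              rw [← Real.rpow_natCast, ← Real.rpow_mul hm0.le, ← Real.rpow_add hm0, hs]
              congr 1; push_cast; ring
            calc (|m| ^ (q - 1) * |y|) ^ 2 = (|m| ^ (q - 1)) ^ 2 * |y| ^ (2 : ℝ) := by
                  rw [mul_pow, Real.rpow_two]
              _ = a * ((|m| ^ (q - 1)) ^ 2 * |y| ^ (2 - q)) := by rw [e1]; ring
              _ ≤ a * ((|m| ^ (q - 1)) ^ 2 * |m| ^ (2 - q)) := by gcongr
              _ = a * s := by rw [e3]
        calc |F - s| ^ 2 ≤ (4 * (|m| ^ (q - 1) * |y|)) ^ 2 := by gcongr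
          _ = 16 * (|m| ^ (q - 1) * |y|) ^ 2 := by ring
          _ ≤ 16 * (a * s) := by gcongr
          _ = _ := by ring
      linarith
    · have hsa : s ≤ a := Real.rpow_le_rpow (abs_nonneg _) hy.le hq0
      have h1 := Real.mul_log_le_of_le hF0 hs0 (b := a) (by linarith)
      have h2 : Real.posLog (a / s) ≤ Real.posLog (a / t) := by
        refine Real.posLog_le_posLog (by positivity) ?_
        gcongr
      have := mul_le_mul_of_nonneg_left h2 ha0
      linarith
  · rw [max_eq_right hm.le]
    rcases le_or_gt a t with h | h
    · have h1 := Real.mul_log_le_of_le hF0 ht (b := t) (by linarith)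
      rw [div_self ht.ne', Real.posLog_one] at h1
      linarith
    · have h1 := Real.mul_log_le_of_le hF0 ht (b := a) (by linarith)
      linarith

/-- Entropy of `|f|^q` in terms of the `L^q log L`-size of `f - m`, for any constant `m`. -/
theorem entropy_le_of_centered {α : Type*} [MeasurableSpace α] (μ : Measure α)
    [IsProbabilityMeasure μ] {q : ℝ} (hq : 1 < q) (hq2 : q ≤ 2) {f : α → ℝ} (hf : Measurable f)
    (m : ℝ) (h1 : Integrable (fun x => |f x - m| ^ q) μ) (ht : 0 < ∫ x, |f x - m| ^ q ∂μ)
    (h2 : Integrable (fun x => |f x - m| ^ q *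
      Real.posLog (|f x - m| ^ q / ∫ y, |f y - m| ^ q ∂μ)) μ) :
    Integrable (fun x => |f x| ^ q) μ ∧
    Integrable (fun x => |f x| ^ q * Real.log (|f x| ^ q / ∫ y, |f y| ^ q ∂μ)) μ ∧
    ∫ x, |f x| ^ q * Real.log (|f x| ^ q / ∫ y, |f y| ^ q ∂μ) ∂μ ≤
      25 * (2 * (∫ x, |f x - m| ^ q ∂μ) + ∫ x, |f x - m| ^ q *
        Real.posLog (|f x - m| ^ q / ∫ y, |f y - m| ^ q ∂μ) ∂μ) := by
  set t := ∫ x, |f x - m| ^ q ∂μ with htdef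
  set F : α → ℝ := fun x => |f x| ^ q with hF
  set g : α → ℝ := fun x => |f x - m| ^ q with hg
  have hF0 : ∀ x, 0 ≤ F x := fun x => by positivity
  have hFm : Measurable F := hf.abs.pow_const q
  have hFint : Integrable F μ := by
    refine Integrable.mono' (g := fun x => 4 * (|m| ^ q + g x))
      (((integrable_const _).add h1).const_mul 4) hFm.aestronglyMeasurable (.of_forall fun x => ?_)
    rw [Real.norm_of_nonneg (hF0 x)]
    have := Real.abs_add_rpow_le (by linarith : 0 ≤ q) hq2 m (f x - m)
    rwa [add_sub_cancel] at this
  refine ⟨hFint, ?_⟩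
  -- The explicit reference value `s` replaces the unknown mean `A` of `F`. The mean minimises the
  -- integrated density, as `A log (A / s) - A + s ≥ 0`, so nothing is lost; the lower bound `t`
  -- keeps `s` positive.
  set s := max (|m| ^ q) t with hs
  have hs0 : 0 < s := lt_of_lt_of_le ht (le_max_right _ _)
  set ψ : α → ℝ := fun x => F x * Real.log (F x / s) - F x + s with hψ
  set B : α → ℝ := fun x => 25 * (t + g x + g x * Real.posLog (g x / t)) with hB
  have hBint : Integrable B μ := (((integrable_const t).add h1).add h2).const_mul 25
  have hψB : ∀ x, ψ x ≤ B x := fun x => by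
    have := Real.entropy_density_le hq hq2 m (f x - m) ht
    rwa [add_sub_cancel] at this
  have lower : ∀ y : ℝ, 0 ≤ y → y - s ≤ y * Real.log (y / s) := by
    intro y hy
    rcases hy.eq_or_lt with h | h
    · rw [← h]; simp; exact hs0.le
    · have := Real.one_sub_inv_le_log_of_pos (x := y / s) (by positivity)
      have h3 := mul_le_mul_of_nonneg_left this hy
      have e : y * (1 - (y / s)⁻¹) = y - s := by field_simp
      linarith
  have hψ0 : ∀ x, 0 ≤ ψ x := fun x => by
    have := lower (F x) (hF0 x)
    simp only [hψ]; linarith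
  have hψm : Measurable ψ := by
    have : Measurable fun x => Real.log (F x / s) := (hFm.div_const s).log
    exact ((hFm.mul this).sub hFm).add measurable_const
  have hψint : Integrable ψ μ := by
    refine Integrable.mono' hBint hψm.aestronglyMeasurable (.of_forall fun x => ?_)
    rw [Real.norm_of_nonneg (hψ0 x)]; exact hψB x
  have hlogint : Integrable (fun x => F x * Real.log (F x / s)) μ := by
    refine ((hψint.add hFint).sub (integrable_const s)).congr (.of_forall fun x => ?_)
    simp only [hψ, Pi.add_apply, Pi.sub_apply]; ring
  have hintB : ∫ x, B x ∂μ = 25 * (2 * t + ∫ x, g x * Real.posLog (g x / t) ∂μ) := by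
    have e1 : ∫ x, B x ∂μ = 25 * ∫ x, (t + g x + g x * Real.posLog (g x / t)) ∂μ :=
      integral_const_mul _ _
    have i1 : Integrable (fun x => t + g x) μ := (integrable_const t).add h1
    have i2 : Integrable (fun x => g x * Real.posLog (g x / t)) μ := h2
    rw [e1, integral_add i1 i2, integral_add (integrable_const t) h1]
    simp only [integral_const, probReal_univ, one_smul]
    rw [← htdef]; ring
  have hψle : ∫ x, ψ x ∂μ ≤ 25 * (2 * t + ∫ x, g x * Real.posLog (g x / t) ∂μ) := by
    rw [← hintB]; exact integral_mono hψint hBint hψB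
  set A := ∫ y, F y ∂μ with hA
  have hA0 : 0 ≤ A := integral_nonneg hF0
  -- If the mean is 0, division by zero and `log 0 = 0` make the entropy integrand vanish
  -- identically.
  rcases hA0.eq_or_lt with h0 | hApos
  · rw [← h0]
    simp only [div_zero, Real.log_zero, mul_zero, integral_zero]
    exact ⟨integrable_zero _ _ _, (integral_nonneg hψ0).trans hψle⟩
  · have e : ∀ x, F x * Real.log (F x / A) = F x * Real.log (F x / s) - F x * Real.log (A / s) := by
      intro x
      rcases (hF0 x).eq_or_lt with h | h
      · rw [← h]; simp
      · rw [Real.log_div h.ne' hApos.ne', Real.log_div h.ne' hs0.ne',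
          Real.log_div hApos.ne' hs0.ne']
        ring
    change Integrable (fun x => F x * Real.log (F x / A)) μ ∧
      ∫ x, F x * Real.log (F x / A) ∂μ ≤ _
    simp only [e]
    refine ⟨hlogint.sub (hFint.mul_const _), ?_⟩
    have hψeq : ∫ x, ψ x ∂μ = (∫ x, F x * Real.log (F x / s) ∂μ) - A + s := by
      have e2 : ∫ x, ψ x ∂μ = ∫ x, ((F x * Real.log (F x / s) - F x) + s) ∂μ := rfl
      have i3 : Integrable (fun x => F x * Real.log (F x / s) - F x) μ := hlogint.sub hFint
      rw [e2, integral_add i3 (integrable_const s), integral_sub hlogint hFint]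
      simp only [integral_const, probReal_univ, one_smul]
      rw [hA]
    rw [integral_sub hlogint (hFint.mul_const _), integral_mul_const, ← hA]
    have := lower A hA0
    linarith

theorem integrable_and_integral_le_of_lintegral_le {α : Type*} [MeasurableSpace α] {μ : Measure α}
    {φ : α → ℝ} (hm : Measurable φ) (h0 : ∀ x, 0 ≤ φ x) {B : ℝ} (hB : 0 ≤ B)
    (h : ∫⁻ x, ENNReal.ofReal (φ x) ∂μ ≤ ENNReal.ofReal B) :
    Integrable φ μ ∧ ∫ x, φ x ∂μ ≤ B := by
  have hi : Integrable φ μ := by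
    refine ⟨hm.aestronglyMeasurable, ?_⟩
    rw [hasFiniteIntegral_iff_ofReal (.of_forall h0)]
    exact h.trans_lt ENNReal.ofReal_lt_top
  refine ⟨hi, ?_⟩
  rw [← ofReal_integral_eq_lintegral_ofReal hi (.of_forall h0)] at h
  exact (ENNReal.ofReal_le_ofReal_iff hB).1 h

theorem MeasureTheory.Measure.tilted_add_const {α : Type*} [MeasurableSpace α] (μ : Measure α)
    (f : α → ℝ) (c : ℝ) : μ.tilted (fun x => f x + c) = μ.tilted f := by
  simp only [Measure.tilted, Real.exp_add, integral_mul_const]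
  congr 1
  funext x
  rw [mul_div_mul_right _ _ (Real.exp_pos c).ne']

/-! ### Logarithmic Sobolev inequality for confining potentials. -/

namespace Heis

/-- Logarithmic Sobolev inequality for confining potentials, with a constant that depends only on
the confinement parameters. -/
theorem exists_logSobolev {p q c₁ C₁ C₂ : ℝ} (hp : 1 ≤ p) (hq : 1 < q) (hq2 : q ≤ 2)
    (hpq : (p - 1) * (q - 1) = 1) (hc : 0 < c₁) (hC : 0 ≤ C₁) (hC₂ : 0 ≤ C₂) :
    ∃ c : ℝ, 0 < c ∧ ∀ (L : ℝ) (U : Heis → ℝ), IsConfining p c₁ C₁ C₂ L U →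
      IsProbabilityMeasure ((volume : Measure Heis).tilted fun x => -U x) ∧
      ∀ f : Heis → ℝ, ContDiff ℝ 1 f →
        Integrable (fun x => gradNorm f x ^ q) ((volume : Measure Heis).tilted fun x => -U x) →
        Integrable (fun x => |f x| ^ q) ((volume : Measure Heis).tilted fun x => -U x) ∧
        Integrable (fun x => |f x| ^ q * Real.log (|f x| ^ q /
            ∫ y, |f y| ^ q ∂((volume : Measure Heis).tilted fun x => -U x)))
          ((volume : Measure Heis).tilted fun x => -U x) ∧
        ∫ x, |f x| ^ q * Real.log (|f x| ^ q /
            ∫ y, |f y| ^ q ∂((volume : Measure Heis).tilted fun x => -U x))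
          ∂((volume : Measure Heis).tilted fun x => -U x) ≤
        c * ∫ x, gradNorm f x ^ q ∂((volume : Measure Heis).tilted fun x => -U x) := by
  obtain ⟨C, hC0, hent⟩ := exists_entropy_bound hp hq hq2 hpq hc hC hC₂
  -- `75 = 25 * (2 + 1)`: `C` bounds both `t`, which occurs twice, and the `posLog` integral.
  refine ⟨75 * C, by positivity, ?_⟩
  intro L U h
  set μ := (volume : Measure Heis).tilted fun x => -U x with hμ
  have hEint : Integrable (fun x => Real.exp (-U x)) (volume : Measure Heis) := by
    refine ⟨h.measurable.neg.exp.aestronglyMeasurable, ?_⟩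
    rw [hasFiniteIntegral_iff_ofReal (.of_forall fun x => (Real.exp_pos _).le)]
    exact (h.lintegral_exp_le hp hc).trans_lt
      (ENNReal.mul_lt_top ENNReal.ofReal_lt_top (lintegral_exp_neg_d_lt_top c₁ 0 hc))
  have hprob : IsProbabilityMeasure μ := isProbabilityMeasure_tilted hEint
  refine ⟨hprob, ?_⟩
  intro f hf hgrad
  set Z := ∫ x, Real.exp (-U x) with hZ
  have hZ0 : 0 < Z := integral_exp_pos hEint
  have hZl : ENNReal.ofReal Z = ∫⁻ x, ENNReal.ofReal (Real.exp (-U x)) :=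
    ofReal_integral_eq_lintegral_ofReal hEint (.of_forall fun x => (Real.exp_pos _).le)
  have conv : ∀ φ : Heis → ENNReal, ∫⁻ x, ENNReal.ofReal (Real.exp (-U x)) * φ x =
      ENNReal.ofReal Z * ∫⁻ x, φ x ∂μ := by
    intro φ
    rw [hμ, lintegral_tilted, ← lintegral_const_mul' _ _ ENNReal.ofReal_ne_top]
    refine lintegral_congr fun x => ?_
    rw [← mul_assoc, ← ENNReal.ofReal_mul hZ0.le, ← hZ, mul_div_cancel₀ _ hZ0.ne']
  have cancel : ∀ a b : ENNReal, ENNReal.ofReal Z * a ≤ ENNReal.ofReal C * (ENNReal.ofReal Z * b) →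
      a ≤ ENNReal.ofReal C * b := by
    intro a b hab
    rw [mul_left_comm] at hab
    exact (ENNReal.mul_le_mul_iff_right (by simpa using hZ0) ENNReal.ofReal_ne_top).1 hab
  obtain ⟨m, hm1, hm2⟩ := hent L U h f hf
  have hfc := hf.continuous
  set G := ∫ x, gradNorm f x ^ q ∂μ with hG
  have hG0 : 0 ≤ G := integral_nonneg fun x => Real.rpow_nonneg (gradNorm_nonneg f x) q
  have hGl : ∫⁻ x, ENNReal.ofReal (gradNorm f x ^ q) ∂μ = ENNReal.ofReal G :=
    (ofReal_integral_eq_lintegral_ofReal hgrad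
      (.of_forall fun x => Real.rpow_nonneg (gradNorm_nonneg f x) q)).symm
  have hgm : Measurable fun x => |f x - m| ^ q :=
    (hfc.sub continuous_const).abs.measurable.pow_const q
  have hg0 : ∀ x, 0 ≤ |f x - m| ^ q := fun x => by positivity
  have hm1' := hm1
  rw [conv, conv] at hm1'
  have b1 := cancel _ _ hm1'
  rw [hGl, ← ENNReal.ofReal_mul hC0.le] at b1
  obtain ⟨i1, l1⟩ := integrable_and_integral_le_of_lintegral_le hgm hg0 (by positivity) b1
  set t := ∫ x, |f x - m| ^ q ∂μ with ht
  have ht0 : 0 ≤ t := integral_nonneg hg0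
  -- The centred bound divides by `t`. If `t = 0`, then `f` is almost everywhere equal to `m` and
  -- its entropy is zero.
  rcases ht0.eq_or_lt with h0 | htpos
  · have hz := (integral_eq_zero_iff_of_nonneg hg0 i1).1 h0.symm
    have hfm : ∀ᵐ x ∂μ, f x = m := by
      filter_upwards [hz] with x hx
      have : |f x - m| = 0 := by
        by_contra hne
        have : 0 < |f x - m| ^ q := Real.rpow_pos_of_pos (lt_of_le_of_ne (abs_nonneg _)
          (Ne.symm hne)) q
        exact this.ne' hx
      exact sub_eq_zero.1 (abs_eq_zero.1 this)
    have hmean : ∫ y, |f y| ^ q ∂μ = |m| ^ q := by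
      have : ∫ y, |f y| ^ q ∂μ = ∫ y, |m| ^ q ∂μ :=
        integral_congr_ae (hfm.mono fun x hx => by simp only [hx])
      rw [this]; simp
    have hzero : (fun x => |f x| ^ q * Real.log (|f x| ^ q / ∫ y, |f y| ^ q ∂μ)) =ᵐ[μ]
        fun _ => 0 := by
      filter_upwards [hfm] with x hx
      rw [hmean, hx]
      by_cases hm0 : |m| ^ q = 0
      · simp [hm0]
      · simp [div_self hm0]
    refine ⟨(integrable_const (|m| ^ q)).congr (hfm.mono fun x hx => by simp only [hx]),
      (integrable_zero _ _ _).congr hzero.symm, ?_⟩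
    rw [integral_congr_ae hzero, integral_zero]
    positivity
  · have hQ : ∫⁻ x, ENNReal.ofReal (Real.exp (-U x)) * ENNReal.ofReal (|f x - m| ^ q) ≤
        ENNReal.ofReal (Z * t) := by
      rw [conv, ENNReal.ofReal_mul hZ0.le, ht,
        ofReal_integral_eq_lintegral_ofReal i1 (.of_forall hg0)]
    have b2 := hm2 (Z * t) Z (by positivity) hZ0 hZl.le hQ
    rw [conv, conv] at b2
    have b2' := cancel _ _ b2
    rw [hGl, ← ENNReal.ofReal_mul hC0.le, mul_div_cancel_left₀ _ hZ0.ne'] at b2'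
    obtain ⟨i2, l2⟩ := integrable_and_integral_le_of_lintegral_le
      (hgm.mul (Real.continuous_posLog.measurable.comp (hgm.div_const t)))
      (fun x => mul_nonneg (hg0 x) Real.posLog_nonneg) (by positivity) b2'
    obtain ⟨j1, j2, j3⟩ := entropy_le_of_centered μ hq hq2 hfc.measurable m i1 htpos i2
    refine ⟨j1, j2, j3.trans ?_⟩
    have l2' : ∫ x, |f x - m| ^ q * Real.posLog (|f x - m| ^ q / t) ∂μ ≤ C * G := l2
    rw [← ht]
    linarith

/-! ### Radial potentials are confining, uniformly in the linear term. -/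

theorem rpow_mul_sub_le {p s t : ℝ} (hp : 1 ≤ p) (hs : 0 ≤ s) (hst : s ≤ t) :
    t ^ (p - 1) * (t - s) ≤ t ^ p - s ^ p := by
  rcases hs.eq_or_lt with h0 | h0
  · rcases (hs.trans hst).eq_or_lt with h | h
    · simp [← h0, ← h]
    · rw [← h0, sub_zero, ← Real.rpow_add_one h.ne', sub_add_cancel,
        Real.zero_rpow (by linarith), sub_zero]
  have ht : 0 < t := lt_of_lt_of_le h0 hst
  have e1 : t ^ p = t ^ (p - 1) * t := by rw [← Real.rpow_add_one ht.ne', sub_add_cancel]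
  have e2 : s ^ p = s ^ (p - 1) * s := by rw [← Real.rpow_add_one h0.ne', sub_add_cancel]
  have e3 : s ^ (p - 1) ≤ t ^ (p - 1) := Real.rpow_le_rpow hs hst (by linarith)
  have := mul_le_mul_of_nonneg_right e3 hs
  rw [e1, e2]; linarith

/-- For `p = 2` the two terms merge with coefficient `α + κ ≥ c₀`. For `p > 2` the power dominates
once `t^(p-2) ≥ 4K/α`, and below this threshold `C` pays for everything. The bound `c ≤ 1` lets the
same `c` serve for the linear term `L * d`. -/
theorem exists_radial_lower {α p K c₀ : ℝ} (hp : 2 ≤ p) (hα : 0 < α) (hK : 0 ≤ K) (hc₀ : 0 < c₀) :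
    ∃ c C : ℝ, 0 < c ∧ c ≤ 1 ∧ 0 ≤ C ∧ ∀ κ : ℝ, |κ| ≤ K → (p = 2 → c₀ ≤ α + κ) →
      ∀ s t : ℝ, 0 ≤ s → s ≤ t →
        c * ((1 + t) ^ (p - 1) * (t - s)) - C ≤ α * (t ^ p - s ^ p) + κ * (t ^ 2 - s ^ 2) := by
  obtain ⟨b, R, hb, hR, hbR⟩ : ∃ b R : ℝ, 0 < b ∧ 1 ≤ R ∧ ∀ κ : ℝ, |κ| ≤ K →
      (p = 2 → c₀ ≤ α + κ) → ∀ s t : ℝ, 0 ≤ s → s ≤ t → R ≤ t →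
        b * (t ^ (p - 1) * (t - s)) ≤ α * (t ^ p - s ^ p) + κ * (t ^ 2 - s ^ 2) := by
    rcases hp.eq_or_lt with h2 | h2
    · refine ⟨c₀, 1, hc₀, le_rfl, fun κ _ hκ s t hs hst ht => ?_⟩
      have hk := hκ h2.symm
      rw [← h2, Real.rpow_two, Real.rpow_two, show (2 : ℝ) - 1 = 1 by norm_num, Real.rpow_one]
      have h3 : t * (t - s) ≤ t ^ 2 - s ^ 2 := by nlinarith
      have h4 : 0 ≤ t * (t - s) := mul_nonneg (hs.trans hst) (by linarith)
      nlinarith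
    · have htend := tendsto_rpow_atTop (y := p - 2) (by linarith)
      obtain ⟨R, hR⟩ := Filter.eventually_atTop.1 (htend.eventually_ge_atTop (4 * K / α))
      refine ⟨α / 2, max 1 R, by positivity, le_max_left _ _, fun κ hκ _ s t hs hst ht => ?_⟩
      have ht1 : 1 ≤ t := (le_max_left _ _).trans ht
      have ht0 : 0 < t := by linarith
      have h3 := hR t ((le_max_right _ _).trans ht)
      rw [div_le_iff₀ hα] at h3
      have e : t ^ (p - 1) = t ^ (p - 2) * t := by
        rw [← Real.rpow_add_one ht0.ne']; congr 1; ring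
      have h4 := rpow_mul_sub_le (by linarith : 1 ≤ p) hs hst
      have h5 : -(K * (2 * t * (t - s))) ≤ κ * (t ^ 2 - s ^ 2) := by
        have h6 : t ^ 2 - s ^ 2 ≤ 2 * t * (t - s) := by nlinarith
        have h7 : 0 ≤ t ^ 2 - s ^ 2 := by nlinarith
        have h8 := (abs_le.1 hκ).1
        nlinarith
      have h6 : K * (2 * t * (t - s)) ≤ α / 2 * (t ^ (p - 1) * (t - s)) := by
        rw [e]
        have : 0 ≤ t * (t - s) := mul_nonneg ht0.le (by linarith)
        have := mul_le_mul_of_nonneg_right h3 this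
        linarith
      have h7 := mul_le_mul_of_nonneg_left h4 hα.le
      linarith
  have hR0 : 0 < R := by linarith
  set c := min 1 (b / 2 ^ (p - 1)) with hc
  have hc0 : 0 < c := lt_min one_pos (by positivity)
  have hc1 : c ≤ 1 := min_le_left _ _
  refine ⟨c, (1 + R) ^ (p - 1) * R + K * R ^ 2, hc0, hc1, by positivity, ?_⟩
  intro κ hκ hκ2 s t hs hst
  have ht : 0 ≤ t := hs.trans hst
  rcases le_or_gt R t with h | h
  · have h1 := hbR κ hκ hκ2 s t hs hst h
    have h2 : c * (1 + t) ^ (p - 1) ≤ b * t ^ (p - 1) := by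
      have e1 : (1 + t) ^ (p - 1) ≤ 2 ^ (p - 1) * t ^ (p - 1) := by
        rw [← Real.mul_rpow (by norm_num) ht]
        exact Real.rpow_le_rpow (by linarith) (by linarith) (by linarith)
      calc c * (1 + t) ^ (p - 1) ≤ b / 2 ^ (p - 1) * (2 ^ (p - 1) * t ^ (p - 1)) := by
            gcongr; exact min_le_right _ _
        _ = b * t ^ (p - 1) := by field_simp
    have h3 := mul_le_mul_of_nonneg_right h2 (by linarith : 0 ≤ t - s)
    have h4 : 0 ≤ (1 + R) ^ (p - 1) * R + K * R ^ 2 := by positivity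
    linarith
  · have h1 : c * ((1 + t) ^ (p - 1) * (t - s)) ≤ (1 + R) ^ (p - 1) * R := by
      calc c * ((1 + t) ^ (p - 1) * (t - s)) ≤ 1 * ((1 + R) ^ (p - 1) * R) := by
            have : 0 ≤ t - s := by linarith
            have : 0 ≤ p - 1 := by linarith
            gcongr
            linarith
        _ = _ := one_mul _
    have h2 : -(K * R ^ 2) ≤ κ * (t ^ 2 - s ^ 2) := by
      have h6 : t ^ 2 - s ^ 2 ≤ R ^ 2 := by nlinarith
      have h7 : 0 ≤ t ^ 2 - s ^ 2 := by nlinarith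
      have h8 := (abs_le.1 hκ).1
      nlinarith
    have h3 : 0 ≤ α * (t ^ p - s ^ p) := by
      have := Real.rpow_le_rpow hs hst (by linarith : 0 ≤ p)
      exact mul_nonneg hα.le (by linarith)
    linarith

theorem radial_upper {α p K κ s t : ℝ} (hp : 2 ≤ p) (hα : 0 ≤ α) (hκ : |κ| ≤ K) (hs : 0 ≤ s)
    (hst : s ≤ t) :
    α * (t ^ p - s ^ p) + κ * (t ^ 2 - s ^ 2) ≤
      (α * p + 2 * K) * ((1 + t) ^ (p - 1) * (t - s)) := by
  have ht : 0 ≤ t := hs.trans hst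
  have hK : 0 ≤ K := (abs_nonneg κ).trans hκ
  have hts : 0 ≤ t - s := by linarith
  have h1 := Real.rpow_sub_rpow_le (by linarith : 1 ≤ p) hs hst
  have h2 : t ^ (p - 1) ≤ (1 + t) ^ (p - 1) := Real.rpow_le_rpow ht (by linarith) (by linarith)
  have h3 : t ≤ (1 + t) ^ (p - 1) := by
    calc t ≤ (1 + t) ^ (1 : ℝ) := by rw [Real.rpow_one]; linarith
      _ ≤ _ := Real.rpow_le_rpow_of_exponent_le (by linarith) (by linarith)
  have h4 : κ * (t ^ 2 - s ^ 2) ≤ 2 * K * ((1 + t) ^ (p - 1) * (t - s)) := by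
    have h6 : t ^ 2 - s ^ 2 ≤ 2 * (t * (t - s)) := by nlinarith
    have h7 : 0 ≤ t ^ 2 - s ^ 2 := by nlinarith
    calc κ * (t ^ 2 - s ^ 2) ≤ K * (2 * (t * (t - s))) :=
          mul_le_mul ((le_abs_self κ).trans hκ) h6 h7 hK
      _ ≤ K * (2 * ((1 + t) ^ (p - 1) * (t - s))) := by gcongr
      _ = _ := by ring
  have h5 : α * (t ^ p - s ^ p) ≤ α * p * ((1 + t) ^ (p - 1) * (t - s)) := by
    calc α * (t ^ p - s ^ p) ≤ α * (p * t ^ (p - 1) * (t - s)) := by gcongr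
      _ ≤ α * (p * (1 + t) ^ (p - 1) * (t - s)) := by gcongr
      _ = _ := by ring
  linarith

/-- `α d^p + κ d² + L d` plus a bounded perturbation is confining, uniformly in `L ≥ 0`. -/
theorem exists_isConfining {α p K c₀ b : ℝ} (hp : 2 ≤ p) (hα : 0 < α) (hK : 0 ≤ K) (hc₀ : 0 < c₀)
    (hb : 0 ≤ b) :
    ∃ c₁ C₁ C₂ : ℝ, 0 < c₁ ∧ 0 ≤ C₁ ∧ 0 ≤ C₂ ∧ ∀ κ L : ℝ, |κ| ≤ K → (p = 2 → c₀ ≤ α + κ) →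
      0 ≤ L → ∀ B : Heis → ℝ, Measurable B → (∀ x, |B x| ≤ b) →
      IsConfining p c₁ C₁ C₂ L fun x => α * d x ^ p + κ * d x ^ 2 + L * d x + B x := by
  obtain ⟨c, C, hc0, hc1, hC0, hlow⟩ := exists_radial_lower hp hα hK hc₀
  refine ⟨c, α * p + 2 * K + 1, C + 2 * b, hc0, by positivity, by positivity, ?_⟩
  intro κ L hκ hκ2 hL B hBm hB
  refine ⟨?_, hL, ?_, ?_, ?_⟩
  · have := continuous_d.measurable
    exact ((((this.pow_const p).const_mul α).add ((this.pow_const 2).const_mul κ)).add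
      (this.const_mul L)).add hBm
  · have := hB 0
    rw [d_zero, Real.zero_rpow (by linarith)]
    norm_num
    linarith
  · intro x y hxy
    have h1 := radial_upper hp hα.le hκ (d_nonneg y) hxy
    have hx := (abs_le.1 (hB x)).2
    have hy := (abs_le.1 (hB y)).1
    have h2 : 0 ≤ d x - d y := by linarith
    have h3 : 0 ≤ (1 + d x) ^ (p - 1) * (d x - d y) := by
      have := d_nonneg x
      positivity
    have h4 : 0 ≤ (α * p + 2 * K) * (L * (d x - d y)) := by positivity
    unfold rate
    linarith
  · intro x y hxy
    have h1 := hlow κ hκ hκ2 (d y) (d x) (d_nonneg y) hxy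
    have hx := (abs_le.1 (hB x)).1
    have hy := (abs_le.1 (hB y)).2
    have h2 : 0 ≤ L * (d x - d y) := mul_nonneg hL (by linarith)
    have h3 := mul_le_mul_of_nonneg_right hc1 h2
    unfold rate
    linarith

end Heis

/-! ### The lattice model and the conclusion. -/

namespace Site

/-- Neighbours have the form `i ± e_l`. The upper bound suffices: it controls the potential terms
and gives the worst case when `ε < 0`. -/
theorem card_neighbors_le {N : ℕ} (i : Site N) : (neighbors i).card ≤ 2 * N := by
  have hsub : neighbors i ⊆ (Finset.univ : Finset (Fin N × Bool)).image
      fun z => i + Pi.single z.1 (if z.2 then 1 else -1) := by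
    intro j hj
    rw [mem_neighbors] at hj
    have hne : ∃ l, i l ≠ j l := by
      by_contra hcon
      push Not at hcon
      simp [dist1, hcon] at hj
    obtain ⟨l, hl⟩ := hne
    have hsplit : |i l - j l| + ∑ l' ∈ Finset.univ.erase l, |i l' - j l'| = 1 := by
      rw [← hj, dist1, Finset.add_sum_erase _ (fun l => |i l - j l|) (Finset.mem_univ l)]
    have h1 : 1 ≤ |i l - j l| := Int.one_le_abs (sub_ne_zero.2 hl)
    have h2 : 0 ≤ ∑ l' ∈ Finset.univ.erase l, |i l' - j l'| :=
      Finset.sum_nonneg fun _ _ => abs_nonneg _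
    have h3 : |i l - j l| = 1 := by linarith
    have h4 : ∑ l' ∈ Finset.univ.erase l, |i l' - j l'| = 0 := by linarith
    rw [Finset.sum_eq_zero_iff_of_nonneg fun _ _ => abs_nonneg _] at h4
    rw [Finset.mem_image]
    refine ⟨(l, decide (j l - i l = 1)), Finset.mem_univ _, ?_⟩
    funext l'
    by_cases hll : l' = l
    · subst hll
      simp only [Pi.add_apply, Pi.single_eq_same, decide_eq_true_eq]
      split_ifs with hcase
      · omega
      · rcases abs_eq (by norm_num : (0 : ℤ) ≤ 1) |>.1 h3 with h | h <;> omega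
    · have := h4 l' (Finset.mem_erase.2 ⟨hll, Finset.mem_univ _⟩)
      rw [abs_eq_zero] at this
      simp only [Pi.add_apply, Pi.single_eq_of_ne hll]
      omega
  refine (Finset.card_le_card hsub).trans (Finset.card_image_le.trans ?_)
  simp [mul_comm]

end Site

namespace Config

variable {N : ℕ}

theorem siteGradNorm_glue (i : Site N) (f : Config N → ℝ) (x : Heis) (ω : Config N) :
    siteGradNorm i f (glue i x ω) = Heis.gradNorm (fun y => f (glue i y ω)) x := by
  simp [siteGradNorm, siteDeriv, Heis.gradNorm, glue]

/-- The boundary condition survives in the coefficient of `Heis.d x` and in the bounded potential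
term; the last sum is constant in `x` and disappears in the normalisation. -/
theorem energy_eq (α p ε ρ θ : ℝ) (φ : Sym2 (Site N) → Config N → ℝ) (i : Site N) (ω : Config N)
    (x : Heis) :
    energy α p ε ρ θ φ i ω x =
      (α * Heis.d x ^ p + (ε * (Site.neighbors i).card) * Heis.d x ^ 2 +
        (2 * (ε * ρ) * ∑ j ∈ Site.neighbors i, Heis.d (ω j)) * Heis.d x +
        θ * ∑ j ∈ Site.neighbors i, φ s(i, j) (glue i x ω)) +
      ε * ∑ j ∈ Site.neighbors i, (ρ * Heis.d (ω j)) ^ 2 := by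
  have e : ∑ j ∈ Site.neighbors i, (Heis.d x + ρ * Heis.d (ω j)) ^ 2 =
      (Site.neighbors i).card * Heis.d x ^ 2 +
      (2 * ρ * Heis.d x) * ∑ j ∈ Site.neighbors i, Heis.d (ω j) +
      ∑ j ∈ Site.neighbors i, (ρ * Heis.d (ω j)) ^ 2 := by
    rw [Finset.mul_sum, ← nsmul_eq_mul, ← Finset.sum_const, ← Finset.sum_add_distrib,
      ← Finset.sum_add_distrib]
    exact Finset.sum_congr rfl fun j _ => by ring
  rw [energy, e]
  ring

end Config

end

theorem theorem4p1 (N : ℕ) (hN : 1 ≤ N) (p q α ε ρ θ : ℝ)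
    (φ : Sym2 (Site N) → Config N → ℝ) (hφ : Config.IsBoundedPotential φ)
    (hp : 2 ≤ p) (hpq : 1 / p + 1 / q = 1) (hα : 0 < α) (hερ : 0 < ε * ρ)
    (hε : p = 2 → -(α / (2 * (N : ℝ))) < ε) :
    ∃ c : ℝ, 0 < c ∧ ∀ (i : Site N) (ω : Config N),
      IsProbabilityMeasure (Config.siteMeasure α p ε ρ θ φ i ω) ∧
      ∀ f : Config N → ℝ, Config.IsC ((⊤ : ℕ∞) : WithTop ℕ∞) f →
        -- if `E_i^ω(|∇ᵢ f|^q) = ∞` there is nothing to prove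
        Integrable (fun x => Config.siteGradNorm i f (Config.glue i x ω) ^ q)
          (Config.siteMeasure α p ε ρ θ φ i ω) →
        Integrable (fun x => |f (Config.glue i x ω)| ^ q)
          (Config.siteMeasure α p ε ρ θ φ i ω) ∧
        Integrable (fun x => |f (Config.glue i x ω)| ^ q *
            Real.log (|f (Config.glue i x ω)| ^ q /
              ∫ y, |f (Config.glue i y ω)| ^ q ∂(Config.siteMeasure α p ε ρ θ φ i ω)))
          (Config.siteMeasure α p ε ρ θ φ i ω) ∧
        ∫ x, |f (Config.glue i x ω)| ^ q *
            Real.log (|f (Config.glue i x ω)| ^ q /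
              ∫ y, |f (Config.glue i y ω)| ^ q ∂(Config.siteMeasure α p ε ρ θ φ i ω))
          ∂(Config.siteMeasure α p ε ρ θ φ i ω)
        ≤ c * ∫ x, Config.siteGradNorm i f (Config.glue i x ω) ^ q
          ∂(Config.siteMeasure α p ε ρ θ φ i ω) := by
  obtain ⟨M, hM0, hM⟩ := hφ
  have hN0 : (0 : ℝ) < N := by exact_mod_cast hN
  have hp0 : 0 < p := by linarith
  have hq0 : q ≠ 0 := by
    rintro rfl
    rw [div_zero, add_zero, div_eq_one_iff_eq hp0.ne'] at hpq
    linarith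
  have hpq1 : q + p = p * q := by
    field_simp at hpq
    linarith
  have hpq2 : (p - 1) * (q - 1) = 1 := by linear_combination -hpq1
  have hq1 : 1 < q := by
    have : 0 < q - 1 := pos_of_mul_pos_right (by rw [hpq2]; exact one_pos) (by linarith : 0 ≤ p - 1)
    linarith
  have hq2 : q ≤ 2 := by nlinarith
  -- Lower bound for the quadratic coefficient `α + ε * card` when `p = 2`: for `ε ≥ 0` it is at
  -- least `α`, for `ε < 0` the worst case is `2 * N` neighbours, and `ε > -α/(2N)` makes the result
  -- positive.
  set c₀ := α + min 0 (2 * N * ε) with hc₀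
  have hcard : ∀ i : Site N, ((Site.neighbors i).card : ℝ) ≤ 2 * N := fun i => by
    exact_mod_cast Site.card_neighbors_le i
  obtain ⟨e₀, he₀, hκ₀⟩ : ∃ e₀ : ℝ, 0 < e₀ ∧
      ∀ i : Site N, p = 2 → e₀ ≤ α + ε * (Site.neighbors i).card := by
    by_cases h2 : p = 2
    · have hε' := hε h2
      have h3 : 0 < c₀ := by
        rw [hc₀]
        rcases le_total 0 (2 * N * ε) with h | h
        · rw [min_eq_left h]; linarith
        · rw [min_eq_right h]
          rw [neg_lt, ← sub_pos] at hε'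
          have := mul_pos (by positivity : (0 : ℝ) < 2 * N) hε'
          field_simp at this
          nlinarith
      refine ⟨c₀, h3, fun i _ => ?_⟩
      rw [hc₀]
      gcongr
      have hc := hcard i
      have hc' : (0 : ℝ) ≤ (Site.neighbors i).card := Nat.cast_nonneg _
      rcases le_total 0 ε with h | h
      · exact (min_le_left _ _).trans (by positivity)
      · refine (min_le_right _ _).trans ?_
        nlinarith
    · exact ⟨1, one_pos, fun i h => absurd h h2⟩
  -- All constants are fixed before `i` and `ω`: the quadratic coefficient and the perturbation are
  -- bounded uniformly, and the one unbounded quantity, `L`, does not enter them.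
  obtain ⟨c₁, C₁, C₂, hc₁, hC₁, hC₂, hconf⟩ := Heis.exists_isConfining (K := |ε| * (2 * N))
    (b := |θ| * (2 * N * M)) hp hα (by positivity) he₀ (by positivity)
  obtain ⟨c, hc, hLS⟩ := Heis.exists_logSobolev (by linarith : 1 ≤ p) hq1 hq2 hpq2 hc₁ hC₁ hC₂
  refine ⟨c, hc, fun i ω => ?_⟩
  set L := 2 * (ε * ρ) * ∑ j ∈ Site.neighbors i, Heis.d (ω j) with hL
  set B : Heis → ℝ := fun x => θ * ∑ j ∈ Site.neighbors i, φ s(i, j) (Config.glue i x ω) with hB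
  have hBm : Measurable B := by
    refine (Continuous.measurable ?_)
    refine continuous_const.mul (continuous_finsetSum _ fun j hj => ?_)
    exact ((hM i j (Site.mem_neighbors.1 hj)).1 i ω).continuous
  have hBb : ∀ x, |B x| ≤ |θ| * (2 * N * M) := by
    intro x
    rw [hB, abs_mul]
    gcongr
    calc |∑ j ∈ Site.neighbors i, φ s(i, j) (Config.glue i x ω)|
        ≤ ∑ j ∈ Site.neighbors i, |φ s(i, j) (Config.glue i x ω)| := Finset.abs_sum_le_sum_abs _ _
      _ ≤ ∑ j ∈ Site.neighbors i, M :=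
          Finset.sum_le_sum fun j hj => (hM i j (Site.mem_neighbors.1 hj)).2.2.1 _
      _ = (Site.neighbors i).card * M := by rw [Finset.sum_const, nsmul_eq_mul]
      _ ≤ 2 * N * M := by gcongr; exact hcard i
  have hU := hconf (ε * (Site.neighbors i).card) L
    (by rw [abs_mul, Nat.abs_cast]; gcongr; exact hcard i) (hκ₀ i)
    (mul_nonneg (by linarith) (Finset.sum_nonneg fun j _ => Heis.d_nonneg _)) B hBm hBb
  have hμ : Config.siteMeasure α p ε ρ θ φ i ω = (volume : Measure Heis).tilted fun x =>
      -(α * Heis.d x ^ p + (ε * (Site.neighbors i).card) * Heis.d x ^ 2 + L * Heis.d x + B x) := by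
    refine Eq.trans ?_ (Measure.tilted_add_const _ _
      (-(ε * ∑ j ∈ Site.neighbors i, (ρ * Heis.d (ω j)) ^ 2)))
    rw [Config.siteMeasure]
    congr 1
    funext x
    rw [Config.energy_eq, neg_add]
  obtain ⟨h1, h2⟩ := hLS L _ hU
  rw [hμ]
  refine ⟨h1, fun f hf => ?_⟩
  simp only [Config.siteGradNorm_glue]
  exact h2 (fun x => f (Config.glue i x ω)) ((hf i ω).of_le (by exact_mod_cast le_top))
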